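/- Let $n\in\mathbb N$ and let $0\le d<n-1$ be a real number. Let $\Gamma\subset\mathbb R^n$ be a nonempty closed set which is $d$-Ahlfors regular, that is, for some constant $C_0\ge 1$, $C_0^{-1}r^d\le \mathcal H^d(\Gamma\cap B(x,r))\le C_0r^d$ for all $x\in\Gamma$ and $r>0$. Put $\Omega=\mathbb R^n\setminus\Gamma$, $w(x)=\operatorname{dist}(x,\Gamma)^{-n+d+1}$ for $x\in\Omega$, and $\sigma=\mathcal H^d|_\Gamma$. Let $W=\dot W^{1,2}_w(\Omega)$ be the space of functions $u\in L^1_{\rm loc}(\Omega)$ (real valued, modulo equality a.e.) whose distributional gradient in $\Omega$ lies in $L^2(\Omega,w)$, with $\|u\|_W=\big(\int_\Omega|\nabla u|^2w\,dx\big)^{1/2}$, and let $H=\dot H^{1/2}(\Gamma)$ be the space of $\sigma$-measurable functions $g:\Gamma\to\mathbb R$ (modulo equality $\sigma$-a.e.) for which $\|g\|_H^2=\int_\Gamma\int_\Gamma\frac{|g(x)-g(y)|^2}{|x-y|^{d+1}}\,d\sigma(x)\,d\sigma(y)$ is finite (the integrand being taken as $0$ for $x=y$). Then there are linear operators $T:W\to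 H$ and $E:H\to W$ which are bounded, i.e. $\|Tu\|_H\le C\|u\|_W$ for all $u\in W$ and $\|Eg\|_W\le C\|g\|_H$ for all $g\in H$, with a finite constant $C$, and which satisfy $T\circ E=I_H$. Moreover, for every $u\in W$ and $\sigma$-almost every $x\in\Gamma$, $u$ is integrable on $B(x,r)$ for all small $r>0$, $$Tu(x)=\lim_{r\to0}\frac1{|B(x,r)|}\int_{B(x,r)}u(y)\,dy\qquad\text{and}\qquad \lim_{r\to0}\frac1{|B(x,r)|}\int_{B(x,r)}|u(y)-Tu(x)|\,dy=0 .$$ Similarly, for every $g\in H$ and $\sigma$-almost every $x\in\Gamma$, $$\lim_{r\to0}\frac1{\sigma(B(x,r))}\int_{\Gamma\cap B(x,r)}|g(y)-g(x)|\,d\sigma(y)=0 .$$ -/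

import Mathlib

open MeasureTheory Measure Filter Topology Set Metric
open scoped ContDiff ENNReal

noncomputable section

namespace HigherCodim

/-- `ℝⁿ` with its Euclidean norm. -/
abbrev Space (n : ℕ) : Type := EuclideanSpace ℝ (Fin n)

/-- `Γ` is a nonempty closed `d`-Ahlfors regular subset of `ℝⁿ`:
`C₀⁻¹ r^d ≤ H^d(Γ ∩ B(x,r)) ≤ C₀ r^d` for all `x ∈ Γ` and all `r > 0`. -/
structure IsAhlforsRegular {n : ℕ} (d : ℝ) (Γ : Set (Space n)) : Prop where
  isClosed : IsClosed Γ
  nonempty : Γ.Nonempty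
  regular : ∃ C₀ : ℝ, 1 ≤ C₀ ∧ ∀ x ∈ Γ, ∀ r : ℝ, 0 < r →
    ENNReal.ofReal (C₀⁻¹ * r ^ d) ≤ μH[d] (Γ ∩ ball x r) ∧
    μH[d] (Γ ∩ ball x r) ≤ ENNReal.ofReal (C₀ * r ^ d)

/-- The measure `σ`: the restriction to `Γ` of the `d`-dimensional Hausdorff measure. -/
def surfaceMeasure {n : ℕ} (d : ℝ) (Γ : Set (Space n)) : Measure (Space n) :=
  (μH[d] : Measure (Space n)).restrict Γ

/-- The weight `w(x) = dist(x, Γ)^(-n+d+1)`. -/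
def weight {n : ℕ} (d : ℝ) (Γ : Set (Space n)) (x : Space n) : ℝ :=
  infDist x Γ ^ (-(n : ℝ) + d + 1)

/-- `u ∈ L¹_loc(Ω)` has distributional gradient `G ∈ L¹_loc(Ω)` in `Ω`. The vector identity
`∫ u ∇φ = - ∫ φ G` is tested against every direction `v`. -/
structure HasWeakGradient {n : ℕ} (Ω : Set (Space n)) (u : Space n → ℝ)
    (G : Space n → Space n) : Prop where
  locallyIntegrableOn : LocallyIntegrableOn u Ω
  locallyIntegrableOn_grad : LocallyIntegrableOn G Ω
  integral_eq : ∀ φ : Space n → ℝ, ContDiff ℝ ∞ φ → HasCompactSupport φ → tsupport φ ⊆ Ω →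
    ∀ v : Space n, ∫ x in Ω, u x * fderiv ℝ φ x v = - ∫ x in Ω, φ x * inner ℝ (G x) v

/-- The distributional gradient of `u` in `Ω` (zero if there is none in `L¹_loc(Ω)`). -/
def weakGradient {n : ℕ} (Ω : Set (Space n)) (u : Space n → ℝ) : Space n → Space n :=
  open Classical in if h : ∃ G, HasWeakGradient Ω u G then h.choose else 0

theorem hasWeakGradient_weakGradient {n : ℕ} {Ω : Set (Space n)} {u : Space n → ℝ}
    (h : ∃ G, HasWeakGradient Ω u G) : HasWeakGradient Ω u (weakGradient Ω u) := by
  rw [weakGradient, dif_pos h]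
  exact h.choose_spec

theorem integrableOn_mul_of_tsupport {n : ℕ} {Ω : Set (Space n)} {u φ : Space n → ℝ}
    (hu : LocallyIntegrableOn u Ω) (hφ : Continuous φ) (hc : HasCompactSupport φ)
    (hs : tsupport φ ⊆ Ω) : IntegrableOn (fun x => u x * φ x) Ω := by
  have hK : IntegrableOn (fun x => u x * φ x) (tsupport φ) :=
    (hu.integrableOn_compact_subset hs hc).mul_continuousOn hφ.continuousOn hc
  refine IntegrableOn.mono_set (t := univ) ?_ (subset_univ _)
  refine hK.of_forall_sdiff_eq_zero MeasurableSet.univ ?_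
  intro x hx
  simp [image_eq_zero_of_notMem_tsupport hx.2]

theorem HasWeakGradient.integrable_left {n : ℕ} {Ω : Set (Space n)} {u φ : Space n → ℝ}
    {G : Space n → Space n} (h : HasWeakGradient Ω u G) (hφ : ContDiff ℝ ∞ φ)
    (hc : HasCompactSupport φ) (hs : tsupport φ ⊆ Ω) (v : Space n) :
    IntegrableOn (fun x => u x * fderiv ℝ φ x v) Ω := by
  have hsub : tsupport (fun x => fderiv ℝ φ x v) ⊆ tsupport φ :=
    closure_minimal (fun x hx => by
      by_contra hn
      apply hx
      have : fderiv ℝ φ x = 0 := by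
        by_contra h0
        exact hn (support_fderiv_subset ℝ h0)
      simp [this]) (isClosed_tsupport φ)
  refine integrableOn_mul_of_tsupport h.locallyIntegrableOn ?_
    (hc.of_isClosed_subset (isClosed_tsupport _) hsub) (hsub.trans hs)
  exact (hφ.continuous_fderiv (by simp)).clm_apply continuous_const

theorem HasWeakGradient.integrable_right {n : ℕ} {Ω : Set (Space n)} {u φ : Space n → ℝ}
    {G : Space n → Space n} (h : HasWeakGradient Ω u G) (hφ : ContDiff ℝ ∞ φ)
    (hc : HasCompactSupport φ) (hs : tsupport φ ⊆ Ω) (v : Space n) :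
    IntegrableOn (fun x => φ x * inner ℝ (G x) v) Ω := by
  have hG : LocallyIntegrableOn (fun x => inner ℝ (G x) v) Ω := fun x hx => by
    obtain ⟨s, hs, hi⟩ := h.locallyIntegrableOn_grad x hx
    exact ⟨s, hs, Integrable.inner_const hi v⟩
  have := integrableOn_mul_of_tsupport hG hφ.continuous hc hs
  simpa only [mul_comm] using this

/-- The distributional gradient in an open set is unique up to null sets. -/
theorem HasWeakGradient.ae_eq {n : ℕ} {Ω : Set (Space n)} (hΩ : IsOpen Ω) {u : Space n → ℝ}
    {G G' : Space n → Space n} (h : HasWeakGradient Ω u G) (h' : HasWeakGradient Ω u G') :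
    G =ᵐ[volume.restrict Ω] G' := by
  have key : ∀ᵐ x, x ∈ Ω → (G - G') x = 0 := by
    refine hΩ.ae_eq_zero_of_integral_contDiff_smul_eq_zero
      (h.locallyIntegrableOn_grad.sub h'.locallyIntegrableOn_grad) fun φ hφ hc hs => ?_
    have hL : LocallyIntegrableOn (G - G') Ω :=
      h.locallyIntegrableOn_grad.sub h'.locallyIntegrableOn_grad
    have hz : ∀ x, x ∉ Ω → φ x • (G - G') x = 0 := fun x hx => by
      rw [image_eq_zero_of_notMem_tsupport (fun hm => hx (hs hm)), zero_smul]
    have hi : IntegrableOn (fun x => φ x • (G - G') x) Ω := by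
      have hK : IntegrableOn (fun x => φ x • (G - G') x) (tsupport φ) :=
        (hL.integrableOn_compact_subset hs hc).continuousOn_smul hφ.continuous.continuousOn hc
      refine IntegrableOn.mono_set (t := univ) ?_ (subset_univ _)
      refine hK.of_forall_sdiff_eq_zero MeasurableSet.univ ?_
      intro x hx
      simp [image_eq_zero_of_notMem_tsupport hx.2]
    rw [← setIntegral_eq_integral_of_forall_compl_eq_zero hz]
    refine ext_inner_left ℝ fun v => ?_
    rw [inner_zero_right, ← integral_inner hi v]
    have e := (h.integral_eq φ hφ hc hs v).symm.trans (h'.integral_eq φ hφ hc hs v)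
    have e2 := integral_sub (h.integrable_right hφ hc hs v) (h'.integrable_right hφ hc hs v)
    rw [neg_inj.mp e, sub_self] at e2
    rw [← e2]
    congr 1
    ext x
    rw [inner_smul_right, Pi.sub_apply, inner_sub_right, mul_sub, real_inner_comm,
      real_inner_comm (G' x)]
  refine (ae_restrict_iff' hΩ.measurableSet).2 ?_
  filter_upwards [key] with x hx hm
  exact sub_eq_zero.1 (hx hm)

theorem HasWeakGradient.congr {n : ℕ} {Ω : Set (Space n)}
    {u u' : Space n → ℝ} {G : Space n → Space n} (h : HasWeakGradient Ω u G)
    (e : u =ᵐ[volume.restrict Ω] u') : HasWeakGradient Ω u' G where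
  locallyIntegrableOn := fun x hx => by
    obtain ⟨s, hs, hi⟩ := h.locallyIntegrableOn x hx
    refine ⟨s ∩ Ω, inter_mem hs self_mem_nhdsWithin, ?_⟩
    exact (hi.mono_set inter_subset_left).congr_fun_ae
      (ae_mono (Measure.restrict_mono inter_subset_right le_rfl) e)
  locallyIntegrableOn_grad := h.locallyIntegrableOn_grad
  integral_eq := fun φ hφ hc hs v => by
    rw [← h.integral_eq φ hφ hc hs v]
    refine integral_congr_ae ?_
    filter_upwards [e] with x hx
    rw [hx]

theorem HasWeakGradient.add {n : ℕ} {Ω : Set (Space n)} {u u' : Space n → ℝ}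
    {G G' : Space n → Space n} (h : HasWeakGradient Ω u G) (h' : HasWeakGradient Ω u' G') :
    HasWeakGradient Ω (u + u') (G + G') where
  locallyIntegrableOn := h.locallyIntegrableOn.add h'.locallyIntegrableOn
  locallyIntegrableOn_grad := h.locallyIntegrableOn_grad.add h'.locallyIntegrableOn_grad
  integral_eq := fun φ hφ hc hs v => by
    simp only [Pi.add_apply, add_mul, inner_add_left, mul_add]
    rw [integral_add (h.integrable_left hφ hc hs v) (h'.integrable_left hφ hc hs v),
      integral_add (h.integrable_right hφ hc hs v) (h'.integrable_right hφ hc hs v),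
      h.integral_eq φ hφ hc hs v, h'.integral_eq φ hφ hc hs v]
    ring

theorem HasWeakGradient.smul {n : ℕ} {Ω : Set (Space n)} {u : Space n → ℝ}
    {G : Space n → Space n} (h : HasWeakGradient Ω u G) (c : ℝ) :
    HasWeakGradient Ω (c • u) (c • G) where
  locallyIntegrableOn := h.locallyIntegrableOn.smul c
  locallyIntegrableOn_grad := h.locallyIntegrableOn_grad.smul c
  integral_eq := fun φ hφ hc hs v => by
    have e1 : ∀ x, (c • u) x * fderiv ℝ φ x v = c * (u x * fderiv ℝ φ x v) := fun x => by
      simp only [Pi.smul_apply, smul_eq_mul]; ring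
    have e2 : ∀ x, φ x * inner ℝ ((c • G) x) v = c * (φ x * inner ℝ (G x) v) := fun x => by
      simp only [Pi.smul_apply, real_inner_smul_left]; ring
    simp only [e1, e2, integral_const_mul, h.integral_eq φ hφ hc hs v]
    ring

theorem measurable_weight {n : ℕ} (d : ℝ) (Γ : Set (Space n)) : Measurable (weight d Γ) :=
  measurable_infDist.pow_const _

theorem weight_nonneg {n : ℕ} (d : ℝ) (Γ : Set (Space n)) (x : Space n) : 0 ≤ weight d Γ x :=
  Real.rpow_nonneg infDist_nonneg _

/-- The weighted homogeneous Sobolev space `W` on `Ω = ℝⁿ \ Γ`: the (classes modulo equality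
a.e. in `Ω` of) functions `u ∈ L¹_loc(Ω)` with a distributional gradient in `L²(Ω, w)`. -/
def spaceW {n : ℕ} (d : ℝ) (Γ : Set (Space n)) :
    Submodule ℝ (Space n →ₘ[volume.restrict Γᶜ] ℝ) where
  carrier := {u | ∃ G, HasWeakGradient Γᶜ u G ∧
    IntegrableOn (fun x => ‖G x‖ ^ 2 * weight d Γ x) Γᶜ}
  add_mem' := by
    rintro u u' ⟨G, hG, hi⟩ ⟨G', hG', hi'⟩
    refine ⟨G + G', (hG.add hG').congr
      (AEEqFun.coeFn_add u u').symm, ?_⟩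
    refine Integrable.mono' ((hi.add hi').const_mul 2) ?_ (Eventually.of_forall fun x => ?_)
    · exact ((hG.add hG').locallyIntegrableOn_grad.aestronglyMeasurable.norm.pow 2).mul
        (measurable_weight d Γ).aestronglyMeasurable
    · have hw := weight_nonneg d Γ x
      rw [Real.norm_of_nonneg (mul_nonneg (sq_nonneg _) hw)]
      have h1 : ‖(G + G') x‖ ≤ ‖G x‖ + ‖G' x‖ := norm_add_le _ _
      have h2 : ‖(G + G') x‖ ^ 2 ≤ 2 * (‖G x‖ ^ 2 + ‖G' x‖ ^ 2) := by
        nlinarith [norm_nonneg ((G + G') x), sq_nonneg (‖G x‖ - ‖G' x‖)]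
      have h3 := mul_le_mul_of_nonneg_right h2 hw
      simp only [Pi.add_apply] at h3 ⊢
      linarith
  zero_mem' := by
    refine ⟨0, HasWeakGradient.congr (u := 0)
      ⟨locallyIntegrableOn_zero, locallyIntegrableOn_zero, ?_⟩ AEEqFun.coeFn_zero.symm, ?_⟩
    · intro φ _ _ _ v
      simp
    · simp
  smul_mem' := by
    rintro c u ⟨G, hG, hi⟩
    refine ⟨c • G, (hG.smul c).congr
      (AEEqFun.coeFn_smul c u).symm, ?_⟩
    have e : (fun x => ‖(c • G) x‖ ^ 2 * weight d Γ x) =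
        fun x => c ^ 2 * (‖G x‖ ^ 2 * weight d Γ x) := by
      ext x
      rw [Pi.smul_apply, norm_smul, mul_pow, Real.norm_eq_abs, sq_abs]
      ring
    rw [e]
    exact Integrable.const_mul hi _

/-- `‖u‖_W = (∫_Ω |∇u|² w dx)^{1/2}`. -/
def normW {n : ℕ} (d : ℝ) (Γ : Set (Space n)) (u : Space n → ℝ) : ℝ :=
  Real.sqrt (∫ x in Γᶜ, ‖weakGradient Γᶜ u x‖ ^ 2 * weight d Γ x)

/-- The integrand `|g(x) - g(y)|² / |x - y|^{d+1}`. -/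
def slobodeckij {n : ℕ} (d : ℝ) (g : Space n → ℝ) (p : Space n × Space n) : ℝ :=
  |g p.1 - g p.2| ^ 2 / dist p.1 p.2 ^ (d + 1)

theorem slobodeckij_congr {n : ℕ} {d : ℝ} {Γ : Set (Space n)} {g g' : Space n → ℝ}
    (e : g =ᵐ[surfaceMeasure d Γ] g') :
    slobodeckij d g =ᵐ[(surfaceMeasure d Γ).prod (surfaceMeasure d Γ)] slobodeckij d g' := by
  filter_upwards [quasiMeasurePreserving_fst.ae e, quasiMeasurePreserving_snd.ae e] with p h1 h2
  simp only [slobodeckij, h1, h2]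

theorem measurable_slobodeckij {n : ℕ} (d : ℝ) {g : Space n → ℝ} (hg : Measurable g) :
    Measurable (slobodeckij d g) := by
  unfold slobodeckij
  fun_prop

/-- The space `H` of (classes modulo equality `σ`-a.e. of) measurable functions `g` on `Γ` such
that `∫_Γ ∫_Γ |g(x) - g(y)|² / |x - y|^{d+1} dσ(x) dσ(y)` is finite. -/
def spaceH {n : ℕ} (d : ℝ) (Γ : Set (Space n)) :
    Submodule ℝ (Space n →ₘ[surfaceMeasure d Γ] ℝ) where
  carrier := {g | Integrable (slobodeckij d g) ((surfaceMeasure d Γ).prod (surfaceMeasure d Γ))}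
  add_mem' := by
    intro g g' h h'
    refine Integrable.congr ?_ (slobodeckij_congr (AEEqFun.coeFn_add g g').symm)
    refine Integrable.mono' ((h.add h').const_mul 2) ?_ (Eventually.of_forall fun p => ?_)
    · exact (measurable_slobodeckij d (g.measurable.add g'.measurable)).aestronglyMeasurable
    · have hd : 0 ≤ dist p.1 p.2 ^ (d + 1) := Real.rpow_nonneg dist_nonneg _
      simp only [slobodeckij, sq_abs, Pi.add_apply]
      rw [Real.norm_of_nonneg (by positivity), ← add_div, ← mul_div_assoc]
      refine div_le_div_of_nonneg_right ?_ hd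
      nlinarith [sq_nonneg ((g p.1 - g p.2) - (g' p.1 - g' p.2))]
  zero_mem' := by
    refine Integrable.congr ?_ (slobodeckij_congr AEEqFun.coeFn_zero.symm)
    refine (integrable_zero _ _ _).congr (Eventually.of_forall fun p => ?_)
    simp [slobodeckij]
  smul_mem' := by
    intro c g h
    refine Integrable.congr ?_ (slobodeckij_congr (AEEqFun.coeFn_smul c g).symm)
    refine (Integrable.const_mul h (c ^ 2)).congr (Eventually.of_forall fun p => ?_)
    simp only [slobodeckij, sq_abs, Pi.smul_apply, smul_eq_mul]
    ring

/-- `‖g‖_H = (∫_Γ ∫_Γ |g(x) - g(y)|² / |x - y|^{d+1} dσ(x) dσ(y))^{1/2}`. -/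
def normH {n : ℕ} (d : ℝ) (Γ : Set (Space n)) (g : Space n → ℝ) : ℝ :=
  Real.sqrt (∫ p, slobodeckij d g p ∂((surfaceMeasure d Γ).prod (surfaceMeasure d Γ)))

end HigherCodim

end

noncomputable section

namespace HigherCodim

open scoped NNReal

/-! Trace. Let `G` be the gradient of `u`. As `d < n - 1`, almost every segment of a given direction
misses `Γ` (`IsAhlforsRegular.ae_segment_notMem`), so the fundamental theorem of calculus on
segments in `Ω` (`HasWeakGradient.ae_sub_eq_integral`) yields an `L¹` Poincaré inequality on every
ball of `ℝⁿ`, even one that meets `Γ`. By Cauchy–Schwarz the mean oscillation of `u` on `B(x,r)` is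
at most a multiple of `(r^(1/2) J(x,r))^(1/2)`, where `J(x,r) = ∫_{B(x,r)} |G(p)|² |p - x|^(3/2 - n)
dp` is `gradPotential`. Halving `r` gains a fixed factor, so wherever `J` is finite the averages of
`u` telescope to a Lebesgue value, and `|Tu(x) - Tu(x')|²` is bounded by `|x - x'|^(1/2)` times
potentials at radius `2|x - x'|`. Dividing by `|x - x'|^(d+1)` and integrating in `x'` turns `J`
into `∫ |G(p)|² |p - x|^(1-n) dp`. Integrating this over `Γ` produces the weight, because `∫_Γ |p -
x|^(1-n) dσ(x)` is at most a multiple of `dist(p,Γ)^(d+1-n)` (`exists_lintegral_fullPotential_le`).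
The exponent `n - 3/2` could be any number strictly between `n - 2` and `n - 1`: the upper half of
the room makes the tail in `x'` converge, the lower half leaves a positive power of `r`.

Extension. `extend` averages `g` against the kernel `k(x,y) = |x - y|^(-2n)`, normalized by its mass
`Z(x)`, which is at least a multiple of `δ^(d-2n)` for `δ = dist(x,Γ)`. The kernel satisfies `|∇k| ≤
(2n/δ) k`, and averaging reproduces constants, so `|∇Eg|²` is bounded by `δ^(-2) Z^(-2)` times the
double integral of `|g(y) - g(z)|² k(x,y) k(x,z)`. After multiplication by the weight it remains to
see that `∫ δ^(3n-d-1) k(x,y) k(x,z) dx` is at most a multiple of `|y - z|^(-(d+1))`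
(`exists_lintegral_kernel_mul_kernel_le`).

Identity and Lebesgue points. For almost every `z` the inner integral `pointEnergy` is finite. There
the mean of `|g - g(z)|²` over `Γ ∩ B(z,r)` and the mean of `|Eg - g(z)|²` over `B(z,r)` are both
`O(r)`. Hence `g(z)` is the Lebesgue value of `Eg` at `z`; as Lebesgue values are unique, `T ∘ E` is
the identity. The same uniqueness makes `T` linear. -/

/-- Weighted Cauchy–Schwarz inequality for lower Lebesgue integrals. -/
theorem sq_lintegral_mul_le {X : Type*} [MeasurableSpace X] {μ : Measure X} {f k : X → ℝ≥0∞}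
    (hf : AEMeasurable f μ) (hk : AEMeasurable k μ) :
    (∫⁻ x, f x * k x ∂μ) ^ 2 ≤ (∫⁻ x, k x ∂μ) * ∫⁻ x, f x ^ 2 * k x ∂μ := by
  have hs : ∀ a : ℝ≥0∞, a ^ (1 / 2 : ℝ) * a ^ (1 / 2 : ℝ) = a := fun a => by
    rw [← ENNReal.rpow_add_of_nonneg _ _ (by norm_num) (by norm_num)]; norm_num
  have hs' : ∀ a : ℝ≥0∞, (a ^ (1 / 2 : ℝ)) ^ 2 = a := fun a => by rw [sq, hs]
  have h := ENNReal.lintegral_mul_le_Lp_mul_Lq μ Real.HolderConjugate.two_two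
    (hk.pow_const (1 / 2 : ℝ)) (hf.mul (hk.pow_const (1 / 2 : ℝ)))
  simp only [Pi.mul_apply, ENNReal.rpow_ofNat, mul_pow, hs'] at h
  calc (∫⁻ x, f x * k x ∂μ) ^ 2
      = (∫⁻ x, k x ^ (1 / 2 : ℝ) * (f x * k x ^ (1 / 2 : ℝ)) ∂μ) ^ 2 := by
        congr 2; ext x; rw [mul_left_comm, hs]
    _ ≤ _ := by
        refine (pow_le_pow_left₀ zero_le h 2).trans ?_
        rw [mul_pow, hs', hs']

theorem sq_lintegral_le {X : Type*} [MeasurableSpace X] {μ : Measure X} {f : X → ℝ≥0∞}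
    (hf : AEMeasurable f μ) :
    (∫⁻ x, f x ∂μ) ^ 2 ≤ μ univ * ∫⁻ x, f x ^ 2 ∂μ := by
  simpa using sq_lintegral_mul_le hf (aemeasurable_const (b := (1 : ℝ≥0∞)))

/-! ### Integrals of powers of the distance against measures of growth `d` -/

section Growth

variable {X : Type*} [PseudoMetricSpace X] [MeasurableSpace X] [OpensMeasurableSpace X]

theorem lintegral_annulus_le (μ : Measure X) (p : X) {q a b : ℝ} (hq : 0 ≤ q) :
    ∫⁻ x in ball p b \ ball p a, edist x p ^ (-q) ∂μ ≤ ENNReal.ofReal a ^ (-q) * μ (ball p b) := by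
  calc ∫⁻ x in ball p b \ ball p a, edist x p ^ (-q) ∂μ
      ≤ ∫⁻ x in ball p b \ ball p a, ENNReal.ofReal a ^ (-q) ∂μ := by
        refine setLIntegral_mono measurable_const fun x hx => ?_
        have h1 : a ≤ dist x p := by simpa using hx.2
        rw [ENNReal.rpow_neg, ENNReal.rpow_neg, edist_dist]
        exact ENNReal.inv_le_inv.2
          (ENNReal.rpow_le_rpow (ENNReal.ofReal_le_ofReal h1) hq)
    _ ≤ _ := by
        rw [setLIntegral_const]
        gcongr
        exact sdiff_subset

theorem tsum_ofReal_geometric_ne_top {b : ℝ} (hb0 : 0 ≤ b) (hb : b < 1) :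
    ∑' k : ℕ, ENNReal.ofReal (b ^ k) ≠ ⊤ := by
  rw [← ENNReal.ofReal_tsum_of_nonneg (fun k => pow_nonneg hb0 k)
    (summable_geometric_of_lt_one hb0 hb)]
  exact ENNReal.ofReal_ne_top

/-- Tail estimate for a measure of growth `d`. -/
theorem exists_lintegral_compl_ball_le (C : ℝ≥0) {d q : ℝ} (hd : 0 ≤ d) (hdq : d < q) :
    ∃ C' : ℝ≥0, ∀ (μ : Measure X) (p : X),
      (∀ r : ℝ, 0 < r → μ (ball p r) ≤ C * ENNReal.ofReal r ^ d) → ∀ s : ℝ, 0 < s →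
      ∫⁻ x in (ball p s)ᶜ, edist x p ^ (-q) ∂μ ≤ C' * ENNReal.ofReal s ^ (d - q) := by
  have hb : (2 : ℝ) ^ (d - q) < 1 :=
    Real.rpow_lt_one_of_one_lt_of_neg (by norm_num) (by linarith)
  have hb0 : 0 ≤ (2 : ℝ) ^ (d - q) := by positivity
  have hfin := tsum_ofReal_geometric_ne_top hb0 hb
  -- On the annulus between radii `2 ^ k * s` and `2 ^ (k + 1) * s` the integrand is at most `(2 ^ k
  -- * s) ^ (-q)` and the mass at most `C * (2 ^ (k + 1) * s) ^ d`. The product is `C * 2 ^ d * s ^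
  -- (d - q)` times the `k`-th term of a geometric series.
  refine ⟨C * ((2 : ℝ≥0) ^ d) * (∑' k : ℕ, ENNReal.ofReal (((2 : ℝ) ^ (d - q)) ^ k)).toNNReal,
    fun μ p hμ s hs => ?_⟩
  push_cast
  rw [ENNReal.coe_toNNReal hfin]
  have hcov : (ball p s)ᶜ ⊆ ⋃ k : ℕ, ball p (2 ^ (k + 1) * s) \ ball p (2 ^ k * s) := by
    intro x hx
    have h1 : s ≤ dist x p := by simpa using hx
    obtain ⟨k, hk1, hk2⟩ := exists_nat_pow_near (x := dist x p / s) (y := (2 : ℝ))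
      (by rw [le_div_iff₀ hs]; linarith) (by norm_num)
    rw [le_div_iff₀ hs] at hk1
    rw [div_lt_iff₀ hs] at hk2
    exact mem_iUnion.2 ⟨k, by simpa using hk2, by simpa using hk1⟩
  refine (lintegral_mono_set hcov).trans ((lintegral_iUnion_le _ _).trans ?_)
  calc ∑' k : ℕ, ∫⁻ x in ball p (2 ^ (k + 1) * s) \ ball p (2 ^ k * s), edist x p ^ (-q) ∂μ
      ≤ ∑' k : ℕ, (C * (2 : ℝ≥0∞) ^ d * ENNReal.ofReal s ^ (d - q)) *
          ENNReal.ofReal (((2 : ℝ) ^ (d - q)) ^ k) := by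
        refine ENNReal.tsum_le_tsum fun k => ?_
        have h2k : (0 : ℝ) < 2 ^ k * s := by positivity
        refine (lintegral_annulus_le μ p (by linarith)).trans ?_
        refine (mul_le_mul_right (hμ _ (by positivity)) _).trans (le_of_eq ?_)
        have e2 : (2 : ℝ≥0∞) ^ d = ENNReal.ofReal ((2 : ℝ) ^ d) := by
          rw [← ENNReal.ofReal_rpow_of_pos (by norm_num)]; simp
        rw [e2, ENNReal.ofReal_rpow_of_pos h2k, ENNReal.ofReal_rpow_of_pos (by positivity),
          ENNReal.ofReal_rpow_of_pos hs, mul_left_comm, mul_assoc, mul_assoc,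
          ← ENNReal.ofReal_mul (by positivity), ← ENNReal.ofReal_mul (by positivity),
          ← ENNReal.ofReal_mul (by positivity)]
        congr 2
        rw [pow_succ, show (2 : ℝ) ^ k * 2 * s = 2 * (2 ^ k * s) by ring,
          Real.mul_rpow (by norm_num) h2k.le, ← mul_assoc, mul_comm (_ ^ (-q)), mul_assoc,
          ← Real.rpow_add h2k, Real.mul_rpow (by positivity) hs.le, ← Real.rpow_natCast,
          ← Real.rpow_natCast, ← Real.rpow_mul (by norm_num), ← Real.rpow_mul (by norm_num)]
        ring_nf
    _ = _ := by
        rw [ENNReal.tsum_mul_left, ENNReal.coe_rpow_of_nonneg _ hd]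
        push_cast
        ring

/-- Local estimate for a measure of growth `d`. -/
theorem exists_lintegral_ball_le (C : ℝ≥0) {d q : ℝ} (hq : 0 ≤ q) (hdq : q < d) :
    ∃ C' : ℝ≥0, ∀ (μ : Measure X) (p : X), μ {x | dist x p = 0} = 0 →
      (∀ r : ℝ, 0 < r → μ (ball p r) ≤ C * ENNReal.ofReal r ^ d) → ∀ s : ℝ, 0 < s →
      ∫⁻ x in ball p s, edist x p ^ (-q) ∂μ ≤ C' * ENNReal.ofReal s ^ (d - q) := by
  have hb : (2 : ℝ) ^ (q - d) < 1 :=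
    Real.rpow_lt_one_of_one_lt_of_neg (by norm_num) (by linarith)
  have hb0 : 0 ≤ (2 : ℝ) ^ (q - d) := by positivity
  have hfin := tsum_ofReal_geometric_ne_top hb0 hb
  -- The annuli now shrink to the centre; the factor `2 ^ q` comes from the inner radius being half
  -- of the outer one.
  refine ⟨C * ((2 : ℝ≥0) ^ q) * (∑' k : ℕ, ENNReal.ofReal (((2 : ℝ) ^ (q - d)) ^ k)).toNNReal,
    fun μ p h0 hμ s hs => ?_⟩
  push_cast
  rw [ENNReal.coe_toNNReal hfin]
  have hcov : ball p s ⊆ {x | dist x p = 0} ∪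
      ⋃ k : ℕ, ball p (s / 2 ^ k) \ ball p (s / 2 ^ (k + 1)) := by
    intro x hx
    rcases (dist_nonneg : 0 ≤ dist x p).eq_or_lt with h | h
    · exact Or.inl h.symm
    right
    have h1 : dist x p < s := hx
    obtain ⟨k, hk1, hk2⟩ := exists_nat_pow_near (x := s / dist x p) (y := (2 : ℝ))
      (by rw [le_div_iff₀ h]; linarith) (by norm_num)
    rw [le_div_iff₀ h, ← le_div_iff₀' (by positivity)] at hk1
    rw [div_lt_iff₀ h, ← div_lt_iff₀' (by positivity)] at hk2
    rcases hk1.lt_or_eq with h2 | h2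
    · exact mem_iUnion.2 ⟨k, h2, by simpa using hk2.le⟩
    -- The annuli omit their outer spheres, so a point at distance exactly `s / 2 ^ k` belongs to
    -- the preceding annulus. For `k = 0` it would not lie in the open ball.
    · cases k with
      | zero => simp [h2] at h1
      | succ k =>
        refine mem_iUnion.2 ⟨k, ?_, by simp [h2]⟩
        rw [mem_ball, h2]
        exact div_lt_div_of_pos_left hs (by positivity)
          (pow_lt_pow_right₀ (by norm_num) (Nat.lt_succ_self k))
  refine (lintegral_mono_set hcov).trans ((lintegral_union_le _ _ _).trans ?_)
  rw [setLIntegral_measure_zero _ _ h0, zero_add]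
  refine (lintegral_iUnion_le _ _).trans ?_
  calc ∑' k : ℕ, ∫⁻ x in ball p (s / 2 ^ k) \ ball p (s / 2 ^ (k + 1)), edist x p ^ (-q) ∂μ
      ≤ ∑' k : ℕ, (C * (2 : ℝ≥0∞) ^ q * ENNReal.ofReal s ^ (d - q)) *
          ENNReal.ofReal (((2 : ℝ) ^ (q - d)) ^ k) := by
        refine ENNReal.tsum_le_tsum fun k => ?_
        have h2k : (0 : ℝ) < s / 2 ^ k := by positivity
        have h2k' : (0 : ℝ) < s / 2 ^ (k + 1) := by positivity
        refine (lintegral_annulus_le μ p (by linarith)).trans ?_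
        refine (mul_le_mul_right (hμ _ h2k) _).trans (le_of_eq ?_)
        have e2 : (2 : ℝ≥0∞) ^ q = ENNReal.ofReal ((2 : ℝ) ^ q) := by
          rw [← ENNReal.ofReal_rpow_of_pos (by norm_num)]; simp
        rw [e2, ENNReal.ofReal_rpow_of_pos h2k, ENNReal.ofReal_rpow_of_pos h2k',
          ENNReal.ofReal_rpow_of_pos hs, mul_left_comm, mul_assoc, mul_assoc,
          ← ENNReal.ofReal_mul (by positivity), ← ENNReal.ofReal_mul (by positivity),
          ← ENNReal.ofReal_mul (by positivity)]
        congr 2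
        have e3 : s / 2 ^ (k + 1) = 2⁻¹ * (s / 2 ^ k) := by rw [pow_succ]; field_simp
        have e4 : s / 2 ^ k = s * 2 ^ (-(k : ℝ)) := by
          rw [Real.rpow_neg (by norm_num), Real.rpow_natCast]; rfl
        rw [e3, Real.mul_rpow (by norm_num) h2k.le, mul_assoc, ← Real.rpow_add h2k, e4,
          Real.mul_rpow hs.le (by positivity), ← Real.rpow_natCast (2 ^ (q - d)),
          ← Real.rpow_mul (by norm_num), ← Real.rpow_mul (by norm_num),
          Real.inv_rpow (by norm_num), ← Real.rpow_neg (by norm_num), neg_neg]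
        ring_nf
    _ = _ := by
        rw [ENNReal.tsum_mul_left, ENNReal.coe_rpow_of_nonneg _ hq]
        push_cast
        ring

end Growth

/-! ### Measure estimates for Ahlfors regular sets; segments that miss `Γ` -/

section Surface

variable {n : ℕ} {d : ℝ} {Γ : Set (Space n)}

theorem surfaceMeasure_ball (p : Space n) (r : ℝ) :
    surfaceMeasure d Γ (ball p r) = μH[d] (Γ ∩ ball p r) := by
  rw [surfaceMeasure, Measure.restrict_apply measurableSet_ball, inter_comm]

/-- The centre may lie off `Γ`: a ball that meets `Γ` sits in the ball of twice the radius about one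
of its points on `Γ`, whence the factor `2 ^ d`. -/
theorem IsAhlforsRegular.exists_measure_ball_le (hΓ : IsAhlforsRegular d Γ) (hd : 0 ≤ d) :
    ∃ C : ℝ≥0, ∀ (p : Space n) (r : ℝ), 0 < r →
      surfaceMeasure d Γ (ball p r) ≤ C * ENNReal.ofReal r ^ d := by
  obtain ⟨C, hC, h⟩ := hΓ.regular
  refine ⟨(C * 2 ^ d).toNNReal, fun p r hr => ?_⟩
  rw [surfaceMeasure_ball]
  rcases (Γ ∩ ball p r).eq_empty_or_nonempty with he | ⟨x, hx, hxp⟩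
  · simp [he]
  have hsub : Γ ∩ ball p r ⊆ Γ ∩ ball x (2 * r) := by
    refine inter_subset_inter_right _ (ball_subset_ball' ?_)
    rw [mem_ball, dist_comm] at hxp
    linarith
  refine (measure_mono hsub).trans (((h x hx (2 * r) (by positivity)).2).trans (le_of_eq ?_))
  rw [ENNReal.ofReal_rpow_of_pos hr, ← ENNReal.ofReal, ← ENNReal.ofReal_mul (by positivity),
    Real.mul_rpow (by norm_num) hr.le, mul_assoc]

theorem IsAhlforsRegular.exists_le_measure_ball (hΓ : IsAhlforsRegular d Γ) :
    ∃ C : ℝ≥0, ∀ x ∈ Γ, ∀ r : ℝ, 0 < r →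
      ENNReal.ofReal r ^ d ≤ C * surfaceMeasure d Γ (ball x r) := by
  obtain ⟨C, hC, h⟩ := hΓ.regular
  have hC0 : 0 < C := by linarith
  refine ⟨C.toNNReal, fun x hx r hr => ?_⟩
  rw [surfaceMeasure_ball]
  refine le_trans (le_of_eq ?_) (mul_le_mul_right (h x hx r hr).1 _)
  rw [ENNReal.ofReal_rpow_of_pos hr, ← ENNReal.ofReal, ← ENNReal.ofReal_mul hC0.le]
  congr 1
  field_simp

theorem IsAhlforsRegular.isLocallyFiniteMeasure (hΓ : IsAhlforsRegular d Γ) (hd : 0 ≤ d) :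
    IsLocallyFiniteMeasure (surfaceMeasure d Γ) := by
  obtain ⟨C, h⟩ := hΓ.exists_measure_ball_le hd
  refine ⟨fun x => ⟨ball x 1, ball_mem_nhds x one_pos, (h x 1 one_pos).trans_lt ?_⟩⟩
  simp

theorem IsAhlforsRegular.ae_mem (hΓ : IsAhlforsRegular d Γ) :
    ∀ᵐ x ∂(surfaceMeasure d Γ), x ∈ Γ :=
  ae_restrict_mem hΓ.isClosed.measurableSet

theorem volume_ball_eq (x : Space n) {r : ℝ} (hr : 0 < r) :
    volume (ball x r) = ENNReal.ofReal (r ^ n) * volume (ball (0 : Space n) 1) := by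
  have := addHaar_ball_of_pos (volume : Measure (Space n)) x hr
  rwa [finrank_euclideanSpace_fin] at this

theorem measurable_measure_ball (τ : Measure (Space n)) [SFinite τ] (ρ : ℝ) :
    Measurable fun z => τ (ball z ρ) := by
  have hA : MeasurableSet {q : Space n × Space n | dist q.2 q.1 < ρ} :=
    (isOpen_lt (by fun_prop) (by fun_prop)).measurableSet
  exact measurable_measure_prodMk_left hA

-- A Chebyshev argument. For `z` in the tube, the `τ`-mass of the `2ε`-balls that travel along `z +
-- t • v`, integrated in `t`, is at least a multiple of `ε ^ (d + 1)`. The integral of this quantity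
-- over all `z` is a multiple of `ε ^ n`. So the tube has volume `O(ε ^ (n - d - 1))`, which tends
-- to zero.
set_option maxHeartbeats 400000 in
theorem IsAhlforsRegular.volume_tube_inter_ball (hΓ : IsAhlforsRegular d Γ) (hd : 0 ≤ d)
    (hdn : d < (n : ℝ) - 1) (v : Space n) (R : ℝ) :
    volume {z : Space n | ∃ t ∈ Icc (0 : ℝ) 1, z + t • v ∈ Γ ∩ ball 0 R} = 0 := by
  have := hΓ.isLocallyFiniteMeasure hd
  obtain ⟨C, hC⟩ := hΓ.exists_le_measure_ball
  set S := {z : Space n | ∃ t ∈ Icc (0 : ℝ) 1, z + t • v ∈ Γ ∩ ball 0 R} with hS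
  obtain ⟨τ, hτ⟩ : ∃ τ, τ = (surfaceMeasure d Γ).restrict (ball 0 (R + 1)) := ⟨_, rfl⟩
  have hτfin : τ univ < ⊤ := by
    rw [hτ, Measure.restrict_apply_univ]; exact measure_ball_lt_top
  have : IsFiniteMeasure τ := ⟨hτfin⟩
  set l := ‖v‖ + 1 with hl
  have hl0 : 0 < l := by positivity
  set K : ℝ≥0∞ := C * (τ univ * (ENNReal.ofReal (l * 2 * 2 ^ n) * volume (ball (0 : Space n) 1)))
    with hK
  have hKfin : K ≠ ⊤ := by
    refine ENNReal.mul_ne_top (by simp) (ENNReal.mul_ne_top hτfin.ne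
      (ENNReal.mul_ne_top (by simp) measure_ball_lt_top.ne))
  have key : ∀ ε : ℝ, 0 < ε → ε < 1 →
      volume S ≤ K * ENNReal.ofReal (ε ^ ((n : ℝ) - d - 1)) := by
    intro ε hε hε1
    have hmeas : Measurable fun q : Space n × ℝ => τ (ball (q.1 + q.2 • v) (2 * ε)) :=
      (measurable_measure_ball τ (2 * ε)).comp (by fun_prop)
    set Φ : Space n → ℝ≥0∞ := fun z => ∫⁻ t in Icc (0 : ℝ) 2, τ (ball (z + t • v) (2 * ε)) with hΦ
    -- If `z + t • v ∈ Γ`, then for `t'` within `ε / l` after `t` the `2ε`-ball about `z + t' • v`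
    -- contains the `ε`-ball about `z + t • v`. Since `ε < 1`, that ball stays in `ball 0 (R + 1)`
    -- and `t'` stays in `[0, 2]`; this is why both are taken larger than in `S`.
    have hlow : ∀ z ∈ S, ENNReal.ofReal ε ^ d * ENNReal.ofReal (ε / l) ≤ C * Φ z := by
      rintro z ⟨t, ht, hzΓ, hzR⟩
      have hεl : ε / l ≤ 1 := by
        rw [div_le_one hl0]; linarith [norm_nonneg v]
      have h1 : ∀ t' ∈ Ioo t (t + ε / l), ENNReal.ofReal ε ^ d ≤
          C * τ (ball (z + t' • v) (2 * ε)) := by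
        intro t' ht'
        refine (hC _ hzΓ ε hε).trans (mul_le_mul_right ?_ _)
        rw [hτ, Measure.restrict_apply measurableSet_ball]
        refine measure_mono (subset_inter (ball_subset_ball' ?_) (ball_subset_ball' ?_))
        · have : dist (z + t • v) (z + t' • v) ≤ ε := by
            rw [dist_add_left, dist_eq_norm, ← sub_smul, norm_smul, Real.norm_eq_abs, abs_sub_comm,
              abs_of_pos (by linarith [ht'.1])]
            have h3 : t' - t ≤ ε / l := by linarith [ht'.2]
            calc (t' - t) * ‖v‖ ≤ ε / l * l := by
                  refine mul_le_mul h3 (by linarith) (norm_nonneg _) (by positivity)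
              _ = ε := by field_simp
          linarith
        · have h4 : dist (z + t • v) 0 < R := hzR
          linarith
      have hsub : Ioo t (t + ε / l) ⊆ Icc 0 2 := fun t' ht' =>
        ⟨by linarith [ht.1, ht'.1], by linarith [ht.2, ht'.2]⟩
      have hm : Measurable fun t' : ℝ => τ (ball (z + t' • v) (2 * ε)) :=
        (measurable_measure_ball τ (2 * ε)).comp (f := fun t' : ℝ => z + t' • v) (by fun_prop)
      calc ENNReal.ofReal ε ^ d * ENNReal.ofReal (ε / l)
          = ∫⁻ t' in Ioo t (t + ε / l), ENNReal.ofReal ε ^ d := by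
            rw [setLIntegral_const, Real.volume_Ioo]; congr 2; ring
        _ ≤ ∫⁻ t' in Ioo t (t + ε / l), C * τ (ball (z + t' • v) (2 * ε)) :=
            setLIntegral_mono (hm.const_mul _) h1
        _ ≤ ∫⁻ t' in Icc (0 : ℝ) 2, C * τ (ball (z + t' • v) (2 * ε)) :=
            lintegral_mono_set hsub
        _ = C * Φ z := by rw [lintegral_const_mul _ hm]
    -- Translation invariance removes `t`, Tonelli gives the mass of `τ` times the volume of one
    -- ball, and the factor `2` is the length of the time interval.
    have hint : ∫⁻ z, Φ z = 2 * (τ univ * volume (ball (0 : Space n) (2 * ε))) := by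
      rw [hΦ, lintegral_lintegral_swap hmeas.aemeasurable]
      have h5 : ∀ t : ℝ, ∫⁻ z, τ (ball (z + t • v) (2 * ε)) =
          τ univ * volume (ball (0 : Space n) (2 * ε)) := by
        intro t
        rw [lintegral_add_right_eq_self (fun z => τ (ball z (2 * ε))) (t • v)]
        have hB : MeasurableSet {q : Space n × Space n | dist q.2 q.1 < 2 * ε} :=
          (isOpen_lt (by fun_prop) (by fun_prop)).measurableSet
        have e1 := Measure.prod_apply (μ := (volume : Measure (Space n))) (ν := τ) hB
        have e2 := Measure.prod_apply_symm (μ := (volume : Measure (Space n))) (ν := τ) hB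
        calc ∫⁻ z, τ (ball z (2 * ε)) = ∫⁻ x, volume (ball x (2 * ε)) ∂τ := by
              refine (e1.symm.trans e2).trans (lintegral_congr fun x => ?_)
              congr 1
              ext z
              simp [dist_comm]
          _ = _ := by
              simp_rw [volume_ball_eq _ (show 0 < 2 * ε by positivity)]
              rw [lintegral_const, mul_comm]
      simp_rw [h5]
      rw [setLIntegral_const, Real.volume_Icc, mul_comm]
      norm_num
    have hΦm : Measurable Φ := hmeas.lintegral_prod_right'
    have h6 : ENNReal.ofReal ε ^ d * ENNReal.ofReal (ε / l) * volume S ≤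
        C * (2 * (τ univ * volume (ball (0 : Space n) (2 * ε)))) := by
      rw [← hint, ← lintegral_const_mul _ hΦm]
      exact (mul_le_mul_right (measure_mono hlow) _).trans
        (mul_meas_ge_le_lintegral (hΦm.const_mul _) _)
    rw [volume_ball_eq _ (show 0 < 2 * ε by positivity), ENNReal.ofReal_rpow_of_pos hε,
      ← ENNReal.ofReal_mul (by positivity)] at h6
    have hc : 0 < ε ^ d * (ε / l) := by positivity
    have h7 : ENNReal.ofReal (ε ^ d * (ε / l)) * (K * ENNReal.ofReal (ε ^ ((n : ℝ) - d - 1))) =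
        C * (2 * (τ univ * (ENNReal.ofReal ((2 * ε) ^ n) * volume (ball (0 : Space n) 1)))) := by
      have e : ENNReal.ofReal (ε ^ d * (ε / l)) * (ENNReal.ofReal (l * 2 * 2 ^ n) *
          ENNReal.ofReal (ε ^ ((n : ℝ) - d - 1))) = 2 * ENNReal.ofReal ((2 * ε) ^ n) := by
        rw [← ENNReal.ofReal_mul (by positivity), ← ENNReal.ofReal_mul (by positivity),
          show (2 : ℝ≥0∞) = ENNReal.ofReal 2 by simp, ← ENNReal.ofReal_mul (by positivity)]
        congr 1
        have : ε ^ d * ε * ε ^ ((n : ℝ) - d - 1) = ε ^ n := by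
          rw [← Real.rpow_add_one hε.ne', ← Real.rpow_add hε, ← Real.rpow_natCast]
          congr 1; ring
        rw [mul_pow, ← this]
        field_simp
      calc _ = C * (τ univ * volume (ball (0 : Space n) 1)) *
            (ENNReal.ofReal (ε ^ d * (ε / l)) * (ENNReal.ofReal (l * 2 * 2 ^ n) *
          ENNReal.ofReal (ε ^ ((n : ℝ) - d - 1)))) := by rw [hK]; ring
        _ = _ := by rw [e]; ring
    rw [← h7] at h6
    exact (ENNReal.mul_le_mul_iff_right (by simpa using hc) (by simp)).1 h6
  have hlim : Tendsto (fun ε : ℝ => K * ENNReal.ofReal (ε ^ ((n : ℝ) - d - 1))) (𝓝[>] 0)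
      (𝓝 (K * ENNReal.ofReal ((0 : ℝ) ^ ((n : ℝ) - d - 1)))) := by
    refine ENNReal.Tendsto.const_mul (ENNReal.tendsto_ofReal ?_) (Or.inr hKfin)
    exact ((Real.continuousAt_rpow_const 0 _ (Or.inr (by linarith))).tendsto).mono_left
      nhdsWithin_le_nhds
  rw [Real.zero_rpow (by linarith), ENNReal.ofReal_zero, mul_zero] at hlim
  refine le_antisymm (ge_of_tendsto hlim ?_) zero_le
  filter_upwards [Ioo_mem_nhdsGT one_pos] with ε hε using key ε hε.1 hε.2

/-- Almost every segment in a given direction misses a `d`-regular set with `d < n - 1`. -/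
theorem IsAhlforsRegular.ae_segment_notMem (hΓ : IsAhlforsRegular d Γ) (hd : 0 ≤ d)
    (hdn : d < (n : ℝ) - 1) (v : Space n) :
    ∀ᵐ z : Space n, ∀ t ∈ Icc (0 : ℝ) 1, z + t • v ∉ Γ := by
  have h : ∀ᵐ z : Space n, ∀ R : ℕ, ¬ ∃ t ∈ Icc (0 : ℝ) 1, z + t • v ∈ Γ ∩ ball 0 (R : ℝ) := by
    rw [ae_all_iff]
    intro R
    rw [ae_iff]
    simpa only [not_not] using hΓ.volume_tube_inter_ball hd hdn v R
  filter_upwards [h] with z hz t ht hm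
  obtain ⟨R, hR⟩ := exists_nat_gt (dist (z + t • v) 0)
  exact hz R ⟨t, ht, hm, hR⟩

/-- The zero direction, where segments degenerate to points. -/
theorem IsAhlforsRegular.volume_eq_zero (hΓ : IsAhlforsRegular d Γ) (hd : 0 ≤ d)
    (hdn : d < (n : ℝ) - 1) : volume Γ = 0 := by
  have h := hΓ.ae_segment_notMem hd hdn 0
  rw [measure_eq_zero_iff_ae_notMem]
  filter_upwards [h] with z hz
  simpa using hz 0 (by simp)

end Surface

/-! ### The fundamental theorem of calculus on almost every segment -/

section Segments

variable {n : ℕ}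

/-- The shear `(t, z) ↦ (t, z + t • v)` preserves the product measure, since each time slice is a
translation. -/
theorem integrable_comp_add_smul {g : Space n → ℝ} (hg : Integrable g) (v : Space n) :
    Integrable (fun q : Space n × ℝ => g (q.1 + q.2 • v))
      (volume.prod (volume.restrict (Ioc (0 : ℝ) 1))) := by
  have hmp : MeasurePreserving (fun q : ℝ × Space n => (q.1, q.2 + q.1 • v))
      ((volume.restrict (Ioc (0 : ℝ) 1)).prod volume)
      ((volume.restrict (Ioc (0 : ℝ) 1)).prod volume) := by
    refine MeasurePreserving.skew_product (g := fun t z => z + t • v)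
      (MeasurePreserving.id _) (by fun_prop) (Eventually.of_forall fun t => ?_)
    exact map_add_right_eq_self volume (t • v)
  have h1 : Integrable (fun q : ℝ × Space n => g q.2)
      ((volume.restrict (Ioc (0 : ℝ) 1)).prod volume) := hg.comp_snd _
  exact (hmp.integrable_comp_of_integrable h1).swap

theorem isOpen_setOf_segment {Ω : Set (Space n)} (hΩ : IsOpen Ω) (v : Space n) :
    IsOpen {z : Space n | ∀ t ∈ Icc (0 : ℝ) 1, z + t • v ∈ Ω} := by
  rw [isOpen_iff_eventually]
  intro z hz
  refine isCompact_Icc.eventually_forall_of_forall_eventually fun t ht => ?_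
  have hc : Continuous fun q : Space n × ℝ => q.1 + q.2 • v := by fun_prop
  exact hc.continuousAt.eventually (hΩ.mem_nhds (hz t ht))

theorem exists_compact_segments {Ω K : Set (Space n)} (hK : IsCompact K) {v : Space n}
    (hKΩ : K ⊆ {z : Space n | ∀ t ∈ Icc (0 : ℝ) 1, z + t • v ∈ Ω}) :
    ∃ L ⊆ Ω, IsCompact L ∧ ∀ z ∈ K, ∀ t ∈ Icc (0 : ℝ) 1, z + t • v ∈ L := by
  refine ⟨(fun q : Space n × ℝ => q.1 + q.2 • v) '' (K ×ˢ Icc (0 : ℝ) 1), ?_,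
    (hK.prod isCompact_Icc).image (by fun_prop), fun z hz t ht => ⟨(z, t), ⟨hz, ht⟩, rfl⟩⟩
  rintro _ ⟨q, hq, rfl⟩
  exact hKΩ hq.1 _ hq.2

theorem integral_fderiv_comp_sub_smul {ψ : Space n → ℝ} (hψ : ContDiff ℝ ∞ ψ) (x v : Space n) :
    ∫ t in Ioc (0 : ℝ) 1, fderiv ℝ ψ (x - t • v) v = ψ x - ψ (x - v) := by
  have hd : ∀ t ∈ uIcc (0 : ℝ) 1, HasDerivAt (fun t : ℝ => -ψ (x - t • v))
      (fderiv ℝ ψ (x - t • v) v) t := by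
    intro t _
    have h1 : HasDerivAt (fun t : ℝ => x - t • v) (-v) t := by
      simpa using ((hasDerivAt_id t).smul_const v).const_sub x
    have h2 := ((hψ.differentiable (by simp)) (x - t • v)).hasFDerivAt.comp_hasDerivAt t h1
    have h3 := h2.neg
    simp only [map_neg, neg_neg] at h3
    exact h3
  have hc : Continuous fun t : ℝ => fderiv ℝ ψ (x - t • v) v :=
    ((hψ.continuous_fderiv (by simp)).comp (by fun_prop)).clm_apply continuous_const
  rw [← intervalIntegral.integral_of_le zero_le_one,
    intervalIntegral.integral_eq_sub_of_hasDerivAt hd (hc.intervalIntegrable _ _)]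
  simp
  ring

theorem HasWeakGradient.integrableOn_inner {Ω L : Set (Space n)}
    {u : Space n → ℝ} {G : Space n → Space n} (h : HasWeakGradient Ω u G)
    (hLΩ : L ⊆ Ω) (hL : IsCompact L) (v : Space n) :
    IntegrableOn (fun x => inner ℝ (G x) v) L :=
  Integrable.inner_const (h.locallyIntegrableOn_grad.integrableOn_compact_subset hLΩ hL) v

/-- The test identity behind the fundamental theorem of calculus on almost every segment. -/
theorem HasWeakGradient.integral_test_segment {Ω : Set (Space n)} (hΩ : IsOpen Ω)
    {u : Space n → ℝ} {G : Space n → Space n} (h : HasWeakGradient Ω u G) {ψ : Space n → ℝ}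
    (hψ : ContDiff ℝ ∞ ψ) (hc : HasCompactSupport ψ) {v : Space n} {L : Set (Space n)}
    (hLΩ : L ⊆ Ω) (hL : IsCompact L) (hK : ∀ z ∈ tsupport ψ, ∀ t ∈ Icc (0 : ℝ) 1, z + t • v ∈ L) :
    ∫ z, ψ z * (L.indicator u (z + v) - L.indicator u z -
      ∫ t in Ioc (0 : ℝ) 1, L.indicator (fun x => inner ℝ (G x) v) (z + t • v)) = 0 := by
  -- Cutting off to the compact set `L` makes both functions integrable on the whole space, so that
  -- Fubini applies, and changes nothing on the segments that start in `tsupport ψ`.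
  set u₁ := L.indicator u with hu₁
  set g₁ := L.indicator (fun x => inner ℝ (G x) v) with hg₁
  have hLm : MeasurableSet L := hL.isClosed.measurableSet
  have iu : Integrable u₁ :=
    (h.locallyIntegrableOn.integrableOn_compact_subset hLΩ hL).integrable_indicator hLm
  have ig : Integrable g₁ := (h.integrableOn_inner hLΩ hL v).integrable_indicator hLm
  obtain ⟨M, hM⟩ := hψ.continuous.bounded_above_of_compact_support hc
  obtain ⟨M', hM'⟩ := (hψ.continuous_fderiv (by simp)).bounded_above_of_compact_support
    (hc.fderiv ℝ)
  have ig2 := integrable_comp_add_smul ig v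
  have ig3 : Integrable (fun q : Space n × ℝ => ψ q.1 * g₁ (q.1 + q.2 • v))
      (volume.prod (volume.restrict (Ioc (0 : ℝ) 1))) :=
    ig2.bdd_mul (c := M) (hψ.continuous.comp continuous_fst).aestronglyMeasurable
      (Eventually.of_forall fun q => hM q.1)
  have iu3 : Integrable (fun q : Space n × ℝ => u₁ q.1 * fderiv ℝ ψ (q.1 - q.2 • v) v)
      (volume.prod (volume.restrict (Ioc (0 : ℝ) 1))) := by
    refine (iu.comp_fst _).mul_bdd (c := M' * ‖v‖) ?_ (Eventually.of_forall fun q => ?_)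
    · exact (((hψ.continuous_fderiv (by simp)).comp (by fun_prop)).clm_apply
        continuous_const).aestronglyMeasurable
    · exact ((fderiv ℝ ψ (q.1 - q.2 • v)).le_opNorm v).trans
        (mul_le_mul_of_nonneg_right (hM' _) (norm_nonneg _))
  -- For fixed `t` the translate of `ψ` by `t • v` is an admissible test function, because its
  -- support lies in `L`.
  have hslice : ∀ t ∈ Ioc (0 : ℝ) 1, ∫ z, ψ z * g₁ (z + t • v) =
      -∫ x, u₁ x * fderiv ℝ ψ (x - t • v) v := by
    intro t ht
    have hsupp : tsupport (fun x => ψ (x - t • v)) ⊆ L := by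
      refine closure_minimal (fun x hx => ?_) hL.isClosed
      have := hK (x - t • v) (subset_tsupport _ hx) t ⟨ht.1.le, ht.2⟩
      simpa using this
    have hψt : ContDiff ℝ ∞ fun x => ψ (x - t • v) := hψ.comp (by fun_prop)
    have hct : HasCompactSupport fun x => ψ (x - t • v) :=
      hL.of_isClosed_subset (isClosed_tsupport _) hsupp
    have e := h.integral_eq _ hψt hct (hsupp.trans hLΩ) v
    have hf : ∀ x, fderiv ℝ (fun x => ψ (x - t • v)) x = fderiv ℝ ψ (x - t • v) := fun x => by
      simp only [sub_eq_add_neg, fderiv_comp_add_right]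
    have hz1 : ∀ x, x ∉ L → ψ (x - t • v) = 0 := fun x hx =>
      image_eq_zero_of_notMem_tsupport (f := fun x => ψ (x - t • v)) fun hm => hx (hsupp hm)
    have hz2 : ∀ x, x ∉ L → fderiv ℝ ψ (x - t • v) = 0 := fun x hx => by
      rw [← hf]
      by_contra h0
      exact hx (hsupp (support_fderiv_subset ℝ h0))
    rw [setIntegral_eq_integral_of_forall_compl_eq_zero,
      setIntegral_eq_integral_of_forall_compl_eq_zero] at e
    · have e1 : ∀ x, u₁ x * fderiv ℝ ψ (x - t • v) v =
          u x * fderiv ℝ (fun x => ψ (x - t • v)) x v := fun x => by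
        rw [hf]
        by_cases hx : x ∈ L
        · simp [hu₁, hx]
        · simp [hz2 x hx]
      have e2 : ∀ x, ψ (x - t • v) * g₁ x = ψ (x - t • v) * inner ℝ (G x) v := fun x => by
        by_cases hx : x ∈ L
        · simp [hg₁, hx]
        · simp [hz1 x hx]
      simp_rw [e1, e, ← e2, neg_neg]
      rw [← integral_add_right_eq_self (fun x => ψ (x - t • v) * g₁ x) (t • v)]
      simp
    · intro x hx
      rw [hz1 x fun hm => hx (hLΩ hm), zero_mul]
    · intro x hx
      rw [hf, hz2 x fun hm => hx (hLΩ hm)]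
      simp
  -- Integrating the slice identities over `t` and exchanging the integrals leaves the integral of
  -- the derivative of `ψ` along a segment, which is a difference of values. Translating back moves
  -- this difference onto `u₁`.
  have hT3 : ∫ z, ψ z * ∫ t in Ioc (0 : ℝ) 1, g₁ (z + t • v) =
      ∫ x, u₁ x * (ψ (x - v) - ψ x) := by
    simp_rw [← integral_const_mul]
    rw [integral_integral_swap ig3, setIntegral_congr_fun measurableSet_Ioc hslice,
      integral_neg, ← integral_integral_swap iu3, ← integral_neg]
    refine integral_congr_ae (Eventually.of_forall fun x => ?_)
    simp only
    rw [integral_const_mul, integral_fderiv_comp_sub_smul hψ]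
    ring
  have i1 : Integrable fun z => ψ z * u₁ (z + v) :=
    (iu.comp_add_right v).bdd_mul hψ.continuous.aestronglyMeasurable
      (Eventually.of_forall hM)
  have i2 : Integrable fun z => ψ z * u₁ z :=
    iu.bdd_mul hψ.continuous.aestronglyMeasurable (Eventually.of_forall hM)
  have i3 : Integrable fun z => ψ z * ∫ t in Ioc (0 : ℝ) 1, g₁ (z + t • v) :=
    ig2.integral_prod_left.bdd_mul hψ.continuous.aestronglyMeasurable (Eventually.of_forall hM)
  have i4 : Integrable fun z => u₁ z * ψ (z - v) := by
    simpa [mul_comm] using i1.comp_sub_right v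
  have i5 : Integrable fun z => u₁ z * ψ z := by simpa [mul_comm] using i2
  simp_rw [mul_sub]
  rw [integral_sub (f := fun z => ψ z * u₁ (z + v) - ψ z * u₁ z) (i1.sub i2) i3,
    integral_sub i1 i2, hT3]
  simp_rw [mul_sub]
  rw [integral_sub i4 i5, ← integral_add_right_eq_self (fun z => u₁ z * ψ (z - v)) v]
  simp_rw [add_sub_cancel_right, mul_comm]
  ring

/-- A function with a weak gradient satisfies the fundamental theorem of calculus on almost every
segment of a given direction and length that stays in the domain. -/
theorem HasWeakGradient.ae_sub_eq_integral {Ω : Set (Space n)} (hΩ : IsOpen Ω)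
    {u : Space n → ℝ} {G : Space n → Space n} (h : HasWeakGradient Ω u G) (v : Space n) :
    ∀ᵐ z : Space n, (∀ t ∈ Icc (0 : ℝ) 1, z + t • v ∈ Ω) →
      u (z + v) - u z = ∫ t in Ioc (0 : ℝ) 1, inner ℝ (G (z + t • v)) v := by
  set U := {z : Space n | ∀ t ∈ Icc (0 : ℝ) 1, z + t • v ∈ Ω} with hU
  have hUo : IsOpen U := isOpen_setOf_segment hΩ v
  set f : Space n → ℝ := fun z => u (z + v) - u z -
    ∫ t in Ioc (0 : ℝ) 1, inner ℝ (G (z + t • v)) v with hf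
  have hfL : ∀ {K L : Set (Space n)}, (∀ z ∈ K, ∀ t ∈ Icc (0 : ℝ) 1, z + t • v ∈ L) → ∀ z ∈ K,
      f z = L.indicator u (z + v) - L.indicator u z -
      ∫ t in Ioc (0 : ℝ) 1, L.indicator (fun x => inner ℝ (G x) v) (z + t • v) := by
    intro K L hKL z hz
    have h0 : z ∈ L := by simpa using hKL z hz 0 ⟨le_rfl, zero_le_one⟩
    have h1 : z + v ∈ L := by simpa using hKL z hz 1 ⟨zero_le_one, le_rfl⟩
    rw [indicator_of_mem h0, indicator_of_mem h1, hf]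
    refine congrArg _ (setIntegral_congr_fun measurableSet_Ioc fun t ht => ?_)
    rw [indicator_of_mem (hKL z hz t ⟨ht.1.le, ht.2⟩)]
  have hloc : LocallyIntegrableOn f U := by
    rw [locallyIntegrableOn_iff hUo.isLocallyClosed]
    intro K hKU hK
    obtain ⟨L, hLΩ, hL, hKL⟩ := exists_compact_segments hK hKU
    have hLm : MeasurableSet L := hL.isClosed.measurableSet
    have iu : Integrable (L.indicator u) :=
      (h.locallyIntegrableOn.integrableOn_compact_subset hLΩ hL).integrable_indicator hLm
    have ig : Integrable (L.indicator (fun x => inner ℝ (G x) v)) :=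
      (h.integrableOn_inner hLΩ hL v).integrable_indicator hLm
    have := ((iu.comp_add_right v).sub iu).sub (integrable_comp_add_smul ig v).integral_prod_left
    exact this.integrableOn.congr_fun (fun z hz => (hfL hKL z hz).symm) hK.isClosed.measurableSet
  -- The defect `f` has zero integral against every test function in the open set `U` of admissible
  -- starting points, hence vanishes almost everywhere there.
  have key := hUo.ae_eq_zero_of_integral_contDiff_smul_eq_zero hloc fun ψ hψ hc hs => by
    obtain ⟨L, hLΩ, hL, hKL⟩ := exists_compact_segments hc hs
    rw [← h.integral_test_segment hΩ hψ hc hLΩ hL hKL]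
    refine integral_congr_ae (Eventually.of_forall fun z => ?_)
    simp only [smul_eq_mul]
    by_cases hz : z ∈ tsupport ψ
    · rw [hfL hKL z hz]
    · simp [image_eq_zero_of_notMem_tsupport hz]
  filter_upwards [key] with z hz hm
  exact sub_eq_zero.1 (hz hm)

theorem HasWeakGradient.ae_enorm_sub_le {Ω : Set (Space n)} (hΩ : IsOpen Ω)
    {u : Space n → ℝ} {G : Space n → Space n} (h : HasWeakGradient Ω u G) (v : Space n) :
    ∀ᵐ z : Space n, (∀ t ∈ Icc (0 : ℝ) 1, z + t • v ∈ Ω) →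
      ‖u (z + v) - u z‖ₑ ≤ ∫⁻ t in Ioc (0 : ℝ) 1, ‖v‖ₑ * ‖G (z + t • v)‖ₑ := by
  filter_upwards [h.ae_sub_eq_integral hΩ v] with z hz hm
  rw [hz hm]
  refine (enorm_integral_le_lintegral_enorm _).trans (lintegral_mono fun t => ?_)
  simp only [← ofReal_norm]
  rw [← ENNReal.ofReal_mul (norm_nonneg _), mul_comm]
  exact ENNReal.ofReal_le_ofReal (norm_inner_le_norm _ _)

end Segments

/-! ### The `L¹` Poincaré inequality on balls -/

section Poincare

variable {n : ℕ}

/-- The Jacobian factor is `t ^ (-n)`, bounded because `t` stays away from zero. -/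
theorem lintegral_comp_add_smul_le {f : Space n → ℝ≥0∞} (hf : Measurable f) (a : Space n) {t : ℝ}
    (ht : 1 / 2 ≤ t) : ∫⁻ y, f (a + t • y) ≤ 2 ^ n * ∫⁻ y, f y := by
  have ht0 : 0 < t := by linarith
  have h1 : ∫⁻ y, f (a + t • y) = ∫⁻ y, f (a + y) ∂(Measure.map (t • ·) volume) := by
    rw [lintegral_map (f := fun y => f (a + y)) (hf.comp (measurable_const_add a))
      (measurable_const_smul t)]
  rw [h1, map_addHaar_smul _ ht0.ne', lintegral_smul_measure, lintegral_add_left_eq_self,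
    finrank_euclideanSpace_fin, smul_eq_mul]
  gcongr
  rw [← inv_pow, abs_of_pos (by positivity), ENNReal.ofReal_pow (by positivity)]
  gcongr
  rw [show (2 : ℝ≥0∞) = ENNReal.ofReal 2 by simp]
  refine ENNReal.ofReal_le_ofReal ?_
  rw [inv_le_comm₀ ht0 (by norm_num)]
  linarith

/-- Averages of a function at the point dividing a segment with random ends in a ball. -/
theorem lintegral_ball_ball_segment_le {N : Space n → ℝ≥0∞} (hN : Measurable N) (x : Space n)
    (r : ℝ) {t : ℝ} (ht : t ∈ Ioc (0 : ℝ) 1) :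
    ∫⁻ z in ball x r, ∫⁻ y in ball x r, N (z + t • (y - z)) ≤
      2 ^ n * volume (ball x r) * ∫⁻ p in ball x r, N p := by
  have main : ∀ (s : ℝ), 1 / 2 ≤ s → s ≤ 1 →
      ∫⁻ z in ball x r, ∫⁻ y in ball x r, N ((1 - s) • z + s • y) ≤
      2 ^ n * volume (ball x r) * ∫⁻ p in ball x r, N p := by
    intro s hs hs1
    have hNB := hN.indicator (measurableSet_ball (x := x) (ε := r))
    have h1 : ∀ z ∈ ball x r, ∫⁻ y in ball x r, N ((1 - s) • z + s • y) ≤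
        2 ^ n * ∫⁻ p in ball x r, N p := by
      intro z hz
      rw [← lintegral_indicator measurableSet_ball (f := N)]
      refine le_trans ?_ (lintegral_comp_add_smul_le hNB ((1 - s) • z) hs)
      refine (setLIntegral_mono (g := fun y => (ball x r).indicator N ((1 - s) • z + s • y))
        (hNB.comp (by fun_prop)) fun y hy => ?_).trans (setLIntegral_le_lintegral _ _)
      have : (1 - s) • z + s • y ∈ ball x r :=
        convex_ball x r hz hy (by linarith) (by linarith) (by ring)
      rw [indicator_of_mem this]
    calc _ ≤ ∫⁻ z in ball x r, 2 ^ n * ∫⁻ p in ball x r, N p :=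
          setLIntegral_mono measurable_const h1
      _ = _ := by rw [setLIntegral_const]; ring
  -- For `t ≥ 1/2` the dividing point depends on `y` with a factor at least `1/2`, so one
  -- substitutes in `y`. For `t ≤ 1/2` the two endpoints exchange roles.
  rcases le_total (1 / 2) t with h | h
  · convert main t h ht.2 using 6
    module
  · rw [lintegral_lintegral_swap]
    · convert main (1 - t) (by linarith) (by linarith [ht.1]) using 6
      module
    · exact (hN.comp (by fun_prop)).aemeasurable

/-- Poincaré inequality on balls, for a function controlled by `G` along almost every segment. -/
theorem lintegral_ball_ball_enorm_sub_le {u : Space n → ℝ} {G : Space n → Space n}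
    (hu : Measurable u) (hG : Measurable G)
    (hline : ∀ v : Space n, ∀ᵐ z : Space n,
      ‖u (z + v) - u z‖ₑ ≤ ∫⁻ t in Ioc (0 : ℝ) 1, ‖v‖ₑ * ‖G (z + t • v)‖ₑ)
    (x : Space n) {r : ℝ} (hr : 0 < r) :
    ∫⁻ z in ball x r, ∫⁻ y in ball x r, ‖u y - u z‖ₑ ≤
      ENNReal.ofReal (2 * r) * (2 ^ n * volume (ball x r) * ∫⁻ p in ball x r, ‖G p‖ₑ) := by
  have hmB : Measurable fun q : Space n × Space n => (q.1 + q.2) := by fun_prop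
  set B := ball x r with hB
  have hBm : MeasurableSet B := measurableSet_ball
  set S : Set (Space n × Space n) := {q | q.1 ∈ B ∧ q.1 + q.2 ∈ B} with hS
  have hSm : MeasurableSet S := (measurable_fst hBm).inter (hmB hBm)
  -- rewriting double integrals over the ball with the difference variable
  have chg : ∀ F : Space n → Space n → ℝ≥0∞,
      ∫⁻ z in B, ∫⁻ y in B, F z y =
        ∫⁻ z, ∫⁻ v, S.indicator (fun q => F q.1 (q.1 + q.2)) (z, v) := by
    intro F
    rw [← lintegral_indicator hBm]
    refine lintegral_congr fun z => ?_
    by_cases hz : z ∈ B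
    · rw [indicator_of_mem hz, ← lintegral_indicator hBm,
        ← lintegral_add_left_eq_self (fun y => B.indicator (F z) y) z]
      refine lintegral_congr fun v => ?_
      by_cases hv : z + v ∈ B
      · rw [indicator_of_mem hv, indicator_of_mem (show (z, v) ∈ S from ⟨hz, hv⟩)]
      · rw [indicator_of_notMem hv, indicator_of_notMem fun h : (z, v) ∈ S => hv h.2]
    · rw [indicator_of_notMem hz]
      have : ∀ v, S.indicator (fun q => F q.1 (q.1 + q.2)) (z, v) = 0 := fun v =>
        indicator_of_notMem (fun h : (z, v) ∈ S => hz h.1) _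
      simp [this]
  have chg' : ∀ F : Space n → Space n → ℝ≥0∞,
      Measurable (fun q : Space n × Space n => F q.1 (q.1 + q.2)) →
      ∫⁻ z in B, ∫⁻ y in B, F z y =
        ∫⁻ v, ∫⁻ z, S.indicator (fun q => F q.1 (q.1 + q.2)) (z, v) := by
    intro F hF
    rw [chg]
    exact lintegral_lintegral_swap (hF.indicator hSm).aemeasurable
  have hF2 : Measurable fun q : (Space n × Space n) × ℝ =>
      ‖q.1.2‖ₑ * ‖G (q.1.1 + q.2 • q.1.2)‖ₑ :=
    (by fun_prop : Measurable fun q : (Space n × Space n) × ℝ => ‖q.1.2‖ₑ).mul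
      ((hG.comp (by fun_prop)).enorm)
  have hF3 : Measurable fun q : (Space n × Space n) × ℝ =>
      ‖G (q.1.1 + q.2 • (q.1.2 - q.1.1))‖ₑ := (hG.comp (by fun_prop)).enorm
  -- The hypothesis `hline` gives, for each fixed difference `v`, an exceptional null set of `z`. It
  -- can therefore be used only after passing to the variables `(z, v)` with `v` integrated
  -- outermost.
  have step1 : ∫⁻ z in B, ∫⁻ y in B, ‖u y - u z‖ₑ ≤
      ∫⁻ z in B, ∫⁻ y in B, ∫⁻ t in Ioc (0 : ℝ) 1, ‖y - z‖ₑ * ‖G (z + t • (y - z))‖ₑ := by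
    rw [chg', chg']
    · refine lintegral_mono fun v => lintegral_mono_ae ?_
      filter_upwards [hline v] with z hz
      by_cases hm : (z, v) ∈ S
      · simp only [indicator_of_mem hm, add_sub_cancel_left]
        exact hz
      · simp only [indicator_of_notMem hm, le_refl]
    · simpa only [add_sub_cancel_left] using hF2.lintegral_prod_right'
    · exact ((hu.comp hmB).sub (hu.comp measurable_fst)).enorm
  refine step1.trans ?_
  have step2 : ∫⁻ z in B, ∫⁻ y in B, ∫⁻ t in Ioc (0 : ℝ) 1, ‖y - z‖ₑ * ‖G (z + t • (y - z))‖ₑ ≤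
      ENNReal.ofReal (2 * r) *
        ∫⁻ z in B, ∫⁻ y in B, ∫⁻ t in Ioc (0 : ℝ) 1, ‖G (z + t • (y - z))‖ₑ := by
    have hm2 : Measurable fun q : Space n × Space n =>
        ∫⁻ t in Ioc (0 : ℝ) 1, ‖G (q.1 + t • (q.2 - q.1))‖ₑ := hF3.lintegral_prod_right'
    rw [← lintegral_const_mul _ hm2.lintegral_prod_right']
    refine setLIntegral_mono (hm2.lintegral_prod_right'.const_mul _) fun z hz => ?_
    have hm3 : Measurable fun y => ∫⁻ t in Ioc (0 : ℝ) 1, ‖G (z + t • (y - z))‖ₑ :=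
      ((hG.comp (by fun_prop)).enorm : Measurable fun q : Space n × ℝ =>
        ‖G (z + q.2 • (q.1 - z))‖ₑ).lintegral_prod_right'
    rw [← lintegral_const_mul _ hm3]
    refine setLIntegral_mono (hm3.const_mul _) fun y hy => ?_
    have hm4 : Measurable fun t : ℝ => ‖G (z + t • (y - z))‖ₑ := (hG.comp (by fun_prop)).enorm
    rw [← lintegral_const_mul _ hm4]
    refine lintegral_mono fun t => mul_le_mul_left ?_ _
    rw [← edist_eq_enorm_sub, edist_dist]
    refine ENNReal.ofReal_le_ofReal ?_
    have h1 : dist y x < r := hy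
    have h2 : dist z x < r := hz
    linarith [dist_triangle_right y z x]
  refine step2.trans (mul_le_mul_right ?_ _)
  -- Time goes outermost, so that the estimate for dividing points applies at each fixed `t`.
  have step3 : ∫⁻ z in B, ∫⁻ y in B, ∫⁻ t in Ioc (0 : ℝ) 1, ‖G (z + t • (y - z))‖ₑ =
      ∫⁻ t in Ioc (0 : ℝ) 1, ∫⁻ z in B, ∫⁻ y in B, ‖G (z + t • (y - z))‖ₑ := by
    have e1 : ∀ z, ∫⁻ y in B, ∫⁻ t in Ioc (0 : ℝ) 1, ‖G (z + t • (y - z))‖ₑ =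
        ∫⁻ t in Ioc (0 : ℝ) 1, ∫⁻ y in B, ‖G (z + t • (y - z))‖ₑ := fun z =>
      lintegral_lintegral_swap
        ((hG.comp (by fun_prop)).enorm : Measurable fun q : Space n × ℝ =>
          ‖G (z + q.2 • (q.1 - z))‖ₑ).aemeasurable
    simp_rw [e1]
    refine lintegral_lintegral_swap (Measurable.aemeasurable ?_)
    exact Measurable.lintegral_prod_right' (f := fun q : (Space n × ℝ) × Space n =>
      ‖G (q.1.1 + q.1.2 • (q.2 - q.1.1))‖ₑ) (hG.comp (by fun_prop)).enorm
  rw [step3]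
  calc ∫⁻ t in Ioc (0 : ℝ) 1, ∫⁻ z in B, ∫⁻ y in B, ‖G (z + t • (y - z))‖ₑ
      ≤ ∫⁻ t in Ioc (0 : ℝ) 1, 2 ^ n * volume B * ∫⁻ p in B, ‖G p‖ₑ :=
        setLIntegral_mono measurable_const fun t ht =>
          lintegral_ball_ball_segment_le hG.enorm x r ht
    _ = _ := by rw [setLIntegral_const, Real.volume_Ioc]; norm_num

end Poincare

/-! ### Oscillation of averages controlled by a Riesz-type potential -/

section Averages

variable {n : ℕ}

/-- The `L¹` Poincaré inequality on all balls. -/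
def SatisfiesPoincare (u : Space n → ℝ) (G : Space n → Space n) : Prop :=
  ∀ (x : Space n) (r : ℝ), 0 < r → ∫⁻ z in ball x r, ∫⁻ y in ball x r, ‖u y - u z‖ₑ ≤
    ENNReal.ofReal (2 * r) * (2 ^ n * volume (ball x r) * ∫⁻ p in ball x r, ‖G p‖ₑ)

/-- The truncated Riesz-type potential of `‖G‖²` controlling the oscillation near `x`. -/
def gradPotential (G : Space n → Space n) (x : Space n) (r : ℝ) : ℝ≥0∞ :=
  ∫⁻ p in ball x r, ‖G p‖ₑ ^ 2 * edist p x ^ (-((n : ℝ) - 3 / 2))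

theorem gradPotential_mono (G : Space n → Space n) (x : Space n) {r s : ℝ} (h : r ≤ s) :
    gradPotential G x r ≤ gradPotential G x s :=
  lintegral_mono_set (ball_subset_ball h)

theorem enorm_average_sub_mul_le {S : Set (Space n)} (hS0 : volume S ≠ 0) (hS : volume S ≠ ⊤)
    {u : Space n → ℝ} (hu : IntegrableOn u S) (c : ℝ) :
    ‖(⨍ y in S, u y) - c‖ₑ * volume S ≤ ∫⁻ y in S, ‖u y - c‖ₑ := by
  have hpos : 0 < volume.real S := ENNReal.toReal_pos hS0 hS
  have e : ∫ y in S, (u y - c) = ((⨍ y in S, u y) - c) * volume.real S := by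
    rw [integral_sub hu (integrableOn_const hS), setIntegral_const, setAverage_eq, smul_eq_mul,
      smul_eq_mul]
    field_simp
  calc ‖(⨍ y in S, u y) - c‖ₑ * volume S = ‖∫ y in S, (u y - c)‖ₑ := by
        rw [e, enorm_mul, Real.enorm_of_nonneg hpos.le, Measure.real, ENNReal.ofReal_toReal hS]
    _ ≤ _ := enorm_integral_le_lintegral_enorm _

theorem volume_ball_ne_zero (x : Space n) {r : ℝ} (hr : 0 < r) : volume (ball x r) ≠ 0 :=
  (measure_ball_pos _ _ hr).ne'

/-- In the ball `(r / |p - x|) ^ (n - 3/2) ≥ 1`, because `n ≥ 2` makes the exponent positive. -/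
theorem lintegral_sq_le_gradPotential (hn : 2 ≤ n) (G : Space n → Space n) (x : Space n)
    {r : ℝ} (hr : 0 < r) :
    ∫⁻ p in ball x r, ‖G p‖ₑ ^ 2 ≤
      ENNReal.ofReal (r ^ ((n : ℝ) - 3 / 2)) * gradPotential G x r := by
  have hn' : (2 : ℝ) ≤ n := by exact_mod_cast hn
  rw [gradPotential, ← lintegral_const_mul' _ _ ENNReal.ofReal_ne_top]
  refine setLIntegral_mono' measurableSet_ball fun p hp => ?_
  rw [mul_left_comm]
  refine le_mul_of_one_le_right zero_le ?_
  rw [← ENNReal.ofReal_rpow_of_pos hr, ENNReal.rpow_neg, ← div_eq_mul_inv,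
    ← ENNReal.div_rpow_of_nonneg _ _ (by linarith)]
  refine ENNReal.one_le_rpow ?_ (by linarith)
  have h1 : edist p x ≤ ENNReal.ofReal r := by
    rw [edist_dist]; exact ENNReal.ofReal_le_ofReal (le_of_lt hp)
  rcases eq_or_ne (edist p x) 0 with h0 | h0
  · rw [h0, ENNReal.div_zero (by simpa using hr)]; exact le_top
  · rw [ENNReal.le_div_iff_mul_le (Or.inl h0) (Or.inl (edist_ne_top _ _)), one_mul]
    exact h1

/-- The oscillation of `u` on a ball is controlled by the potential. -/
theorem exists_lintegral_ball_ball_le_gradPotential (hn : 2 ≤ n) :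
    ∃ K : ℝ, 0 ≤ K ∧ ∀ (u : Space n → ℝ) (G : Space n → Space n), Measurable G →
      SatisfiesPoincare u G → ∀ (x : Space n) (r j : ℝ), 0 < r → 0 ≤ j →
      gradPotential G x r ≤ ENNReal.ofReal j →
      ∫⁻ z in ball x r, ∫⁻ y in ball x r, ‖u y - u z‖ₑ ≤
        volume (ball x r) ^ 2 * ENNReal.ofReal (K * √(√r * j)) := by
  set W := (volume (ball (0 : Space n) 1)).toReal with hW
  have hW0 : 0 < W := ENNReal.toReal_pos (volume_ball_ne_zero 0 one_pos) measure_ball_lt_top.ne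
  -- Squaring the Poincaré bound and using Cauchy–Schwarz gives `4 r² 4^n |B|³ r^(n-3/2) j`. As `r²
  -- r^(n-3/2) = r^n √r = |B| √r / W`, this equals `|B|⁴ (2^(n+1))² √r j / W`.
  refine ⟨2 ^ (n + 1) / √W, by positivity, fun u G hG hP x r j hr hj hJ => ?_⟩
  have hB : volume (ball x r) = ENNReal.ofReal (r ^ n * W) := by
    rw [volume_ball_eq x hr, ENNReal.ofReal_mul (by positivity), hW,
      ENNReal.ofReal_toReal measure_ball_lt_top.ne]
  have h1 : (∫⁻ p in ball x r, ‖G p‖ₑ) ^ 2 ≤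
      ENNReal.ofReal (r ^ n * W * (r ^ ((n : ℝ) - 3 / 2) * j)) := by
    refine (sq_lintegral_le hG.enorm.aemeasurable).trans ?_
    rw [Measure.restrict_apply_univ, hB, ENNReal.ofReal_mul (q := _ * j) (by positivity)]
    refine mul_le_mul_right ?_ _
    rw [ENNReal.ofReal_mul (by positivity)]
    exact (lintegral_sq_le_gradPotential hn G x hr).trans (mul_le_mul_right hJ _)
  refine (ENNReal.pow_le_pow_left_iff two_ne_zero).1
    ((pow_le_pow_left₀ zero_le (hP x r hr) 2).trans ?_)
  rw [mul_pow, mul_pow _ (∫⁻ p in ball x r, ‖G p‖ₑ)]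
  refine (mul_le_mul_right (mul_le_mul_right h1 _) _).trans (le_of_eq ?_)
  rw [hB, show (2 : ℝ≥0∞) ^ n = ENNReal.ofReal (2 ^ n) by
    rw [ENNReal.ofReal_pow (by norm_num)]; simp]
  rw [← ENNReal.ofReal_pow (by positivity), ← ENNReal.ofReal_pow (by positivity),
    ← ENNReal.ofReal_mul (by positivity), ← ENNReal.ofReal_pow (by positivity),
    ← ENNReal.ofReal_mul (by positivity), ← ENNReal.ofReal_mul (by positivity),
    ← ENNReal.ofReal_mul (by positivity), ← ENNReal.ofReal_pow (by positivity)]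
  congr 1
  have e1 : r ^ ((n : ℝ) - 3 / 2) * r ^ 2 = r ^ n * √r := by
    rw [Real.sqrt_eq_rpow, ← Real.rpow_natCast r n, ← Real.rpow_natCast r 2,
      ← Real.rpow_add hr, ← Real.rpow_add hr]
    congr 1
    push_cast
    ring
  rw [mul_pow ((r ^ n * W) ^ 2), mul_pow (2 ^ (n + 1) / √W), div_pow, Real.sq_sqrt hW0.le,
    Real.sq_sqrt (by positivity)]
  generalize r ^ ((n : ℝ) - 3 / 2) = ρ at e1 ⊢
  rw [div_mul_eq_mul_div, mul_div_assoc', eq_div_iff hW0.ne']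
  linear_combination (4 * j * (2 ^ n) ^ 2 * (r ^ n) ^ 3 * W ^ 4) * e1

/-- Local integrability of `u` is known only inside `Ω`, while the ball may meet `Γ`. The finite
double integral supplies a point `z` for which `u - u z` is integrable on the ball, and the constant
`u z` is harmless. -/
theorem integrableOn_ball_of_gradPotential (hn : 2 ≤ n) {u : Space n → ℝ}
    {G : Space n → Space n} (hu : Measurable u) (hG : Measurable G) (hP : SatisfiesPoincare u G)
    {x : Space n} {r : ℝ} (hr : 0 < r) (hJ : gradPotential G x r ≠ ⊤) :
    IntegrableOn u (ball x r) := by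
  obtain ⟨K, -, hK⟩ := exists_lintegral_ball_ball_le_gradPotential hn
  have h := hK u G hG hP x r _ hr ENNReal.toReal_nonneg (ENNReal.ofReal_toReal hJ).ge
  have hfin : ∫⁻ z in ball x r, ∫⁻ y in ball x r, ‖u y - u z‖ₑ ≠ ⊤ :=
    (h.trans_lt (ENNReal.mul_lt_top (ENNReal.pow_lt_top measure_ball_lt_top) (by simp))).ne
  have hm : Measurable fun z => ∫⁻ y in ball x r, ‖u y - u z‖ₑ :=
    ((by fun_prop : Measurable fun q : Space n × Space n => u q.2 - u q.1)).enorm.lintegral_prod_right'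
  have hae := ae_lt_top hm hfin
  have : (ae (volume.restrict (ball x r))).NeBot := by
    rw [ae_neBot, Ne, Measure.restrict_eq_zero]
    exact volume_ball_ne_zero x hr
  obtain ⟨z, hz⟩ := hae.exists
  have hi : IntegrableOn (fun y => u y - u z) (ball x r) :=
    ⟨(hu.sub_const _).aestronglyMeasurable, hz⟩
  have := hi.add (integrableOn_const (C := u z) measure_ball_lt_top.ne)
  exact this.congr_fun (fun y _ => by simp) measurableSet_ball

/-- Distance of `u` to its average on a ball, and comparison of averages on nested sets. -/
theorem exists_average_sub_average_le (hn : 2 ≤ n) :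
    ∃ K : ℝ, 0 ≤ K ∧ ∀ (u : Space n → ℝ) (G : Space n → Space n), Measurable u → Measurable G →
      SatisfiesPoincare u G → ∀ (x : Space n) (r j : ℝ), 0 < r → 0 ≤ j →
      gradPotential G x r ≤ ENNReal.ofReal j →
      (∫⁻ z in ball x r, ‖u z - ⨍ y in ball x r, u y‖ₑ ≤
        volume (ball x r) * ENNReal.ofReal (K * √(√r * j))) ∧
      ∀ (x' : Space n) (s : ℝ), ball x' s ⊆ ball x r → 0 < s → r ≤ 2 * s →
        |(⨍ y in ball x' s, u y) - ⨍ y in ball x r, u y| ≤ K * √(√r * j) := by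
  obtain ⟨K, hK0, hK⟩ := exists_lintegral_ball_ball_le_gradPotential hn
  have first : ∀ (u : Space n → ℝ) (G : Space n → Space n), Measurable u → Measurable G →
      SatisfiesPoincare u G → ∀ (x : Space n) (r j : ℝ), 0 < r → 0 ≤ j →
      gradPotential G x r ≤ ENNReal.ofReal j →
      ∫⁻ z in ball x r, ‖u z - ⨍ y in ball x r, u y‖ₑ ≤
        volume (ball x r) * ENNReal.ofReal (K * √(√r * j)) := by
    intro u G hu hG hP x r j hr hj hJ
    have hi := integrableOn_ball_of_gradPotential hn hu hG hP hr (hJ.trans_lt (by simp)).ne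
    have h := hK u G hG hP x r j hr hj hJ
    have hB0 := volume_ball_ne_zero x hr
    have hB : volume (ball x r) ≠ ⊤ := measure_ball_lt_top.ne
    rw [sq, mul_assoc] at h
    refine (ENNReal.mul_le_mul_iff_right hB0 hB).1 (le_trans ?_ h)
    rw [← lintegral_const_mul' _ _ hB]
    refine lintegral_mono fun z => ?_
    simp only
    rw [mul_comm, ← enorm_neg, neg_sub]
    exact enorm_average_sub_mul_le hB0 hB hi (u z)
  -- `2 ^ n` bounds the ratio of the volumes of the two balls when `r ≤ 2 * s`.
  refine ⟨2 ^ n * K, by positivity, fun u G hu hG hP x r j hr hj hJ => ⟨?_, ?_⟩⟩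
  · refine (first u G hu hG hP x r j hr hj hJ).trans ?_
    gcongr
    exact le_mul_of_one_le_left hK0 (one_le_pow₀ (by norm_num))
  · intro x' s hsub hs hrs
    have hi := integrableOn_ball_of_gradPotential hn hu hG hP hr (hJ.trans_lt (by simp)).ne
    have hB0 := volume_ball_ne_zero x' hs
    have hB : volume (ball x' s) ≠ ⊤ := measure_ball_lt_top.ne
    have h1 := (enorm_average_sub_mul_le hB0 hB (hi.mono_set hsub)
      (⨍ y in ball x r, u y)).trans ((lintegral_mono_set hsub).trans
        (first u G hu hG hP x r j hr hj hJ))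
    have h2 : volume (ball x r) ≤ 2 ^ n * volume (ball x' s) := by
      rw [volume_ball_eq x hr, volume_ball_eq x' hs, ← mul_assoc]
      gcongr
      rw [show (2 : ℝ≥0∞) ^ n = ENNReal.ofReal (2 ^ n) by
        rw [ENNReal.ofReal_pow (by norm_num)]; simp, ← ENNReal.ofReal_mul (by positivity),
        ← mul_pow]
      gcongr
    have h3 := h1.trans (mul_le_mul_left h2 _)
    rw [mul_assoc, mul_left_comm, mul_comm, ENNReal.mul_le_mul_iff_right hB0 hB,
      show (2 : ℝ≥0∞) ^ n = ENNReal.ofReal (2 ^ n) by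
        rw [ENNReal.ofReal_pow (by norm_num)]; simp, ← ENNReal.ofReal_mul (by positivity),
      ← ofReal_norm, ENNReal.ofReal_le_ofReal_iff (by positivity), Real.norm_eq_abs] at h3
    rwa [mul_assoc]

end Averages

/-! ### Pointwise traces and Lebesgue values -/

section PointwiseTrace

variable {n : ℕ}

/-- `a` is the value of `u` at `x` in the Lebesgue sense. -/
def IsLebesgueValue (u : Space n → ℝ) (x : Space n) (a : ℝ) : Prop :=
  Tendsto (fun r : ℝ => ⨍⁻ y in ball x r, ‖u y - a‖ₑ ∂volume) (𝓝[>] 0) (𝓝 0)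

theorem tendsto_sqrt_sqrt_mul (K j : ℝ) :
    Tendsto (fun r : ℝ => K * √(√r * j)) (𝓝[>] 0) (𝓝 0) := by
  have h : Continuous fun r : ℝ => K * √(√r * j) := by fun_prop
  have := (h.tendsto 0).mono_left (nhdsWithin_le_nhds (s := Ioi (0 : ℝ)))
  simpa using this

/-- Telescoping over dyadic radii. -/
theorem exists_average_sub_average_concentric_le (hn : 2 ≤ n) :
    ∃ K : ℝ, 0 ≤ K ∧ ∀ (u : Space n → ℝ) (G : Space n → Space n), Measurable u → Measurable G →
      SatisfiesPoincare u G → ∀ (x : Space n) (r j : ℝ), 0 < r → 0 ≤ j →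
      gradPotential G x r ≤ ENNReal.ofReal j → ∀ s : ℝ, 0 < s → s ≤ r →
        |(⨍ y in ball x s, u y) - ⨍ y in ball x r, u y| ≤ K * √(√r * j) := by
  obtain ⟨K, hK0, hK⟩ := exists_average_sub_average_le hn
  -- Halving the radius multiplies `√(√r * j)` by `θ = 2^(-1/4)`. The errors then sum like a
  -- geometric series, and `K / (1 - θ)` is the constant that reproduces itself in the induction, as
  -- `hKθ` records.
  set θ : ℝ := √(√(1 / 2)) with hθ
  have hθ1 : θ < 1 := by
    rw [hθ, Real.sqrt_lt' one_pos, one_pow, Real.sqrt_lt' one_pos]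
    norm_num
  have hθ2 : 0 < 1 - θ := by linarith
  have hKθ : K / (1 - θ) * θ + K = K / (1 - θ) := by field_simp; ring
  have hKle : K ≤ K / (1 - θ) := by
    rw [le_div_iff₀ hθ2]; nlinarith [Real.sqrt_nonneg (√(1 / 2 : ℝ))]
  refine ⟨K / (1 - θ), by positivity, fun u G hu hG hP x r j hr hj hJ s hs hsr => ?_⟩
  obtain ⟨k, hk⟩ : ∃ k : ℕ, r ≤ 2 ^ (k + 1) * s := by
    obtain ⟨k, hk⟩ := pow_unbounded_of_one_lt (r / s) (one_lt_two (α := ℝ))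
    refine ⟨k, ?_⟩
    rw [div_lt_iff₀ hs] at hk
    rw [pow_succ]
    nlinarith
  have near : ∀ r' : ℝ, 0 < r' → r' ≤ r → ∀ s' : ℝ, 0 < s' → s' ≤ r' → r' ≤ 2 * s' →
      |(⨍ y in ball x s', u y) - ⨍ y in ball x r', u y| ≤ K * √(√r' * j) := by
    intro r' hr' hr'r s' hs' hs'r h2
    exact (hK u G hu hG hP x r' j hr' hj ((gradPotential_mono G x hr'r).trans hJ)).2 x s'
      (ball_subset_ball hs'r) hs' h2
  have main : ∀ k : ℕ, ∀ r' : ℝ, 0 < r' → r' ≤ r → s ≤ r' → r' ≤ 2 ^ (k + 1) * s →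
      |(⨍ y in ball x s, u y) - ⨍ y in ball x r', u y| ≤ K / (1 - θ) * √(√r' * j) := by
    intro k
    induction k with
    | zero =>
      intro r' hr' hr'r hsr' hk
      exact (near r' hr' hr'r s hs hsr' (by simpa using hk)).trans
        (mul_le_mul_of_nonneg_right hKle (Real.sqrt_nonneg _))
    | succ k ih =>
      intro r' hr' hr'r hsr' hk
      by_cases h2 : r' ≤ 2 * s
      · exact (near r' hr' hr'r s hs hsr' (by linarith)).trans
          (mul_le_mul_of_nonneg_right hKle (Real.sqrt_nonneg _))
      push Not at h2
      have h3 := ih (r' / 2) (by linarith) (by linarith) (by linarith)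
        (by rw [pow_succ] at hk; linarith)
      have h4 := near r' hr' hr'r (r' / 2) (by linarith) (by linarith) (by linarith)
      have h5 : √(√(r' / 2) * j) = θ * √(√r' * j) := by
        rw [hθ, ← Real.sqrt_mul (Real.sqrt_nonneg _), ← mul_assoc,
          ← Real.sqrt_mul (by norm_num)]
        congr 3
        ring
      rw [h5] at h3
      calc _ ≤ _ := abs_sub_le _ (⨍ y in ball x (r' / 2), u y) _
        _ ≤ K / (1 - θ) * (θ * √(√r' * j)) + K * √(√r' * j) := add_le_add h3 h4
        _ = (K / (1 - θ) * θ + K) * √(√r' * j) := by ring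
        _ = _ := by rw [hKθ]
  exact main k r hr le_rfl hsr hk

/-- Existence of the trace at a point where the potential is finite, with a quantitative bound. -/
theorem exists_tendsto_average (hn : 2 ≤ n) :
    ∃ K : ℝ, 0 ≤ K ∧ ∀ (u : Space n → ℝ) (G : Space n → Space n), Measurable u → Measurable G →
      SatisfiesPoincare u G → ∀ x : Space n, (∀ r, gradPotential G x r ≠ ⊤) → ∃ a : ℝ,
        Tendsto (fun r : ℝ => ⨍ y in ball x r, u y) (𝓝[>] 0) (𝓝 a) ∧
        IsLebesgueValue u x a ∧
        ∀ r j : ℝ, 0 < r → 0 ≤ j → gradPotential G x r ≤ ENNReal.ofReal j →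
          |a - ⨍ y in ball x r, u y| ≤ K * √(√r * j) := by
  obtain ⟨K, hK0, hK⟩ := exists_average_sub_average_concentric_le hn
  obtain ⟨K₁, hK₁0, hK₁⟩ := exists_average_sub_average_le hn
  refine ⟨K, hK0, fun u G hu hG hP x hx => ?_⟩
  set m : ℝ → ℝ := fun r => ⨍ y in ball x r, u y with hm
  set j₀ := (gradPotential G x 1).toReal with hj₀
  have hj : ∀ r ≤ 1, gradPotential G x r ≤ ENNReal.ofReal j₀ := fun r hr => by
    rw [hj₀, ENNReal.ofReal_toReal (hx 1)]
    exact gradPotential_mono G x hr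
  have hj₀0 : 0 ≤ j₀ := ENNReal.toReal_nonneg
  have hcau : Cauchy (map m (𝓝[>] 0)) := by
    rw [Metric.cauchy_iff]
    refine ⟨inferInstance, fun ε hε => ?_⟩
    have h1 : ∀ᶠ r in 𝓝[>] (0 : ℝ), K * √(√r * j₀) < ε / 2 :=
      (tendsto_sqrt_sqrt_mul K j₀).eventually (gt_mem_nhds (by linarith))
    obtain ⟨r, hr1, hr2, hr3⟩ := (h1.and (Ioo_mem_nhdsGT one_pos)).exists
    refine ⟨m '' Ioc 0 r, image_mem_map (Ioc_mem_nhdsGT hr2), ?_⟩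
    rintro _ ⟨s, hs, rfl⟩ _ ⟨s', hs', rfl⟩
    have b1 := hK u G hu hG hP x r j₀ hr2 hj₀0 (hj r hr3.le) s hs.1 hs.2
    have b2 := hK u G hu hG hP x r j₀ hr2 hj₀0 (hj r hr3.le) s' hs'.1 hs'.2
    refine (dist_triangle_right _ _ (m r)).trans_lt ?_
    rw [Real.dist_eq, Real.dist_eq]
    simp only [hm]
    linarith
  obtain ⟨a, ha⟩ := CompleteSpace.complete hcau
  have hta : Tendsto m (𝓝[>] 0) (𝓝 a) := ha
  have hbound : ∀ r j : ℝ, 0 < r → 0 ≤ j → gradPotential G x r ≤ ENNReal.ofReal j →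
      |a - ⨍ y in ball x r, u y| ≤ K * √(√r * j) := by
    intro r j hr hj hJ
    refine le_of_tendsto (hta.sub_const (m r)).abs ?_
    filter_upwards [Ioc_mem_nhdsGT hr] with s hs
    exact hK u G hu hG hP x r j hr hj hJ s hs.1 hs.2
  refine ⟨a, hta, ?_, hbound⟩
  have hlim : Tendsto (fun r : ℝ => ENNReal.ofReal ((K₁ + K) * √(√r * j₀))) (𝓝[>] 0) (𝓝 0) := by
    simpa using ENNReal.tendsto_ofReal (tendsto_sqrt_sqrt_mul (K₁ + K) j₀)
  refine tendsto_of_tendsto_of_tendsto_of_le_of_le' tendsto_const_nhds hlim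
    (Eventually.of_forall fun _ => zero_le) ?_
  filter_upwards [Ioc_mem_nhdsGT one_pos] with r hr
  have hB0 := volume_ball_ne_zero x hr.1
  have hB : volume (ball x r) ≠ ⊤ := measure_ball_lt_top.ne
  have h1 := (hK₁ u G hu hG hP x r j₀ hr.1 hj₀0 (hj r hr.2)).1
  rw [setLAverage_eq, ENNReal.div_le_iff hB0 hB]
  calc ∫⁻ y in ball x r, ‖u y - a‖ₑ
      ≤ ∫⁻ y in ball x r, (‖u y - m r‖ₑ + ENNReal.ofReal (K * √(√r * j₀))) := by
        refine lintegral_mono fun y => ?_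
        rw [show u y - a = (u y - m r) + (m r - a) by ring]
        refine (enorm_add_le _ _).trans (add_le_add_right ?_ _)
        rw [← ofReal_norm, Real.norm_eq_abs, abs_sub_comm]
        exact ENNReal.ofReal_le_ofReal (hbound r j₀ hr.1 hj₀0 (hj r hr.2))
    _ ≤ volume (ball x r) * ENNReal.ofReal (K₁ * √(√r * j₀)) +
          volume (ball x r) * ENNReal.ofReal (K * √(√r * j₀)) := by
        rw [lintegral_add_right _ measurable_const, setLIntegral_const,
          mul_comm (ENNReal.ofReal (K * _))]
        exact add_le_add_left h1 _
    _ = _ := by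
        rw [← mul_add, ← ENNReal.ofReal_add (by positivity) (by positivity), ← add_mul, mul_comm]

/-- Difference of the traces at two points. -/
theorem exists_sq_trace_sub_trace_le (hn : 2 ≤ n) :
    ∃ C : ℝ≥0, ∀ (u : Space n → ℝ) (G : Space n → Space n), Measurable u → Measurable G →
      SatisfiesPoincare u G → ∀ (x x' : Space n) (a a' : ℝ), (∀ r, gradPotential G x r ≠ ⊤) →
        (∀ r, gradPotential G x' r ≠ ⊤) →
        Tendsto (fun r : ℝ => ⨍ y in ball x r, u y) (𝓝[>] 0) (𝓝 a) →
        Tendsto (fun r : ℝ => ⨍ y in ball x' r, u y) (𝓝[>] 0) (𝓝 a') → x ≠ x' →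
        ‖a - a'‖ₑ ^ 2 ≤ C * edist x x' ^ (1 / 2 : ℝ) *
          (gradPotential G x (2 * dist x x') + gradPotential G x' (2 * dist x x')) := by
  obtain ⟨K, hK0, hK⟩ := exists_tendsto_average hn
  obtain ⟨K₁, hK₁0, hK₁⟩ := exists_average_sub_average_le hn
  refine ⟨(4 * (K + K₁) ^ 2).toNNReal, fun u G hu hG hP x x' a a' hx hx' ha ha' hne => ?_⟩
  set r := dist x x' with hr
  have hr0 : 0 < r := dist_pos.2 hne
  obtain ⟨b, hb, -, hbK⟩ := hK u G hu hG hP x hx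
  obtain ⟨b', hb', -, hbK'⟩ := hK u G hu hG hP x' hx'
  obtain rfl := tendsto_nhds_unique ha hb
  obtain rfl := tendsto_nhds_unique ha' hb'
  set j := (gradPotential G x (2 * r)).toReal with hj
  set j' := (gradPotential G x' (2 * r)).toReal with hj'
  have hj0 : 0 ≤ j := ENNReal.toReal_nonneg
  have hj'0 : 0 ≤ j' := ENNReal.toReal_nonneg
  have ej : gradPotential G x (2 * r) = ENNReal.ofReal j := (ENNReal.ofReal_toReal (hx _)).symm
  have ej' : gradPotential G x' (2 * r) = ENNReal.ofReal j' := (ENNReal.ofReal_toReal (hx' _)).symm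
  -- The comparison goes from `a` to the average on `ball x (2 * r)`, then to the average on `ball
  -- x' r`, which is contained in it, then to `a'`.
  have h1 := hbK (2 * r) j (by positivity) hj0 ej.le
  have h2 := (hK₁ u G hu hG hP x (2 * r) j (by positivity) hj0 ej.le).2 x' r
    (ball_subset_ball' (by rw [dist_comm, ← hr]; linarith)) hr0 le_rfl
  have h3 := hbK' r j' hr0 hj'0 ((gradPotential_mono G x' (by linarith)).trans ej'.le)
  have h4 : √(√r * j') ≤ √(√(2 * r) * j') := by gcongr; linarith
  have h5 : |a - a'| ≤ (K + K₁) * (√(√(2 * r) * j) + √(√(2 * r) * j')) := by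
    have e : a - a' = (a - ⨍ y in ball x (2 * r), u y) -
      ((⨍ y in ball x' r, u y) - ⨍ y in ball x (2 * r), u y) -
      (a' - ⨍ y in ball x' r, u y) := by ring
    have h6 : |a - a'| ≤ |a - ⨍ y in ball x (2 * r), u y| +
        |(⨍ y in ball x' r, u y) - ⨍ y in ball x (2 * r), u y| +
        |a' - ⨍ y in ball x' r, u y| := by
      rw [e]
      exact (abs_sub _ _).trans (add_le_add_left (abs_sub _ _) _)
    have h7 := mul_le_mul_of_nonneg_left h4 hK0
    have h8 : 0 ≤ K₁ * √(√(2 * r) * j') := by positivity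
    linarith
  have h9 : |a - a'| ^ 2 ≤ 4 * (K + K₁) ^ 2 * (√r * (j + j')) := by
    have hs : √(2 * r) ≤ 2 * √r := by
      rw [Real.sqrt_mul (by norm_num)]
      gcongr
      rw [Real.sqrt_le_left (by norm_num)]
      norm_num
    have q1 := Real.sq_sqrt (show 0 ≤ √(2 * r) * j by positivity)
    have q2 := Real.sq_sqrt (show 0 ≤ √(2 * r) * j' by positivity)
    calc |a - a'| ^ 2 ≤ ((K + K₁) * (√(√(2 * r) * j) + √(√(2 * r) * j'))) ^ 2 := by gcongr
      _ = (K + K₁) ^ 2 * (√(√(2 * r) * j) + √(√(2 * r) * j')) ^ 2 := by ring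
      _ ≤ (K + K₁) ^ 2 * (2 * (√(2 * r) * j + √(2 * r) * j')) := by
          gcongr
          nlinarith [sq_nonneg (√(√(2 * r) * j) - √(√(2 * r) * j'))]
      _ ≤ (K + K₁) ^ 2 * (2 * (2 * √r * j + 2 * √r * j')) := by gcongr
      _ = _ := by ring
  rw [ej, ej', ← ENNReal.ofReal_add hj0 hj'0, edist_dist, ENNReal.ofReal_rpow_of_pos (by rwa [← hr]),
    ← Real.sqrt_eq_rpow, ← ofReal_norm, ← ENNReal.ofReal_pow (norm_nonneg _),
    Real.norm_eq_abs, ← ENNReal.ofReal, ← ENNReal.ofReal_mul (by positivity),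
    ← ENNReal.ofReal_mul (by positivity), mul_assoc]
  exact ENNReal.ofReal_le_ofReal h9

/-- Average `|a - b| ≤ |u - a| + |u - b|` over small balls. This uniqueness gives both the linearity
of the trace and its value on extensions. -/
theorem IsLebesgueValue.unique {u : Space n → ℝ} (hu : Measurable u) {x : Space n} {a b : ℝ}
    (ha : IsLebesgueValue u x a) (hb : IsLebesgueValue u x b) : a = b := by
  have h := ha.add hb
  rw [add_zero] at h
  have hle : ‖a - b‖ₑ ≤ 0 := by
    refine ge_of_tendsto h ?_
    filter_upwards [self_mem_nhdsWithin] with r hr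
    have hB0 := volume_ball_ne_zero x hr
    have hB : volume (ball x r) ≠ ⊤ := measure_ball_lt_top.ne
    have h1 : ⨍⁻ _ in ball x r, ‖a - b‖ₑ ∂volume = ‖a - b‖ₑ := setLAverage_const hB0 hB _
    rw [← h1, setLAverage_eq, setLAverage_eq, setLAverage_eq, ← ENNReal.add_div,
      ← lintegral_add_left (hu.sub_const a).enorm]
    refine ENNReal.div_le_div_right (lintegral_mono fun y => ?_) _
    rw [show a - b = (u y - b) - (u y - a) by ring, add_comm]
    exact enorm_sub_le
  have h0 : a - b = 0 := by simpa using hle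
  linarith

theorem IsLebesgueValue.add {u v : Space n → ℝ} (hu : Measurable u) {x : Space n} {a b : ℝ}
    (ha : IsLebesgueValue u x a) (hb : IsLebesgueValue v x b) :
    IsLebesgueValue (u + v) x (a + b) := by
  have h := Tendsto.add ha hb
  rw [add_zero] at h
  refine tendsto_of_tendsto_of_tendsto_of_le_of_le tendsto_const_nhds h
    (fun _ => zero_le) fun r => ?_
  simp only
  rw [setLAverage_eq, setLAverage_eq, setLAverage_eq, ← ENNReal.add_div,
    ← lintegral_add_left (hu.sub_const a).enorm]
  refine ENNReal.div_le_div_right (lintegral_mono fun y => ?_) _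
  rw [Pi.add_apply, add_sub_add_comm]
  exact enorm_add_le _ _

theorem IsLebesgueValue.smul {u : Space n → ℝ} {x : Space n} {a : ℝ} (c : ℝ)
    (ha : IsLebesgueValue u x a) : IsLebesgueValue (c • u) x (c • a) := by
  have h := ENNReal.Tendsto.const_mul (a := ‖c‖ₑ) ha (Or.inr (by simp))
  rw [mul_zero] at h
  refine h.congr fun r => ?_
  rw [setLAverage_eq, setLAverage_eq, ← mul_div_assoc, ← lintegral_const_mul' _ _ (by simp)]
  simp_rw [Pi.smul_apply, ← smul_sub, enorm_smul]

theorem IsLebesgueValue.congr {u v : Space n → ℝ} (h : u =ᵐ[volume] v) {x : Space n} {a : ℝ}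
    (ha : IsLebesgueValue u x a) : IsLebesgueValue v x a := by
  refine Tendsto.congr (fun r => ?_) ha
  rw [setLAverage_eq, setLAverage_eq]
  congr 1
  refine lintegral_congr_ae (ae_restrict_of_ae ?_)
  filter_upwards [h] with y hy
  rw [hy]

end PointwiseTrace

/-! ### The two energies as extended nonnegative integrals -/

section Energies

variable {n : ℕ} {d : ℝ} {Γ : Set (Space n)}

/-- The square of the `H` seminorm, as an extended nonnegative number. -/
def energyH (d : ℝ) (Γ : Set (Space n)) (g : Space n → ℝ) : ℝ≥0∞ :=
  ∫⁻ x, ∫⁻ y, ‖g x - g y‖ₑ ^ 2 * edist x y ^ (-(d + 1)) ∂(surfaceMeasure d Γ)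
    ∂(surfaceMeasure d Γ)

theorem enorm_slobodeckij (hd : 0 ≤ d) (g : Space n → ℝ) (p : Space n × Space n) :
    ‖slobodeckij d g p‖ₑ = ‖g p.1 - g p.2‖ₑ ^ 2 * edist p.1 p.2 ^ (-(d + 1)) := by
  -- On the diagonal both sides vanish: the real numerator is zero, and on the right `0 * ⊤ = 0`.
  rcases eq_or_ne p.1 p.2 with h | h
  · simp [slobodeckij, h]
  · have h0 : 0 < dist p.1 p.2 := dist_pos.2 h
    rw [slobodeckij, edist_dist, ENNReal.ofReal_rpow_of_pos h0, Real.rpow_neg h0.le,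
      Real.enorm_of_nonneg (by positivity), ← ofReal_norm, Real.norm_eq_abs,
      ← ENNReal.ofReal_pow (abs_nonneg _), ← ENNReal.ofReal_mul (by positivity), div_eq_mul_inv]

theorem lintegral_enorm_slobodeckij (hΓ : IsAhlforsRegular d Γ) (hd : 0 ≤ d) {g : Space n → ℝ}
    (hg : Measurable g) :
    ∫⁻ p, ‖slobodeckij d g p‖ₑ ∂((surfaceMeasure d Γ).prod (surfaceMeasure d Γ)) =
      energyH d Γ g := by
  have := hΓ.isLocallyFiniteMeasure hd
  rw [lintegral_prod _ (measurable_slobodeckij d hg).enorm.aemeasurable, energyH]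
  simp_rw [enorm_slobodeckij hd]

theorem integrable_slobodeckij_iff (hΓ : IsAhlforsRegular d Γ) (hd : 0 ≤ d) {g : Space n → ℝ}
    (hg : Measurable g) :
    Integrable (slobodeckij d g) ((surfaceMeasure d Γ).prod (surfaceMeasure d Γ)) ↔
      energyH d Γ g ≠ ⊤ := by
  rw [← lintegral_enorm_slobodeckij hΓ hd hg, ← lt_top_iff_ne_top]
  exact ⟨fun h => h.2, fun h => ⟨(measurable_slobodeckij d hg).aestronglyMeasurable, h⟩⟩

theorem normH_eq (hΓ : IsAhlforsRegular d Γ) (hd : 0 ≤ d) {g : Space n → ℝ}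
    (hg : Measurable g) : normH d Γ g = √(energyH d Γ g).toReal := by
  rw [normH, integral_eq_lintegral_of_nonneg_ae, ← lintegral_enorm_slobodeckij hΓ hd hg]
  · congr 2
    refine lintegral_congr fun p => ?_
    rw [Real.enorm_of_nonneg]
    exact div_nonneg (sq_nonneg _) (Real.rpow_nonneg dist_nonneg _)
  · exact Eventually.of_forall fun p =>
      div_nonneg (sq_nonneg _) (Real.rpow_nonneg dist_nonneg _)
  · exact (measurable_slobodeckij d hg).aestronglyMeasurable

/-- The weighted energy of a gradient field, as an extended nonnegative number. -/
def energyW (d : ℝ) (Γ : Set (Space n)) (G : Space n → Space n) : ℝ≥0∞ :=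
  ∫⁻ x in Γᶜ, ‖G x‖ₑ ^ 2 * ENNReal.ofReal (weight d Γ x)

theorem HasWeakGradient.congr_grad {Ω : Set (Space n)} {u : Space n → ℝ}
    {G G' : Space n → Space n} (h : HasWeakGradient Ω u G)
    (e : G =ᵐ[volume.restrict Ω] G') : HasWeakGradient Ω u G' where
  locallyIntegrableOn := h.locallyIntegrableOn
  locallyIntegrableOn_grad := fun x hx => by
    obtain ⟨s, hs, hi⟩ := h.locallyIntegrableOn_grad x hx
    refine ⟨s ∩ Ω, inter_mem hs self_mem_nhdsWithin, ?_⟩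
    exact (hi.mono_set inter_subset_left).congr_fun_ae
      (ae_mono (Measure.restrict_mono inter_subset_right le_rfl) e)
  integral_eq := fun φ hφ hc hs v => by
    rw [h.integral_eq φ hφ hc hs v]
    congr 1
    refine integral_congr_ae ?_
    filter_upwards [e] with x hx
    rw [hx]

theorem enorm_sq_mul_weight (v x : Space n) :
    ‖‖v‖ ^ 2 * weight d Γ x‖ₑ = ‖v‖ₑ ^ 2 * ENNReal.ofReal (weight d Γ x) := by
  rw [enorm_mul, Real.enorm_of_nonneg (weight_nonneg d Γ x), enorm_pow, enorm_norm]

theorem integrableOn_sq_mul_weight_iff {G : Space n → Space n}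
    (hG : AEStronglyMeasurable G (volume.restrict Γᶜ)) :
    IntegrableOn (fun x => ‖G x‖ ^ 2 * weight d Γ x) Γᶜ ↔ energyW d Γ G ≠ ⊤ := by
  have hm : AEStronglyMeasurable (fun x => ‖G x‖ ^ 2 * weight d Γ x) (volume.restrict Γᶜ) :=
    (hG.norm.pow 2).mul (measurable_weight d Γ).aestronglyMeasurable
  have e : ∫⁻ x in Γᶜ, ‖‖G x‖ ^ 2 * weight d Γ x‖ₑ = energyW d Γ G := by
    simp_rw [energyW, enorm_sq_mul_weight]
  rw [← e, ← lt_top_iff_ne_top]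
  exact ⟨fun h => h.2, fun h => ⟨hm, h⟩⟩

/-- Weak gradients in an open set agree almost everywhere, so any one of them computes the norm, not
only the chosen one. -/
theorem normW_eq (hΓ : IsClosed Γ) {u : Space n → ℝ} {G : Space n → Space n}
    (h : HasWeakGradient Γᶜ u G) : normW d Γ u = √(energyW d Γ G).toReal := by
  have h' := hasWeakGradient_weakGradient ⟨G, h⟩
  have hae := HasWeakGradient.ae_eq hΓ.isOpen_compl h' h
  have hm := h'.locallyIntegrableOn_grad.aestronglyMeasurable
  rw [normW, integral_eq_lintegral_of_nonneg_ae]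
  · congr 2
    refine lintegral_congr_ae ?_
    filter_upwards [hae] with x hx
    rw [hx, ← enorm_sq_mul_weight, Real.enorm_of_nonneg]
    exact mul_nonneg (sq_nonneg _) (weight_nonneg d Γ x)
  · exact Eventually.of_forall fun x => mul_nonneg (sq_nonneg _) (weight_nonneg d Γ x)
  · exact (hm.norm.pow 2).mul (measurable_weight d Γ).aestronglyMeasurable

/-- The segment estimate holds for segments inside `Ω`, and almost every segment of each direction
lies there. The Poincaré inequality thus extends to balls that meet `Γ`. A measurable representative
of the gradient is fixed for the later uses of Tonelli. -/
theorem exists_measurable_gradient (hΓ : IsAhlforsRegular d Γ) (hd : 0 ≤ d)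
    (hdn : d < (n : ℝ) - 1) (u : spaceW d Γ) :
    ∃ G : Space n → Space n, Measurable G ∧ HasWeakGradient Γᶜ u.1 G ∧ energyW d Γ G ≠ ⊤ ∧
      SatisfiesPoincare u.1 G := by
  obtain ⟨G₀, hG₀, hi⟩ := u.2
  have hm := hG₀.locallyIntegrableOn_grad.aestronglyMeasurable
  have h := hG₀.congr_grad hm.ae_eq_mk
  refine ⟨hm.mk G₀, hm.stronglyMeasurable_mk.measurable, h, ?_, ?_⟩
  · rw [← integrableOn_sq_mul_weight_iff hm.stronglyMeasurable_mk.aestronglyMeasurable]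
    refine hi.congr ?_
    filter_upwards [hm.ae_eq_mk] with x hx
    rw [← hx]
  · intro x r hr
    refine lintegral_ball_ball_enorm_sub_le u.1.measurable hm.stronglyMeasurable_mk.measurable
      (fun v => ?_) x hr
    filter_upwards [h.ae_enorm_sub_le hΓ.isClosed.isOpen_compl v,
      hΓ.ae_segment_notMem hd hdn v] with z hz hm'
    exact hz hm'

end Energies

/-! ### The full potential and the weight -/

section Potential

variable {n : ℕ} {d : ℝ} {Γ : Set (Space n)}

theorem infDist_pos_of_notMem (hΓ : IsAhlforsRegular d Γ) {x : Space n} (hx : x ∉ Γ) :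
    0 < infDist x Γ :=
  (hΓ.isClosed.notMem_iff_infDist_pos hΓ.nonempty).1 hx

/-- Integral over `Γ` of a negative power of the distance to a point outside `Γ`. -/
theorem exists_lintegral_edist_rpow_le (hΓ : IsAhlforsRegular d Γ) (hd : 0 ≤ d) {q : ℝ}
    (hq : d < q) : ∃ C : ℝ≥0, ∀ x ∉ Γ,
      ∫⁻ y, edist y x ^ (-q) ∂(surfaceMeasure d Γ) ≤
        C * ENNReal.ofReal (infDist x Γ) ^ (d - q) := by
  obtain ⟨C, hC⟩ := hΓ.exists_measure_ball_le hd
  obtain ⟨C', hC'⟩ := exists_lintegral_compl_ball_le (X := Space n) C hd hq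
  refine ⟨C', fun x hx => ?_⟩
  refine le_trans ?_ (hC' (surfaceMeasure d Γ) x (hC x) _ (infDist_pos_of_notMem hΓ hx))
  -- All of `Γ` lies outside this ball, so the tail estimate covers the whole integral.
  have hsub : Γ ⊆ (ball x (infDist x Γ))ᶜ := fun y hy => by
    simpa [dist_comm] using infDist_le_dist_of_mem (x := x) hy
  rw [surfaceMeasure, Measure.restrict_restrict measurableSet_ball.compl,
    inter_eq_right.2 hsub]

/-- The full potential `∫ ‖G p‖² |p - x|^{1-n} dp`. -/
def fullPotential (G : Space n → Space n) (x : Space n) : ℝ≥0∞ :=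
  ∫⁻ p, ‖G p‖ₑ ^ 2 * edist p x ^ (-((n : ℝ) - 1))

theorem measurable_sq_mul_edist_rpow {G : Space n → Space n} (hG : Measurable G) (q : ℝ) :
    Measurable fun z : Space n × Space n => ‖G z.2‖ₑ ^ 2 * edist z.2 z.1 ^ q :=
  ((hG.comp measurable_snd).enorm.pow_const 2).mul
    ((by fun_prop : Measurable fun z : Space n × Space n => edist z.2 z.1).pow_const q)

theorem measurable_fullPotential {G : Space n → Space n} (hG : Measurable G) :
    Measurable (fullPotential G) :=
  (measurable_sq_mul_edist_rpow hG _).lintegral_prod_right'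

/-- By Tonelli the integral over `Γ` falls on `|p - x|^(1-n)`. It converges because `d < n - 1`, and
is at most a multiple of `dist(p, Γ)^(d+1-n)`, which is exactly the weight. -/
theorem exists_lintegral_fullPotential_le (hΓ : IsAhlforsRegular d Γ) (hd : 0 ≤ d)
    (hdn : d < (n : ℝ) - 1) : ∃ C : ℝ≥0, ∀ G : Space n → Space n, Measurable G →
      ∫⁻ x, fullPotential G x ∂(surfaceMeasure d Γ) ≤ C * energyW d Γ G := by
  have := hΓ.isLocallyFiniteMeasure hd
  obtain ⟨C, hC⟩ := exists_lintegral_edist_rpow_le hΓ hd hdn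
  refine ⟨C, fun G hG => ?_⟩
  have hm := measurable_sq_mul_edist_rpow hG (-((n : ℝ) - 1))
  have hres : (volume : Measure (Space n)).restrict Γᶜ = volume := by
    refine Measure.restrict_eq_self_of_ae_mem ?_
    exact measure_eq_zero_iff_ae_notMem.1 (hΓ.volume_eq_zero hd hdn)
  simp_rw [fullPotential]
  rw [lintegral_lintegral_swap hm.aemeasurable, energyW, ← lintegral_const_mul' _ _ (by simp),
    ← hres, hres]
  nth_rewrite 1 [← hres]
  refine setLIntegral_mono' hΓ.isClosed.measurableSet.compl fun p hp => ?_
  rw [lintegral_const_mul' _ _ (by simp), mul_left_comm]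
  refine mul_le_mul_right ?_ _
  have h := hC p hp
  rw [ENNReal.ofReal_rpow_of_pos (infDist_pos_of_notMem hΓ hp)] at h
  simp_rw [edist_comm p]
  rw [weight, show -(n : ℝ) + d + 1 = d - (n - 1) by ring]
  exact h

/-- The two potentials differ by a factor `|p - x|^(1/2)`, which is at most `r^(1/2)` in the ball.
-/
theorem gradPotential_ne_top (hn : 2 ≤ n) {G : Space n → Space n} {x : Space n}
    (h : fullPotential G x ≠ ⊤) (r : ℝ) : gradPotential G x r ≠ ⊤ := by
  have hn' : (2 : ℝ) ≤ n := by exact_mod_cast hn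
  suffices h1 : gradPotential G x r ≤ ENNReal.ofReal r ^ (1 / 2 : ℝ) * fullPotential G x from
    (h1.trans_lt (ENNReal.mul_lt_top (ENNReal.rpow_lt_top_of_nonneg (by norm_num) (by simp))
      h.lt_top)).ne
  rw [gradPotential, fullPotential, ← lintegral_const_mul' _ _ (by simp)]
  refine (setLIntegral_mono' measurableSet_ball fun p hp => ?_).trans
    (setLIntegral_le_lintegral _ _)
  rw [mul_left_comm]
  refine mul_le_mul_right ?_ _
  have h1 : edist p x ≤ ENNReal.ofReal r := by
    rw [edist_dist]; exact ENNReal.ofReal_le_ofReal (le_of_lt hp)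
  rcases eq_or_ne (edist p x) 0 with h0 | h0
  · have hr : 0 < r := dist_nonneg.trans_lt hp
    rw [h0, ENNReal.zero_rpow_of_neg (by linarith), ENNReal.zero_rpow_of_neg (by linarith),
      ENNReal.mul_top (by simp [hr])]
  · calc edist p x ^ (-((n : ℝ) - 3 / 2))
        = edist p x ^ (1 / 2 : ℝ) * edist p x ^ (-((n : ℝ) - 1)) := by
          rw [← ENNReal.rpow_add _ _ h0 (edist_ne_top _ _)]
          congr 1; ring
      _ ≤ _ := by gcongr

theorem measurable_average_ball {u : Space n → ℝ} (hu : Measurable u) (r : ℝ) :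
    Measurable fun x => ⨍ y in ball x r, u y := by
  have hS : MeasurableSet {z : Space n × Space n | dist z.2 z.1 < r} :=
    (isOpen_lt (by fun_prop) (by fun_prop)).measurableSet
  have h1 : StronglyMeasurable fun x => ∫ y in ball x r, u y := by
    have := (((hu.comp measurable_snd).indicator hS).stronglyMeasurable.integral_prod_right'
      (ν := (volume : Measure (Space n))))
    convert this using 2 with x
    rw [← integral_indicator measurableSet_ball]
    refine integral_congr_ae (Eventually.of_forall fun y => ?_)
    simp only [indicator, mem_ball, mem_ofPred_eq, Function.comp]
  simp_rw [setAverage_eq, smul_eq_mul]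
  have h2 : Measurable fun x : Space n => volume.real (ball x r) :=
    (measurable_measure_ball volume r).ennreal_toReal
  exact h2.inv.mul h1.measurable

end Potential

/-! ### The trace operator and its energy bound -/

section Trace

variable {n : ℕ} {d : ℝ} {Γ : Set (Space n)}

theorem measurable_gradPotential {G : Space n → Space n} (hG : Measurable G) :
    Measurable fun z : Space n × Space n => gradPotential G z.1 (2 * dist z.1 z.2) := by
  have hS : MeasurableSet {w : (Space n × Space n) × Space n |
      dist w.2 w.1.1 < 2 * dist w.1.1 w.1.2} :=
    (isOpen_lt (by fun_prop) (by fun_prop)).measurableSet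
  have hm : Measurable fun w : (Space n × Space n) × Space n =>
      ‖G w.2‖ₑ ^ 2 * edist w.2 w.1.1 ^ (-((n : ℝ) - 3 / 2)) :=
    ((hG.comp measurable_snd).enorm.pow_const 2).mul
      ((by fun_prop : Measurable fun w : (Space n × Space n) × Space n =>
        edist w.2 w.1.1).pow_const _)
  have h := (hm.indicator hS).lintegral_prod_right' (ν := (volume : Measure (Space n)))
  convert h using 2 with z
  rw [gradPotential, ← lintegral_indicator measurableSet_ball]
  rfl

/-- For fixed `p`, only points `x'` with `|x - x'| > |p - x| / 2` contribute. Since `d + 1/2 > d`,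
the tail of `|x - x'|^(-(d+1/2))` there is at most a multiple of `|p - x|^(-1/2)`. This is the half
power that separates the exponents `n - 3/2` and `n - 1`. -/
theorem exists_lintegral_gradPotential_le (hn : 2 ≤ n) (hΓ : IsAhlforsRegular d Γ) (hd : 0 ≤ d) :
    ∃ C : ℝ≥0, ∀ (G : Space n → Space n), Measurable G → ∀ x : Space n,
      ∫⁻ x', edist x x' ^ (-(d + 1 / 2)) * gradPotential G x (2 * dist x x')
        ∂(surfaceMeasure d Γ) ≤ C * fullPotential G x := by
  have := hΓ.isLocallyFiniteMeasure hd
  obtain ⟨C, hC⟩ := hΓ.exists_measure_ball_le hd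
  obtain ⟨C', hC'⟩ := exists_lintegral_compl_ball_le (X := Space n) C hd
    (show d < d + 1 / 2 by linarith)
  refine ⟨C' * ((2 : ℝ) ^ (1 / 2 : ℝ)).toNNReal, fun G hG x => ?_⟩
  have hS : MeasurableSet {w : Space n × Space n | dist w.2 x < 2 * dist x w.1} :=
    (isOpen_lt (by fun_prop) (by fun_prop)).measurableSet
  set h : Space n → ℝ≥0∞ := fun p => ‖G p‖ₑ ^ 2 * edist p x ^ (-((n : ℝ) - 3 / 2)) with hh
  have hhm : Measurable h :=
    (hG.enorm.pow_const 2).mul ((by fun_prop : Measurable fun p => edist p x).pow_const _)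
  set k : Space n → ℝ≥0∞ := fun x' => edist x' x ^ (-(d + 1 / 2)) with hk
  have hkm : Measurable k := (by fun_prop : Measurable fun p => edist p x).pow_const _
  set Ψ : Space n × Space n → ℝ≥0∞ :=
    {w : Space n × Space n | dist w.2 x < 2 * dist x w.1}.indicator
      (fun w => k w.1 * h w.2) with hΨ
  have hΨm : Measurable Ψ :=
    ((hkm.comp measurable_fst).mul (hhm.comp measurable_snd)).indicator hS
  have e1 : ∀ x', edist x x' ^ (-(d + 1 / 2)) * gradPotential G x (2 * dist x x') =
      ∫⁻ p, Ψ (x', p) := by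
    intro x'
    rw [gradPotential, ← lintegral_const_mul _ hhm, ← lintegral_indicator measurableSet_ball]
    refine lintegral_congr fun p => ?_
    rw [edist_comm]
    rfl
  simp_rw [e1]
  rw [lintegral_lintegral_swap (f := fun x' p => Ψ (x', p)) hΨm.aemeasurable, fullPotential,
    ← lintegral_const_mul' _ _ ENNReal.coe_ne_top]
  have hne : ∀ᵐ p : Space n, p ≠ x := by
    have : Nonempty (Fin n) := ⟨⟨0, by omega⟩⟩
    exact measure_eq_zero_iff_ae_notMem.1 (measure_singleton x)
  refine lintegral_mono_ae ?_
  filter_upwards [hne] with p hp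
  have hρ : 0 < dist p x := dist_pos.2 hp
  have hTm : MeasurableSet (ball x (dist p x / 2))ᶜ := measurableSet_ball.compl
  calc ∫⁻ x', Ψ (x', p) ∂(surfaceMeasure d Γ)
      ≤ ∫⁻ x', (ball x (dist p x / 2))ᶜ.indicator k x' * h p ∂(surfaceMeasure d Γ) := by
        refine lintegral_mono fun x' => ?_
        by_cases hx' : dist p x < 2 * dist x x'
        · have hm : x' ∈ (ball x (dist p x / 2))ᶜ := by
            simp only [mem_compl_iff, mem_ball, not_lt]
            rw [dist_comm x'] ; linarith
          simp only [hΨ]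
          rw [indicator_of_mem hm, indicator_of_mem
            (show (x', p) ∈ {w : Space n × Space n | dist w.2 x < 2 * dist x w.1} from hx')]
        · simp only [hΨ]
          rw [indicator_of_notMem
            (show (x', p) ∉ {w : Space n × Space n | dist w.2 x < 2 * dist x w.1} from hx')]
          exact zero_le
    _ = (∫⁻ x' in (ball x (dist p x / 2))ᶜ, k x' ∂(surfaceMeasure d Γ)) * h p := by
        rw [lintegral_mul_const _ (hkm.indicator hTm), lintegral_indicator hTm]
    _ ≤ C' * ENNReal.ofReal (dist p x / 2) ^ (d - (d + 1 / 2)) * h p := by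
        gcongr
        exact hC' _ x (hC x) _ (by positivity)
    _ = _ := by
        have e2 : ENNReal.ofReal (dist p x / 2) ^ (d - (d + 1 / 2)) =
            ENNReal.ofReal ((2 : ℝ) ^ (1 / 2 : ℝ)) * edist p x ^ (-(1 / 2) : ℝ) := by
          rw [edist_dist, ENNReal.ofReal_rpow_of_pos (by positivity),
            ENNReal.ofReal_rpow_of_pos hρ, ← ENNReal.ofReal_mul (by positivity),
            show d - (d + 1 / 2) = -(1 / 2 : ℝ) by ring, Real.div_rpow hρ.le (by norm_num),
            Real.rpow_neg (by norm_num : (0 : ℝ) ≤ 2)]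
          congr 1
          rw [div_inv_eq_mul, mul_comm]
        have e3 : edist p x ^ (-((n : ℝ) - 1)) =
            edist p x ^ (-(1 / 2) : ℝ) * edist p x ^ (-((n : ℝ) - 3 / 2)) := by
          rw [← ENNReal.rpow_add _ _ (edist_pos.2 hp).ne' (edist_ne_top _ _)]
          congr 1; ring
        rw [e2, e3, hh]
        push_cast
        rw [ENNReal.ofReal]
        ring

/-- Multiplying the pointwise bound by `|x - x'|^(-(d+1))` leaves the exponent `-(d + 1/2)`. The two
potentials contribute equally by symmetry, and each contribution reduces to the integral of the full
potential over `Γ`. -/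
theorem exists_energyH_le (hn : 2 ≤ n) (hΓ : IsAhlforsRegular d Γ) (hd : 0 ≤ d)
    (hdn : d < (n : ℝ) - 1) (C₀ : ℝ≥0) :
    ∃ C : ℝ≥0, ∀ (G : Space n → Space n), Measurable G → ∀ g : Space n → ℝ,
      (∀ᵐ x ∂(surfaceMeasure d Γ), ∀ᵐ x' ∂(surfaceMeasure d Γ), x ≠ x' →
        ‖g x - g x'‖ₑ ^ 2 ≤ C₀ * edist x x' ^ (1 / 2 : ℝ) *
          (gradPotential G x (2 * dist x x') + gradPotential G x' (2 * dist x x'))) →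
      energyH d Γ g ≤ C * energyW d Γ G := by
  have := hΓ.isLocallyFiniteMeasure hd
  obtain ⟨C₁, hC₁⟩ := exists_lintegral_gradPotential_le hn hΓ hd
  obtain ⟨C₂, hC₂⟩ := exists_lintegral_fullPotential_le hΓ hd hdn
  refine ⟨C₀ * (2 * (C₁ * C₂)), fun G hG g hg => ?_⟩
  set σ := surfaceMeasure d Γ with hσ
  set Φ : Space n → Space n → ℝ≥0∞ := fun x x' =>
    edist x x' ^ (-(d + 1 / 2)) * gradPotential G x (2 * dist x x') with hΦ
  have hΦm : Measurable (Function.uncurry Φ) :=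
    ((by fun_prop : Measurable fun z : Space n × Space n => edist z.1 z.2).pow_const _).mul
      (measurable_gradPotential hG)
  have hΦm' : Measurable (Function.uncurry fun x x' => Φ x' x) := by
    have : (Function.uncurry fun x x' => Φ x' x) = Function.uncurry Φ ∘ Prod.swap := rfl
    rw [this]
    exact hΦm.comp measurable_swap
  have hI : ∫⁻ x, ∫⁻ x', Φ x x' ∂σ ∂σ ≤ C₁ * C₂ * energyW d Γ G := by
    calc _ ≤ ∫⁻ x, C₁ * fullPotential G x ∂σ := lintegral_mono fun x => hC₁ G hG x
      _ ≤ _ := by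
        rw [lintegral_const_mul' _ _ (by simp), mul_assoc]
        exact mul_le_mul_right (hC₂ G hG) _
  calc energyH d Γ g
      ≤ ∫⁻ x, ∫⁻ x', C₀ * (Φ x x' + Φ x' x) ∂σ ∂σ := by
        refine lintegral_mono_ae ?_
        filter_upwards [hg] with x hx
        refine lintegral_mono_ae ?_
        filter_upwards [hx] with x' hx'
        rcases eq_or_ne x x' with h | h
        · simp [h]
        · have h0 : edist x x' ≠ 0 := (edist_pos.2 h).ne'
          refine (mul_le_mul_left (hx' h) _).trans (le_of_eq ?_)
          have e : edist x x' ^ (-(d + 1 / 2)) =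
              edist x x' ^ (1 / 2 : ℝ) * edist x x' ^ (-(d + 1)) := by
            rw [← ENNReal.rpow_add _ _ h0 (edist_ne_top _ _)]
            congr 1; ring
          simp only [hΦ]
          rw [edist_comm x', dist_comm x', e]
          ring
    _ = C₀ * (∫⁻ x, ∫⁻ x', Φ x x' ∂σ ∂σ + ∫⁻ x, ∫⁻ x', Φ x' x ∂σ ∂σ) := by
        rw [← lintegral_add_left hΦm.lintegral_prod_right, ← lintegral_const_mul' _ _ (by simp)]
        refine lintegral_congr fun x => ?_
        rw [lintegral_const_mul' _ _ (by simp), lintegral_add_left (hΦm.of_uncurry_left)]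
    _ = C₀ * (2 * ∫⁻ x, ∫⁻ x', Φ x x' ∂σ ∂σ) := by
        rw [lintegral_lintegral_swap hΦm'.aemeasurable, two_mul]
    _ ≤ C₀ * (2 * (C₁ * C₂ * energyW d Γ G)) := by gcongr
    _ = _ := by push_cast; ring

/-- The trace theorem. -/
theorem exists_trace (hΓ : IsAhlforsRegular d Γ) (hd : 0 ≤ d) (hdn : d < (n : ℝ) - 1) :
    ∃ C : ℝ, ∀ u : spaceW d Γ, ∃ g : spaceH d Γ,
      (∀ᵐ x ∂(surfaceMeasure d Γ), (∀ r > 0, IntegrableOn (u.1 : Space n → ℝ) (ball x r)) ∧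
        Tendsto (fun r : ℝ => ⨍ y in ball x r, u.1 y) (𝓝[>] 0) (𝓝 (g.1 x)) ∧
        IsLebesgueValue u.1 x (g.1 x)) ∧
      normH d Γ g.1 ≤ C * normW d Γ u.1 := by
  have hn : 2 ≤ n := by
    have : (1 : ℝ) < n := by linarith
    exact_mod_cast this
  obtain ⟨C₀, hC₀⟩ := exists_sq_trace_sub_trace_le hn
  obtain ⟨C, hC⟩ := exists_energyH_le hn hΓ hd hdn C₀
  obtain ⟨C₂, hC₂⟩ := exists_lintegral_fullPotential_le hΓ hd hdn
  obtain ⟨K, -, hK⟩ := exists_tendsto_average hn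
  refine ⟨√C, fun u => ?_⟩
  obtain ⟨G, hG, hw, hfin, hP⟩ := exists_measurable_gradient hΓ hd hdn u
  have hum : Measurable (u.1 : Space n → ℝ) := u.1.measurable
  have hgood : ∀ᵐ x ∂(surfaceMeasure d Γ), ∀ r, gradPotential G x r ≠ ⊤ := by
    have h1 : ∫⁻ x, fullPotential G x ∂(surfaceMeasure d Γ) ≠ ⊤ :=
      ((hC₂ G hG).trans_lt (ENNReal.mul_lt_top (by simp) hfin.lt_top)).ne
    filter_upwards [ae_lt_top (measurable_fullPotential hG) h1] with x hx
    exact gradPotential_ne_top hn hx.ne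
  set f : Space n → ℝ := fun x => limUnder (𝓝[>] (0 : ℝ)) fun r => ⨍ y in ball x r, u.1 y with hf
  have hlim : ∀ x, (∀ r, gradPotential G x r ≠ ⊤) →
      Tendsto (fun r : ℝ => ⨍ y in ball x r, u.1 y) (𝓝[>] 0) (𝓝 (f x)) ∧
        IsLebesgueValue u.1 x (f x) := by
    intro x hx
    obtain ⟨a, ha, ha', -⟩ := hK u.1 G hum hG hP x hx
    have : f x = a := ha.limUnder_eq
    rw [this]
    exact ⟨ha, ha'⟩
  -- The averages at the radii `1 / (k + 1)` are measurable in the centre and converge almost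
  -- everywhere to `f`.
  have hfm : AEStronglyMeasurable f (surfaceMeasure d Γ) := by
    refine aestronglyMeasurable_of_tendsto_ae atTop
      (f := fun (k : ℕ) x => ⨍ y in ball x (1 / ((k : ℝ) + 1)), u.1 y)
      (fun k => (measurable_average_ball hum _).aestronglyMeasurable) ?_
    filter_upwards [hgood] with x hx
    refine (hlim x hx).1.comp ?_
    refine tendsto_nhdsWithin_iff.2 ⟨tendsto_one_div_add_atTop_nhds_zero_nat, ?_⟩
    exact Eventually.of_forall fun k => by
      have : (0 : ℝ) < 1 / ((k : ℝ) + 1) := by positivity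
      exact this
  set g : Space n →ₘ[surfaceMeasure d Γ] ℝ := AEEqFun.mk f hfm with hg
  have hgf : g =ᵐ[surfaceMeasure d Γ] f := AEEqFun.coeFn_mk f hfm
  have hen : energyH d Γ g ≤ C * energyW d Γ G := by
    refine hC G hG g ?_
    filter_upwards [hgood, hgf] with x hx hgx
    filter_upwards [hgood, hgf] with x' hx' hgx' hne
    rw [hgx, hgx']
    exact hC₀ u.1 G hum hG hP x x' _ _ hx hx' (hlim x hx).1 (hlim x' hx').1 hne
  have hentop : energyH d Γ g ≠ ⊤ :=
    (hen.trans_lt (ENNReal.mul_lt_top (by simp) hfin.lt_top)).ne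
  refine ⟨⟨g, (integrable_slobodeckij_iff hΓ hd g.measurable).2 hentop⟩, ?_, ?_⟩
  · filter_upwards [hgood, hgf] with x hx hgx
    rw [hgx]
    exact ⟨fun r hr => integrableOn_ball_of_gradPotential hn hum hG hP hr (hx r), hlim x hx⟩
  · rw [normH_eq hΓ hd g.measurable, normW_eq hΓ.isClosed hw, ← Real.sqrt_mul (by positivity)]
    refine Real.sqrt_le_sqrt ?_
    have := ENNReal.toReal_mono (ENNReal.mul_ne_top (by simp) hfin) hen
    simpa using this

end Trace

/-! ### The kernel, its derivative, and integrability against it -/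

section Kernel

variable {n : ℕ} {d : ℝ} {Γ : Set (Space n)}

/-- The kernel `|x - y|^{-2n}`. -/
def kernel (x y : Space n) : ℝ := ((‖x - y‖ ^ 2) ^ n)⁻¹

/-- The derivative of `kernel` in the first variable. -/
def kernelDeriv (x y : Space n) : Space n →L[ℝ] ℝ :=
  (-(n * (‖x - y‖ ^ 2) ^ (n - 1)) / ((‖x - y‖ ^ 2) ^ n) ^ 2) • ((2 : ℝ) • innerSL ℝ (x - y))

theorem kernel_nonneg (x y : Space n) : 0 ≤ kernel x y := by
  unfold kernel; positivity

theorem hasFDerivAt_kernel {x y : Space n} (h : x ≠ y) :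
    HasFDerivAt (fun z => kernel z y) (kernelDeriv x y) x := by
  have hs : 0 < ‖x - y‖ ^ 2 := by
    have := norm_pos_iff.2 (sub_ne_zero.2 h)
    positivity
  have h1 : HasFDerivAt (fun z : Space n => ‖z - y‖ ^ 2) ((2 : ℝ) • innerSL ℝ (x - y)) x := by
    rw [ofNat_smul_eq_nsmul]
    simpa using ((hasFDerivAt_id x).sub_const y).norm_sq
  have h2 : HasDerivAt (fun s : ℝ => (s ^ n)⁻¹)
      (-(n * (‖x - y‖ ^ 2) ^ (n - 1)) / ((‖x - y‖ ^ 2) ^ n) ^ 2) (‖x - y‖ ^ 2) :=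
    (hasDerivAt_pow n _).fun_inv (by positivity)
  exact HasDerivAt.comp_hasFDerivAt (h₂ := fun s : ℝ => (s ^ n)⁻¹) x h2 h1

/-- The kernel is a power of degree `-2n` of the distance, so its derivative has norm `2n / |x - y|`
times the kernel. -/
theorem norm_kernelDeriv_le (hn : 1 ≤ n) (x y : Space n) {ε : ℝ} (hε : 0 < ε) (h : ε ≤ ‖x - y‖) :
    ‖kernelDeriv x y‖ ≤ 2 * n / ε * kernel x y := by
  have hs : 0 < ‖x - y‖ := hε.trans_le h
  obtain ⟨m, rfl⟩ : ∃ m, n = m + 1 := ⟨n - 1, by omega⟩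
  rw [kernelDeriv, kernel, norm_smul, norm_smul, innerSL_apply_norm, norm_div, norm_neg]
  simp only [Nat.add_sub_cancel, norm_mul, norm_pow, norm_norm,
    Real.norm_ofNat, Real.norm_natCast]
  generalize ‖x - y‖ = s at *
  have e : ((m + 1 : ℕ) : ℝ) * (s ^ 2) ^ m / ((s ^ 2) ^ (m + 1)) ^ 2 * (2 * s) =
      2 * ((m + 1 : ℕ) : ℝ) / s * ((s ^ 2) ^ (m + 1))⁻¹ := by
    rw [pow_succ (s ^ 2) m]
    field_simp
  rw [e]
  gcongr

theorem measurable_kernel (x : Space n) : Measurable (kernel x) := by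
  unfold kernel; fun_prop

theorem measurable_kernelDeriv (x : Space n) : Measurable (kernelDeriv x) := by
  unfold kernelDeriv
  have h1 : Measurable fun y : Space n =>
      -(n * (‖x - y‖ ^ 2) ^ (n - 1)) / ((‖x - y‖ ^ 2) ^ n) ^ 2 := by fun_prop
  have h2 : Measurable fun y : Space n => (2 : ℝ) • innerSL ℝ (x - y) := by
    have : Continuous fun y : Space n => (2 : ℝ) • innerSL ℝ (x - y) := by fun_prop
    exact this.measurable
  exact h1.smul h2

theorem enorm_kernel {x y : Space n} (h : x ≠ y) :
    ‖kernel x y‖ₑ = edist x y ^ (-(2 * n : ℝ)) := by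
  have hs : 0 < dist x y := dist_pos.2 h
  rw [Real.enorm_of_nonneg (kernel_nonneg _ _), edist_dist, ENNReal.ofReal_rpow_of_pos hs, kernel,
    Real.rpow_neg hs.le, ← dist_eq_norm, ← pow_mul, ← Real.rpow_natCast]
  push_cast
  rfl

/-- Functions on `Γ` that can be integrated against the kernel. -/
def Tempered (d : ℝ) (Γ : Set (Space n)) (g : Space n → ℝ) : Prop :=
  Integrable (fun y => g y * ((1 + ‖y‖) ^ (2 * n))⁻¹) (surfaceMeasure d Γ)

theorem Tempered.aestronglyMeasurable {g : Space n → ℝ} (h : Tempered d Γ g) :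
    AEStronglyMeasurable g (surfaceMeasure d Γ) := by
  have hm : AEStronglyMeasurable (fun y : Space n => (1 + ‖y‖) ^ (2 * n)) (surfaceMeasure d Γ) := by
    fun_prop
  refine (h.1.mul hm).congr (Eventually.of_forall fun y => ?_)
  have : (1 + ‖y‖) ^ (2 * n) ≠ 0 := by positivity
  simp only [Pi.mul_apply]
  field_simp

theorem Tempered.add {g g' : Space n → ℝ} (h : Tempered d Γ g) (h' : Tempered d Γ g') :
    Tempered d Γ (g + g') :=
  (Integrable.add h h').congr (Eventually.of_forall fun y => by simp [add_mul])

theorem Tempered.smul {g : Space n → ℝ} (h : Tempered d Γ g) (c : ℝ) :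
    Tempered d Γ (c • g) :=
  (Integrable.const_mul h c).congr (Eventually.of_forall fun y => by simp [mul_assoc])

/-- Near the origin `σ` is finite; far away the decay `2n` exceeds the growth exponent `d`. -/
theorem IsAhlforsRegular.tempered_one (hΓ : IsAhlforsRegular d Γ) (hd : 0 ≤ d)
    (hdn : d < (n : ℝ) - 1) : Tempered d Γ 1 := by
  have := hΓ.isLocallyFiniteMeasure hd
  obtain ⟨C, hC⟩ := hΓ.exists_measure_ball_le hd
  obtain ⟨C', hC'⟩ := exists_lintegral_compl_ball_le (X := Space n) C hd
    (show d < 2 * (n : ℝ) by linarith)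
  refine ⟨by fun_prop, ?_⟩
  have hle : ∀ y : Space n, ‖(1 : Space n → ℝ) y * ((1 + ‖y‖) ^ (2 * n))⁻¹‖ₑ =
      ENNReal.ofReal (((1 + ‖y‖) ^ (2 * n))⁻¹) := fun y => by
    rw [Pi.one_apply, one_mul, Real.enorm_of_nonneg (by positivity)]
  rw [HasFiniteIntegral]
  simp_rw [hle]
  rw [← lintegral_add_compl _ (measurableSet_ball (x := (0 : Space n)) (ε := 1))]
  refine ENNReal.add_lt_top.2 ⟨?_, ?_⟩
  · refine (setLIntegral_mono (g := fun _ => 1) measurable_const fun y _ => ?_).trans_lt ?_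
    · rw [← ENNReal.ofReal_one]
      refine ENNReal.ofReal_le_ofReal (inv_le_one_of_one_le₀ (one_le_pow₀ ?_))
      linarith [norm_nonneg y]
    · rw [setLIntegral_const, one_mul]; exact measure_ball_lt_top
  · refine lt_of_le_of_lt ?_ ((hC' (surfaceMeasure d Γ) 0 (hC 0) 1 one_pos).trans_lt
      (by simp))
    refine setLIntegral_mono' measurableSet_ball.compl fun y hy => ?_
    have h1 : 1 ≤ dist y 0 := by simpa using hy
    have h0 : 0 < dist y 0 := by linarith
    rw [edist_dist, ENNReal.ofReal_rpow_of_pos h0]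
    refine ENNReal.ofReal_le_ofReal ?_
    rw [Real.rpow_neg h0.le, dist_zero_right] at *
    refine inv_anti₀ (by positivity) ?_
    have : (2 * (n : ℝ)) = ((2 * n : ℕ) : ℝ) := by push_cast; rfl
    rw [this, Real.rpow_natCast]
    gcongr
    linarith

theorem IsAhlforsRegular.measure_ne_zero (hΓ : IsAhlforsRegular d Γ) : surfaceMeasure d Γ ≠ 0 := by
  obtain ⟨C, hC⟩ := hΓ.exists_le_measure_ball
  obtain ⟨x, hx⟩ := hΓ.nonempty
  intro h
  have := hC x hx 1 one_pos
  simp [h] at this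

/-- Fix one `x` at which the inner integral of the energy is finite; such a point exists since `σ ≠
0`. Then `|g y| ≤ |g x| + 1 + |g x - g y|²`. The last term is handled by `|x - y|^(d+1) ≤ ((1 +
|x|)(1 + |y|))^(2n)`, valid since `d + 1 ≤ 2n`. -/
theorem tempered_of_mem_spaceH (hΓ : IsAhlforsRegular d Γ) (hd : 0 ≤ d)
    (hdn : d < (n : ℝ) - 1) (g : spaceH d Γ) : Tempered d Γ g.1 := by
  have := hΓ.isLocallyFiniteMeasure hd
  have h1 := hΓ.tempered_one hd hdn
  have hae := Integrable.prod_right_ae (μ := surfaceMeasure d Γ) (ν := surfaceMeasure d Γ) g.2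
  have : (ae (surfaceMeasure d Γ)).NeBot := ae_neBot.2 hΓ.measure_ne_zero
  obtain ⟨x, hx⟩ := hae.exists
  set A : ℝ := 1 + ‖x‖ with hA
  have hA1 : 1 ≤ A := by simp [hA]
  refine Integrable.mono' ((Integrable.const_mul h1 (|g.1 x| + 1)).add
    (Integrable.const_mul hx (A ^ (2 * n)))) ?_ (Eventually.of_forall fun y => ?_)
  · exact g.1.aestronglyMeasurable.mul (by fun_prop)
  · simp only [Pi.add_apply, Pi.one_apply, one_mul]
    set B : ℝ := 1 + ‖y‖ with hB
    have hB1 : 1 ≤ B := by simp [hB]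
    rw [norm_mul, Real.norm_of_nonneg (show 0 ≤ (B ^ (2 * n))⁻¹ by positivity), Real.norm_eq_abs]
    have e1 : |g.1 y| ≤ |g.1 x| + 1 + |g.1 x - g.1 y| ^ 2 := by
      have := abs_sub_abs_le_abs_sub (g.1 y) (g.1 x)
      rw [abs_sub_comm] at this
      nlinarith [sq_nonneg (|g.1 x - g.1 y| - 1), abs_nonneg (g.1 x - g.1 y)]
    have e2 : |g.1 x - g.1 y| ^ 2 * (B ^ (2 * n))⁻¹ ≤ A ^ (2 * n) * slobodeckij d g.1 (x, y) := by
      rw [slobodeckij]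
      rcases eq_or_ne x y with h | h
      · simp [h]
      have hr : 0 < dist x y := dist_pos.2 h
      have e3 : dist x y ≤ A * B := by
        rw [dist_eq_norm]
        have := norm_sub_le x y
        nlinarith [norm_nonneg x, norm_nonneg y]
      have e4 : dist x y ^ (d + 1) ≤ A ^ (2 * n) * B ^ (2 * n) := by
        rw [← mul_pow, ← Real.rpow_natCast]
        refine (Real.rpow_le_rpow hr.le e3 (by linarith)).trans
          (Real.rpow_le_rpow_of_exponent_le (one_le_mul_of_one_le_of_one_le hA1 hB1) ?_)
        push_cast
        linarith
      rw [← div_eq_mul_inv, ← mul_div_assoc, div_le_div_iff₀ (by positivity) (by positivity)]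
      calc _ ≤ |g.1 x - g.1 y| ^ 2 * (A ^ (2 * n) * B ^ (2 * n)) := by gcongr
        _ = _ := by ring
    calc |g.1 y| * (B ^ (2 * n))⁻¹
        ≤ (|g.1 x| + 1 + |g.1 x - g.1 y| ^ 2) * (B ^ (2 * n))⁻¹ := by gcongr
      _ = (|g.1 x| + 1) * (B ^ (2 * n))⁻¹ + |g.1 x - g.1 y| ^ 2 * (B ^ (2 * n))⁻¹ := by ring
      _ ≤ _ := by gcongr

/-- Uniform domination of the kernel near a point outside `Γ`. -/
theorem exists_kernel_le (hn : 1 ≤ n) {x : Space n} {ε : ℝ} (hε : 0 < ε)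
    (hx : ∀ y ∈ Γ, 2 * ε ≤ dist x y) :
    ∃ C : ℝ, 0 ≤ C ∧ ∀ z ∈ ball x ε, ∀ y ∈ Γ, kernel z y ≤ C * ((1 + ‖y‖) ^ (2 * n))⁻¹ ∧
      ‖kernelDeriv z y‖ ≤ C * ((1 + ‖y‖) ^ (2 * n))⁻¹ := by
  -- Chosen so that `1 + ‖y‖ ≤ A * ‖z - y‖` when `z` is within `ε` of `x` and at distance at least
  -- `ε` from `y`.
  set A := (1 + ‖x‖ + ε) / ε + 1 with hA
  have hA0 : 0 < A := by positivity
  set c := max 1 (2 * n / ε) with hc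
  refine ⟨c * A ^ (2 * n), by positivity, fun z hz y hy => ?_⟩
  have h1 : ε ≤ ‖z - y‖ := by
    rw [← dist_eq_norm]
    have := hx y hy
    have h2 : dist z x < ε := hz
    linarith [dist_triangle_left x y z]
  have h2 : 1 + ‖y‖ ≤ A * ‖z - y‖ := by
    have h3 : ‖y‖ ≤ ‖z‖ + ‖z - y‖ := by
      have := norm_sub_le z (z - y)
      simpa using this
    have h4 : ‖z‖ ≤ ‖x‖ + ε := by
      have h5 : ‖z - x‖ < ε := by rw [← dist_eq_norm]; exact hz
      have := norm_sub_norm_le z x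
      linarith
    have h6 : 1 + ‖x‖ + ε ≤ (1 + ‖x‖ + ε) / ε * ‖z - y‖ := by
      rw [div_mul_eq_mul_div, le_div_iff₀ hε]
      gcongr
    rw [hA, add_mul]
    linarith
  have h3 : kernel z y ≤ A ^ (2 * n) * ((1 + ‖y‖) ^ (2 * n))⁻¹ := by
    rw [kernel, ← pow_mul, ← div_eq_mul_inv, inv_eq_one_div,
      div_le_div_iff₀ (pow_pos (hε.trans_le h1) _) (by positivity), one_mul, ← mul_pow]
    gcongr
  have hpos : 0 ≤ A ^ (2 * n) * ((1 + ‖y‖) ^ (2 * n))⁻¹ := by positivity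
  rw [mul_assoc]
  constructor
  · exact h3.trans (le_mul_of_one_le_left hpos (le_max_left _ _))
  · refine (norm_kernelDeriv_le hn z y hε h1).trans ?_
    exact mul_le_mul (le_max_right _ _) h3 (kernel_nonneg _ _) (by positivity)

/-- Integration against the kernel. -/
def kernelInt (d : ℝ) (Γ : Set (Space n)) (g : Space n → ℝ) (x : Space n) : ℝ :=
  ∫ y, g y * kernel x y ∂(surfaceMeasure d Γ)

/-- Differentiation under the integral sign: on the ball of half the distance to `Γ` the kernel and
its derivative have a common bound integrable against `g`. -/
theorem Tempered.hasFDerivAt_kernelInt (hΓ : IsAhlforsRegular d Γ) (hn : 1 ≤ n) {g : Space n → ℝ}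
    (hg : Tempered d Γ g) {x : Space n} (hx : x ∉ Γ) :
    Integrable (fun y => g y * kernel x y) (surfaceMeasure d Γ) ∧
    HasFDerivAt (kernelInt d Γ g) (∫ y, g y • kernelDeriv x y ∂(surfaceMeasure d Γ)) x := by
  have hδ := infDist_pos_of_notMem hΓ hx
  obtain ⟨C, hC0, hC⟩ := exists_kernel_le (Γ := Γ) hn (half_pos hδ)
    (x := x) (fun y hy => by linarith [infDist_le_dist_of_mem (x := x) hy])
  have hxb : x ∈ ball x (infDist x Γ / 2) := mem_ball_self (half_pos hδ)
  have hgm := hg.aestronglyMeasurable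
  have hi : Integrable (fun y => g y * kernel x y) (surfaceMeasure d Γ) := by
    refine Integrable.mono' (hg.norm.const_mul C)
      (hgm.mul (measurable_kernel x).aestronglyMeasurable) ?_
    filter_upwards [hΓ.ae_mem] with y hy
    rw [norm_mul, norm_mul, Real.norm_of_nonneg (kernel_nonneg _ _),
      Real.norm_of_nonneg (show 0 ≤ ((1 + ‖y‖) ^ (2 * n))⁻¹ by positivity), mul_left_comm]
    exact mul_le_mul_of_nonneg_left (hC x hxb y hy).1 (norm_nonneg _)
  refine ⟨hi, ?_⟩
  refine hasFDerivAt_integral_of_dominated_of_fderiv_le (F' := fun z y => g y • kernelDeriv z y)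
    (bound := fun y => C * ‖g y * ((1 + ‖y‖) ^ (2 * n))⁻¹‖)
    (ball_mem_nhds x (half_pos hδ)) (Eventually.of_forall fun z => ?_) hi ?_ ?_
    (hg.norm.const_mul C) ?_
  · exact hgm.mul (measurable_kernel z).aestronglyMeasurable
  · exact hgm.smul (measurable_kernelDeriv x).aestronglyMeasurable
  · filter_upwards [hΓ.ae_mem] with y hy z hz
    rw [norm_smul, norm_mul,
      Real.norm_of_nonneg (show 0 ≤ ((1 + ‖y‖) ^ (2 * n))⁻¹ by positivity), mul_left_comm]
    exact mul_le_mul_of_nonneg_left (hC z hz y hy).2 (norm_nonneg _)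
  · filter_upwards [hΓ.ae_mem] with y hy z hz
    have hne : z ≠ y := by
      rintro rfl
      have h1 := infDist_le_dist_of_mem (x := x) hy
      rw [mem_ball, dist_comm] at hz
      linarith
    exact (hasFDerivAt_kernel hne).const_mul (g y)

end Kernel

/-! ### The extension by normalized kernel averages -/

section Extension

variable {n : ℕ} {d : ℝ} {Γ : Set (Space n)}

/-- The kernel `|x - y|^{-2n}` as an extended nonnegative number. -/
def ekernel (x y : Space n) : ℝ≥0∞ := edist x y ^ (-(2 * n : ℝ))

theorem measurable_ekernel : Measurable fun z : Space n × Space n => ekernel z.1 z.2 :=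
  (by fun_prop : Measurable fun z : Space n × Space n => edist z.1 z.2).pow_const _

theorem measurable_ekernel_right (x : Space n) : Measurable (ekernel x) :=
  (by fun_prop : Measurable fun y : Space n => edist x y).pow_const _

/-- The total mass of the kernel. -/
def kernelMass (d : ℝ) (Γ : Set (Space n)) (x : Space n) : ℝ≥0∞ :=
  ∫⁻ y, ekernel x y ∂(surfaceMeasure d Γ)

theorem lintegral_enorm_mul_kernel (hΓ : IsAhlforsRegular d Γ) (g : Space n → ℝ) {x : Space n}
    (hx : x ∉ Γ) : ∫⁻ y, ‖g y * kernel x y‖ₑ ∂(surfaceMeasure d Γ) =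
      ∫⁻ y, ‖g y‖ₑ * ekernel x y ∂(surfaceMeasure d Γ) := by
  refine lintegral_congr_ae ?_
  filter_upwards [hΓ.ae_mem] with y hy
  have hne : x ≠ y := by
    rintro rfl
    exact hx hy
  rw [enorm_mul, enorm_kernel hne, ekernel]

theorem ofReal_integral_norm_mul_kernel (hΓ : IsAhlforsRegular d Γ) (hn : 1 ≤ n) {g : Space n → ℝ}
    (hg : Tempered d Γ g) {x : Space n} (hx : x ∉ Γ) :
    ENNReal.ofReal (∫ y, ‖g y * kernel x y‖ ∂(surfaceMeasure d Γ)) =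
      ∫⁻ y, ‖g y‖ₑ * ekernel x y ∂(surfaceMeasure d Γ) := by
  rw [← lintegral_enorm_mul_kernel hΓ g hx,
    ofReal_integral_norm_eq_lintegral_enorm (hg.hasFDerivAt_kernelInt hΓ hn hx).1]

theorem ofReal_kernelInt_one (hΓ : IsAhlforsRegular d Γ) (hd : 0 ≤ d) (hdn : d < (n : ℝ) - 1)
    (hn : 1 ≤ n) {x : Space n} (hx : x ∉ Γ) :
    ENNReal.ofReal (kernelInt d Γ 1 x) = kernelMass d Γ x := by
  have h := ofReal_integral_norm_mul_kernel hΓ hn (hΓ.tempered_one hd hdn) hx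
  simpa [kernelMass, kernelInt, abs_of_nonneg (kernel_nonneg _ _)] using h

/-- Let `δ` be the distance to `Γ`. The `δ`-ball about a nearest point of `Γ` has mass at least a
multiple of `δ ^ d`, and all its points are within `2δ` of `x`. -/
theorem exists_le_kernelMass (hΓ : IsAhlforsRegular d Γ) :
    ∃ C : ℝ≥0, ∀ x ∉ Γ,
      ENNReal.ofReal (infDist x Γ) ^ (d - 2 * n) ≤ C * kernelMass d Γ x := by
  obtain ⟨C, hC⟩ := hΓ.exists_le_measure_ball
  refine ⟨C * 2 ^ (2 * n), fun x hx => ?_⟩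
  obtain ⟨x₀, hx₀, hx₀d⟩ := hΓ.isClosed.exists_infDist_eq_dist hΓ.nonempty x
  have hδ := infDist_pos_of_notMem hΓ hx
  set δ := infDist x Γ with hδdef
  have h1 : ENNReal.ofReal (2 * δ) ^ (-(2 * n : ℝ)) * surfaceMeasure d Γ (ball x₀ δ) ≤
      kernelMass d Γ x := by
    rw [← setLIntegral_const, kernelMass]
    refine (setLIntegral_mono' measurableSet_ball fun y hy => ?_).trans
      (setLIntegral_le_lintegral _ _)
    rw [ekernel, ENNReal.rpow_neg, ENNReal.rpow_neg]
    refine ENNReal.inv_le_inv.2 (ENNReal.rpow_le_rpow ?_ (by positivity))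
    rw [edist_dist]
    refine ENNReal.ofReal_le_ofReal ?_
    have : dist y x₀ < δ := hy
    have := dist_triangle_right x y x₀
    linarith
  have h2 : ENNReal.ofReal δ ^ (d - 2 * n) = ENNReal.ofReal δ ^ d *
      (ENNReal.ofReal (2 ^ (2 * n)) * ENNReal.ofReal (2 * δ) ^ (-(2 * n : ℝ))) := by
    rw [ENNReal.ofReal_rpow_of_pos hδ, ENNReal.ofReal_rpow_of_pos hδ,
      ENNReal.ofReal_rpow_of_pos (by positivity), ← ENNReal.ofReal_mul (by positivity),
      ← ENNReal.ofReal_mul (by positivity), Real.mul_rpow (by norm_num) hδ.le]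
    congr 1
    have e : (2 : ℝ) ^ (2 * n) * 2 ^ (-(2 * n : ℝ)) = 1 := by
      rw [← Real.rpow_natCast, ← Real.rpow_add (by norm_num)]
      push_cast
      simp
    rw [← mul_assoc (2 ^ (2 * n)), e, one_mul, ← Real.rpow_add hδ]
    rfl
  rw [h2]
  calc _ ≤ C * surfaceMeasure d Γ (ball x₀ δ) *
        (ENNReal.ofReal (2 ^ (2 * n)) * ENNReal.ofReal (2 * δ) ^ (-(2 * n : ℝ))) := by
        gcongr
        exact hC x₀ hx₀ δ hδ
    _ = C * ENNReal.ofReal (2 ^ (2 * n)) * (ENNReal.ofReal (2 * δ) ^ (-(2 * n : ℝ)) *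
        surfaceMeasure d Γ (ball x₀ δ)) := by ring
    _ ≤ C * ENNReal.ofReal (2 ^ (2 * n)) * kernelMass d Γ x := by gcongr
    _ = _ := by
        push_cast
        rw [ENNReal.ofReal_pow (by norm_num)]
        simp

theorem kernelMass_ne_zero (hΓ : IsAhlforsRegular d Γ) {x : Space n} (hx : x ∉ Γ) :
    kernelMass d Γ x ≠ 0 := by
  obtain ⟨C, hC⟩ := exists_le_kernelMass hΓ
  intro h
  have h1 := hC x hx
  rw [h, mul_zero, ENNReal.ofReal_rpow_of_pos (infDist_pos_of_notMem hΓ hx)] at h1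
  have := Real.rpow_pos_of_pos (infDist_pos_of_notMem hΓ hx) (d - 2 * n)
  simp only [nonpos_iff_eq_zero, ENNReal.ofReal_eq_zero] at h1
  linarith

theorem kernelMass_ne_top (hΓ : IsAhlforsRegular d Γ) (hd : 0 ≤ d) (hdn : d < (n : ℝ) - 1)
    (hn : 1 ≤ n) {x : Space n} (hx : x ∉ Γ) : kernelMass d Γ x ≠ ⊤ := by
  rw [← ofReal_kernelInt_one hΓ hd hdn hn hx]
  exact ENNReal.ofReal_ne_top

theorem kernelInt_one_pos (hΓ : IsAhlforsRegular d Γ) (hd : 0 ≤ d) (hdn : d < (n : ℝ) - 1)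
    (hn : 1 ≤ n) {x : Space n} (hx : x ∉ Γ) : 0 < kernelInt d Γ 1 x := by
  have h := kernelMass_ne_zero hΓ hx
  rw [← ofReal_kernelInt_one hΓ hd hdn hn hx] at h
  simpa using h

/-- The extension of `g`: its average against the normalized kernel. -/
def extend (d : ℝ) (Γ : Set (Space n)) (g : Space n → ℝ) (x : Space n) : ℝ :=
  kernelInt d Γ g x / kernelInt d Γ 1 x

/-- Normalized averages reproduce constants, so `g` may be replaced by `g - c`. The freedom in `c`
is what later creates differences of `g`. -/
theorem extend_eq (hΓ : IsAhlforsRegular d Γ) (hd : 0 ≤ d) (hdn : d < (n : ℝ) - 1) (hn : 1 ≤ n)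
    {g : Space n → ℝ} (hg : Tempered d Γ g) (c : ℝ) {x : Space n} (hx : x ∉ Γ) :
    extend d Γ g x = kernelInt d Γ (g + (-c) • 1) x / kernelInt d Γ 1 x + c := by
  have h1 := (hΓ.tempered_one hd hdn).hasFDerivAt_kernelInt hΓ hn hx
  have h2 := hg.hasFDerivAt_kernelInt hΓ hn hx
  have e : kernelInt d Γ (g + (-c) • 1) x = kernelInt d Γ g x - c * kernelInt d Γ 1 x := by
    simp only [kernelInt]
    rw [← integral_const_mul, ← integral_sub h2.1 (h1.1.const_mul c)]
    congr 1
    ext y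
    simp only [Pi.add_apply, Pi.smul_apply, Pi.one_apply, smul_eq_mul]
    ring
  have := (kernelInt_one_pos hΓ hd hdn hn hx).ne'
  rw [e, extend]
  field_simp
  ring

theorem norm_kernelInt_le (g : Space n → ℝ) (x : Space n) :
    ‖kernelInt d Γ g x‖ ≤ ∫ y, ‖g y * kernel x y‖ ∂(surfaceMeasure d Γ) :=
  norm_integral_le_integral_norm _

theorem norm_integral_kernelDeriv_le (hΓ : IsAhlforsRegular d Γ) (hn : 1 ≤ n) {g : Space n → ℝ}
    (hg : Tempered d Γ g) {x : Space n} (hx : x ∉ Γ) :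
    ‖∫ y, g y • kernelDeriv x y ∂(surfaceMeasure d Γ)‖ ≤
      2 * n / infDist x Γ * ∫ y, ‖g y * kernel x y‖ ∂(surfaceMeasure d Γ) := by
  rw [← integral_const_mul]
  refine norm_integral_le_of_norm_le
    ((hg.hasFDerivAt_kernelInt hΓ hn hx).1.norm.const_mul _) ?_
  filter_upwards [hΓ.ae_mem] with y hy
  rw [norm_smul, norm_mul, mul_left_comm, Real.norm_of_nonneg (kernel_nonneg _ _)]
  refine mul_le_mul_of_nonneg_left (norm_kernelDeriv_le hn x y (infDist_pos_of_notMem hΓ hx) ?_)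
    (norm_nonneg _)
  rw [← dist_eq_norm]
  exact infDist_le_dist_of_mem hy

theorem enorm_extend_sub_mul_le (hΓ : IsAhlforsRegular d Γ) (hd : 0 ≤ d)
    (hdn : d < (n : ℝ) - 1) (hn : 1 ≤ n) {g : Space n → ℝ} (hg : Tempered d Γ g) (c : ℝ)
    {x : Space n} (hx : x ∉ Γ) :
    ‖extend d Γ g x - c‖ₑ * kernelMass d Γ x ≤
      ∫⁻ y, ‖g y - c‖ₑ * ekernel x y ∂(surfaceMeasure d Γ) := by
  have hZ := kernelInt_one_pos hΓ hd hdn hn hx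
  have hgc : Tempered d Γ (g + (-c) • 1) := hg.add ((hΓ.tempered_one hd hdn).smul _)
  have h := norm_kernelInt_le (d := d) (Γ := Γ) (g + (-c) • 1) x
  rw [extend_eq hΓ hd hdn hn hg c hx, add_sub_cancel_right, ← ofReal_kernelInt_one hΓ hd hdn hn hx,
    ← ofReal_norm, ← ENNReal.ofReal_mul (norm_nonneg _), norm_div,
    Real.norm_of_nonneg hZ.le, div_mul_cancel₀ _ hZ.ne']
  refine (ENNReal.ofReal_le_ofReal h).trans (le_of_eq ?_)
  rw [ofReal_integral_norm_mul_kernel hΓ hn hgc hx]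
  simp [sub_eq_add_neg]

/-- The quotient rule, applied after subtracting `c`, gives two terms. Each is at most `2n / dist(x,
Γ)` times the kernel average of `|g - c|`, one from the derivative of the numerator and one from
that of the mass. -/
theorem hasFDerivAt_extend (hΓ : IsAhlforsRegular d Γ) (hd : 0 ≤ d)
    (hdn : d < (n : ℝ) - 1) (hn : 1 ≤ n) {g : Space n → ℝ} (hg : Tempered d Γ g) (c : ℝ)
    {x : Space n} (hx : x ∉ Γ) : ∃ L : Space n →L[ℝ] ℝ, HasFDerivAt (extend d Γ g) L x ∧
      ‖L‖ₑ * kernelMass d Γ x ≤ ENNReal.ofReal (4 * n / infDist x Γ) *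
        ∫⁻ y, ‖g y - c‖ₑ * ekernel x y ∂(surfaceMeasure d Γ) := by
  have hZ := kernelInt_one_pos hΓ hd hdn hn hx
  have hδ := infDist_pos_of_notMem hΓ hx
  have h1 := hΓ.tempered_one hd hdn
  have hgc : Tempered d Γ (g + (-c) • 1) := hg.add (h1.smul _)
  have hA := (hgc.hasFDerivAt_kernelInt hΓ hn hx).2
  have hB := (h1.hasFDerivAt_kernelInt hΓ hn hx).2
  set A' := ∫ y, (g + (-c) • 1 : Space n → ℝ) y • kernelDeriv x y ∂(surfaceMeasure d Γ) with hA'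
  set B' := ∫ y, (1 : Space n → ℝ) y • kernelDeriv x y ∂(surfaceMeasure d Γ) with hB'
  set A := kernelInt d Γ (g + (-c) • 1) with hAdef
  set Z := kernelInt d Γ 1 with hZdef
  set I := ∫ y, ‖(g + (-c) • 1 : Space n → ℝ) y * kernel x y‖ ∂(surfaceMeasure d Γ) with hI
  have hAI : ‖A x‖ ≤ I := norm_kernelInt_le _ _
  have hA'I : ‖A'‖ ≤ 2 * n / infDist x Γ * I := norm_integral_kernelDeriv_le hΓ hn hgc hx
  have hB'Z : ‖B'‖ ≤ 2 * n / infDist x Γ * Z x := by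
    have := norm_integral_kernelDeriv_le hΓ hn h1 hx
    simpa [hB', hZdef, kernelInt, abs_of_nonneg (kernel_nonneg _ _)] using this
  have hinv : HasFDerivAt (fun z => (Z z)⁻¹) ((-(Z x ^ 2)⁻¹) • B') x :=
    HasDerivAt.comp_hasFDerivAt (h₂ := fun s : ℝ => s⁻¹) x (hasDerivAt_inv hZ.ne') hB
  have hmul := (hA.mul hinv).add_const c
  refine ⟨_, hmul.congr_of_eventuallyEq ?_, ?_⟩
  · filter_upwards [hΓ.isClosed.isOpen_compl.mem_nhds hx] with z hz
    rw [extend_eq hΓ hd hdn hn hg c hz]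
    rfl
  · have key : ‖A x • ((-(Z x ^ 2)⁻¹) • B') + (Z x)⁻¹ • A'‖ * Z x ≤ 4 * n / infDist x Γ * I := by
      have t1 : ‖A x • ((-(Z x ^ 2)⁻¹) • B')‖ ≤ I * ((Z x ^ 2)⁻¹ * (2 * n / infDist x Γ * Z x)) := by
        rw [norm_smul, norm_smul, norm_neg, Real.norm_of_nonneg (by positivity : 0 ≤ (Z x ^ 2)⁻¹)]
        gcongr
      have t2 : ‖(Z x)⁻¹ • A'‖ ≤ (Z x)⁻¹ * (2 * n / infDist x Γ * I) := by
        rw [norm_smul, Real.norm_of_nonneg (by positivity : 0 ≤ (Z x)⁻¹)]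
        gcongr
      calc _ ≤ (I * ((Z x ^ 2)⁻¹ * (2 * n / infDist x Γ * Z x)) +
            (Z x)⁻¹ * (2 * n / infDist x Γ * I)) * Z x := by
              gcongr
              exact (norm_add_le _ _).trans (add_le_add t1 t2)
        _ = _ := by field_simp; ring
    rw [← ofReal_kernelInt_one hΓ hd hdn hn hx, ← ofReal_norm,
      ← ENNReal.ofReal_mul (norm_nonneg _)]
    refine (ENNReal.ofReal_le_ofReal key).trans (le_of_eq ?_)
    rw [ENNReal.ofReal_mul (by positivity), hI, ofReal_integral_norm_mul_kernel hΓ hn hgc hx]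
    simp [sub_eq_add_neg]

/-- Passing from a linear to a quadratic bound by the Cauchy–Schwarz inequality. -/
theorem sq_mul_kernelMass_le (hΓ : IsAhlforsRegular d Γ) (hd : 0 ≤ d) (hdn : d < (n : ℝ) - 1)
    (hn : 1 ≤ n) {f : Space n → ℝ≥0∞} (hf : Measurable f) {x : Space n} (hx : x ∉ Γ)
    {a m : ℝ≥0∞} (h : a * kernelMass d Γ x ≤
      m * ∫⁻ y, f y * ekernel x y ∂(surfaceMeasure d Γ)) :
    a ^ 2 * kernelMass d Γ x ≤
      m ^ 2 * ∫⁻ y, f y ^ 2 * ekernel x y ∂(surfaceMeasure d Γ) := by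
  have h0 := kernelMass_ne_zero hΓ hx
  have ht := kernelMass_ne_top hΓ hd hdn hn hx
  refine (ENNReal.mul_le_mul_iff_right h0 ht).1 ?_
  calc kernelMass d Γ x * (a ^ 2 * kernelMass d Γ x) = (a * kernelMass d Γ x) ^ 2 := by ring
    _ ≤ (m * ∫⁻ y, f y * ekernel x y ∂(surfaceMeasure d Γ)) ^ 2 := by gcongr
    _ ≤ m ^ 2 * (kernelMass d Γ x * ∫⁻ y, f y ^ 2 * ekernel x y ∂(surfaceMeasure d Γ)) := by
        rw [mul_pow]
        gcongr
        exact sq_lintegral_mul_le hf.aemeasurable (measurable_ekernel_right x).aemeasurable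
    _ = _ := by ring

theorem enorm_extend_sub_sq_mul_le (hΓ : IsAhlforsRegular d Γ) (hd : 0 ≤ d)
    (hdn : d < (n : ℝ) - 1) (hn : 1 ≤ n) {g : Space n → ℝ} (hgm : Measurable g)
    (hg : Tempered d Γ g) (c : ℝ) {x : Space n} (hx : x ∉ Γ) :
    ‖extend d Γ g x - c‖ₑ ^ 2 * kernelMass d Γ x ≤
      ∫⁻ y, ‖g y - c‖ₑ ^ 2 * ekernel x y ∂(surfaceMeasure d Γ) := by
  have h := enorm_extend_sub_mul_le hΓ hd hdn hn hg c hx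
  rw [← one_mul (lintegral _ _)] at h
  simpa using sq_mul_kernelMass_le hΓ hd hdn hn (hgm.sub_const c).enorm hx h

/-- The derivative of the extension is controlled by double differences of `g`. -/
theorem enorm_fderiv_extend_sq_mul_le (hΓ : IsAhlforsRegular d Γ) (hd : 0 ≤ d)
    (hdn : d < (n : ℝ) - 1) (hn : 1 ≤ n) {g : Space n → ℝ} (hgm : Measurable g)
    (hg : Tempered d Γ g) {x : Space n} (hx : x ∉ Γ) :
    ‖fderiv ℝ (extend d Γ g) x‖ₑ ^ 2 * kernelMass d Γ x ^ 2 ≤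
      ENNReal.ofReal (4 * n / infDist x Γ) ^ 2 *
        ∫⁻ z, ∫⁻ y, ‖g y - g z‖ₑ ^ 2 * (ekernel x y * ekernel x z) ∂(surfaceMeasure d Γ)
          ∂(surfaceMeasure d Γ) := by
  have hZt := kernelMass_ne_top hΓ hd hdn hn hx
  have hc : ∀ c : ℝ, ‖fderiv ℝ (extend d Γ g) x‖ₑ ^ 2 * kernelMass d Γ x ≤
      ENNReal.ofReal (4 * n / infDist x Γ) ^ 2 *
        ∫⁻ y, ‖g y - c‖ₑ ^ 2 * ekernel x y ∂(surfaceMeasure d Γ) := by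
    intro c
    obtain ⟨L, hL, hLb⟩ := hasFDerivAt_extend hΓ hd hdn hn hg c hx
    rw [hL.fderiv]
    exact sq_mul_kernelMass_le hΓ hd hdn hn (hgm.sub_const c).enorm hx hLb
  -- The bound holds for every constant. Taking `c = g z` and integrating in `z` against the kernel
  -- yields the second factor of the mass and the double difference.
  calc ‖fderiv ℝ (extend d Γ g) x‖ₑ ^ 2 * kernelMass d Γ x ^ 2
      = ∫⁻ z, ‖fderiv ℝ (extend d Γ g) x‖ₑ ^ 2 * kernelMass d Γ x * ekernel x z
          ∂(surfaceMeasure d Γ) := by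
        rw [lintegral_const_mul _ (measurable_ekernel_right x), ← kernelMass]
        ring
    _ ≤ ∫⁻ z, ENNReal.ofReal (4 * n / infDist x Γ) ^ 2 *
          ∫⁻ y, ‖g y - g z‖ₑ ^ 2 * (ekernel x y * ekernel x z) ∂(surfaceMeasure d Γ)
          ∂(surfaceMeasure d Γ) := by
        refine lintegral_mono fun z => ?_
        have hm : Measurable fun y => ‖g y - g z‖ₑ ^ 2 * ekernel x y :=
          ((hgm.sub_const _).enorm.pow_const 2).mul (measurable_ekernel_right x)
        simp_rw [← mul_assoc (‖_‖ₑ ^ 2)]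
        rw [lintegral_mul_const _ hm, ← mul_assoc]
        exact mul_le_mul_left (hc (g z)) _
    _ = _ := by rw [lintegral_const_mul' _ _ (by simp)]

end Extension

/-! ### Energy bound for the extension -/

section ExtensionEnergy

variable {n : ℕ} {d : ℝ} {Γ : Set (Space n)}

theorem volume_ball_le_rpow (x : Space n) {r : ℝ} (hr : 0 < r) :
    volume (ball x r) ≤ (volume (ball (0 : Space n) 1)).toNNReal * ENNReal.ofReal r ^ (n : ℝ) := by
  rw [volume_ball_eq x hr, ENNReal.coe_toNNReal measure_ball_lt_top.ne, mul_comm,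
    ENNReal.rpow_natCast, ENNReal.ofReal_pow hr.le]

/-- Here `D` stands for the distance to `Γ` and `a ≤ b` for the distances to two points of `Γ`.
After `D ≤ a` the remaining power of `a` is `n - d - 1`, positive by the codimension hypothesis, so
`a` may be raised to `b`. -/
theorem rpow_mul_rpow_mul_rpow_le (hd : 0 ≤ d) (hdn : d < (n : ℝ) - 1) {D a b : ℝ≥0∞} (hDa : D ≤ a)
    (ha : a ≠ 0) (hb' : b ≠ ⊤) (hab : a ≤ b) :
    D ^ (3 * n - d - 1 : ℝ) * (a ^ (-(2 * n : ℝ)) * b ^ (-(2 * n : ℝ))) ≤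
      b ^ (-(n + d + 1 : ℝ)) := by
  have ha' : a ≠ ⊤ := (hab.trans_lt hb'.lt_top).ne
  have hb : b ≠ 0 := ((pos_iff_ne_zero.2 ha).trans_le hab).ne'
  calc _ ≤ a ^ (3 * n - d - 1 : ℝ) * (a ^ (-(2 * n : ℝ)) * b ^ (-(2 * n : ℝ))) := by
        gcongr; linarith
    _ = a ^ (n - d - 1 : ℝ) * b ^ (-(2 * n : ℝ)) := by
        rw [← mul_assoc, ← ENNReal.rpow_add _ _ ha ha']
        congr 2; ring
    _ ≤ b ^ (n - d - 1 : ℝ) * b ^ (-(2 * n : ℝ)) := by gcongr; linarith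
    _ = _ := by
        rw [← ENNReal.rpow_add _ _ hb hb']
        congr 1; ring

theorem ofReal_infDist_le_edist {y : Space n} (x : Space n) (hy : y ∈ Γ) :
    ENNReal.ofReal (infDist x Γ) ≤ edist x y := by
  rw [edist_dist]
  exact ENNReal.ofReal_le_ofReal (infDist_le_dist_of_mem hy)

/-- The integrand is at most the larger of `|x - y|`, `|x - z|` to the power `-(n + d + 1)`. That
maximum is at least `|y - z| / 2`, which is used on the ball of radius `|y - z|` about `y`, and at
least `|x - y|`, which is used outside. Both pieces scale as `|y - z|^(-(d+1))`. -/
theorem exists_lintegral_kernel_mul_kernel_le (hΓ : IsAhlforsRegular d Γ) (hd : 0 ≤ d)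
    (hdn : d < (n : ℝ) - 1) :
    ∃ C : ℝ≥0, ∀ y ∈ Γ, ∀ z ∈ Γ, y ≠ z →
      ∫⁻ x in Γᶜ, ENNReal.ofReal (infDist x Γ) ^ (3 * n - d - 1 : ℝ) *
        (ekernel x y * ekernel x z) ≤ C * edist y z ^ (-(d + 1)) := by
  obtain ⟨C', hC'⟩ := exists_lintegral_compl_ball_le (X := Space n)
    (volume (ball (0 : Space n) 1)).toNNReal (d := n) (q := n + d + 1) (by positivity) (by linarith)
  set κ := (volume (ball (0 : Space n) 1)).toNNReal with hκ
  refine ⟨((2 : ℝ) ^ (n + d + 1 : ℝ)).toNNReal * κ + C', fun y hy z hz hyz => ?_⟩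
  set ρ := dist y z with hρ
  have hρ0 : 0 < ρ := dist_pos.2 hyz
  set c := ENNReal.ofReal (ρ / 2) ^ (-(n + d + 1 : ℝ)) with hc
  have hmE : Measurable fun x : Space n => edist x y ^ (-(n + d + 1 : ℝ)) :=
    (by fun_prop : Measurable fun x : Space n => edist x y).pow_const _
  have hpt : ∀ x ∈ Γᶜ, ENNReal.ofReal (infDist x Γ) ^ (3 * n - d - 1 : ℝ) *
      (ekernel x y * ekernel x z) ≤ (ball y ρ).indicator (fun _ => c) x +
        (ball y ρ)ᶜ.indicator (fun x => edist x y ^ (-(n + d + 1 : ℝ))) x := by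
    intro x hx
    have hxy : x ≠ y := by rintro rfl; exact hx hy
    have hxz : x ≠ z := by rintro rfl; exact hx hz
    have h1 : ENNReal.ofReal (infDist x Γ) ^ (3 * n - d - 1 : ℝ) * (ekernel x y * ekernel x z) ≤
        max (edist x y) (edist x z) ^ (-(n + d + 1 : ℝ)) := by
      rcases le_total (edist x y) (edist x z) with h | h
      · rw [max_eq_right h]
        exact rpow_mul_rpow_mul_rpow_le hd hdn (ofReal_infDist_le_edist x hy)
          (edist_pos.2 hxy).ne' (edist_ne_top _ _) h
      · rw [max_eq_left h, mul_comm (ekernel x y)]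
        exact rpow_mul_rpow_mul_rpow_le hd hdn (ofReal_infDist_le_edist x hz)
          (edist_pos.2 hxz).ne' (edist_ne_top _ _) h
    refine h1.trans ?_
    by_cases hxb : x ∈ ball y ρ
    · rw [indicator_of_mem hxb, indicator_of_notMem (by simpa using hxb), add_zero, hc,
        ENNReal.rpow_neg, ENNReal.rpow_neg]
      refine ENNReal.inv_le_inv.2 (ENNReal.rpow_le_rpow ?_ (by linarith))
      rw [edist_dist, edist_dist, ← ENNReal.ofReal_max]
      refine ENNReal.ofReal_le_ofReal ?_
      have h2 := dist_triangle_left y z x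
      rcases le_total (dist x y) (dist x z) with h | h
      · rw [max_eq_right h]; linarith
      · rw [max_eq_left h]; linarith
    · rw [indicator_of_notMem hxb, indicator_of_mem (show x ∈ (ball y ρ)ᶜ from hxb), zero_add,
        ENNReal.rpow_neg, ENNReal.rpow_neg]
      exact ENNReal.inv_le_inv.2 (ENNReal.rpow_le_rpow (le_max_left _ _) (by linarith))
  have hgrow : ∀ r : ℝ, 0 < r → volume (ball y r) ≤ κ * ENNReal.ofReal r ^ (n : ℝ) := fun r hr =>
    volume_ball_le_rpow y hr
  have e1 : c * volume (ball y ρ) ≤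
      ENNReal.ofReal ((2 : ℝ) ^ (n + d + 1 : ℝ)) * κ * edist y z ^ (-(d + 1)) := by
    refine (mul_le_mul_right (hgrow ρ hρ0) _).trans (le_of_eq ?_)
    rw [hc, edist_dist, ← hρ, ENNReal.ofReal_rpow_of_pos (by positivity),
      ENNReal.ofReal_rpow_of_pos hρ0, ENNReal.ofReal_rpow_of_pos hρ0, mul_left_comm,
      mul_comm (ENNReal.ofReal _) (κ : ℝ≥0∞), mul_assoc, ← ENNReal.ofReal_mul (by positivity),
      ← ENNReal.ofReal_mul (by positivity), Real.div_rpow hρ0.le (by norm_num),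
      Real.rpow_neg (by norm_num : (0 : ℝ) ≤ 2), div_inv_eq_mul, mul_comm (ρ ^ _), mul_assoc,
      ← Real.rpow_add hρ0]
    congr 4
    ring
  have e2 : ∫⁻ x in (ball y ρ)ᶜ, edist x y ^ (-(n + d + 1 : ℝ)) ≤ C' * edist y z ^ (-(d + 1)) := by
    refine (hC' volume y hgrow ρ hρ0).trans (le_of_eq ?_)
    rw [edist_dist, ← hρ]
    congr 2
    ring
  calc _ ≤ ∫⁻ x in Γᶜ, ((ball y ρ).indicator (fun _ => c) x +
        (ball y ρ)ᶜ.indicator (fun x => edist x y ^ (-(n + d + 1 : ℝ))) x) :=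
        setLIntegral_mono' hΓ.isClosed.measurableSet.compl hpt
    _ ≤ ∫⁻ x, ((ball y ρ).indicator (fun _ => c) x +
        (ball y ρ)ᶜ.indicator (fun x => edist x y ^ (-(n + d + 1 : ℝ))) x) :=
        setLIntegral_le_lintegral _ _
    _ = c * volume (ball y ρ) + ∫⁻ x in (ball y ρ)ᶜ, edist x y ^ (-(n + d + 1 : ℝ)) := by
        rw [lintegral_add_left (measurable_const.indicator measurableSet_ball),
          lintegral_indicator measurableSet_ball, setLIntegral_const,
          lintegral_indicator measurableSet_ball.compl]
    _ ≤ ENNReal.ofReal ((2 : ℝ) ^ (n + d + 1 : ℝ)) * κ * edist y z ^ (-(d + 1)) +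
        C' * edist y z ^ (-(d + 1)) := add_le_add e1 e2
    _ = _ := by
        push_cast
        rw [ENNReal.ofReal]
        ring

/-- The kernel in the double integral representation of the energy. -/
theorem measurable_energy_integrand {g : Space n → ℝ} (hgm : Measurable g) (β : ℝ) :
    Measurable fun q : (Space n × Space n) × Space n =>
      ‖g q.2 - g q.1.2‖ₑ ^ 2 * (ENNReal.ofReal (infDist q.1.1 Γ) ^ β *
        (ekernel q.1.1 q.2 * ekernel q.1.1 q.1.2)) := by
  have h1 : Measurable fun q : (Space n × Space n) × Space n => ‖g q.2 - g q.1.2‖ₑ ^ 2 :=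
    ((hgm.comp measurable_snd).sub (hgm.comp (measurable_snd.comp
      measurable_fst))).enorm.pow_const 2
  have h2 : Measurable fun q : (Space n × Space n) × Space n =>
      ENNReal.ofReal (infDist q.1.1 Γ) ^ β :=
    ((continuous_infDist_pt Γ).measurable.comp
      (measurable_fst.comp measurable_fst)).ennreal_ofReal.pow_const β
  have h3 : Measurable fun q : (Space n × Space n) × Space n => ekernel q.1.1 q.2 :=
    (by fun_prop : Measurable fun q : (Space n × Space n) × Space n =>
      edist q.1.1 q.2).pow_const _
  have h4 : Measurable fun q : (Space n × Space n) × Space n => ekernel q.1.1 q.1.2 :=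
    (by fun_prop : Measurable fun q : (Space n × Space n) × Space n =>
      edist q.1.1 q.1.2).pow_const _
  exact h1.mul (h2.mul (h3.mul h4))

theorem measurable_energy_integrand_right {g : Space n → ℝ} (hgm : Measurable g) (β : ℝ)
    (z : Space n) : Measurable fun q : Space n × Space n =>
      ‖g q.2 - g z‖ₑ ^ 2 * (ENNReal.ofReal (infDist q.1 Γ) ^ β *
        (ekernel q.1 q.2 * ekernel q.1 z)) := by
  have h1 : Measurable fun q : Space n × Space n => ‖g q.2 - g z‖ₑ ^ 2 :=
    ((hgm.comp measurable_snd).sub_const _).enorm.pow_const 2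
  have h2 : Measurable fun q : Space n × Space n => ENNReal.ofReal (infDist q.1 Γ) ^ β :=
    ((continuous_infDist_pt Γ).measurable.comp measurable_fst).ennreal_ofReal.pow_const β
  have h4 : Measurable fun q : Space n × Space n => ekernel q.1 z :=
    (by fun_prop : Measurable fun q : Space n × Space n => edist q.1 z).pow_const _
  exact h1.mul (h2.mul (measurable_ekernel.mul h4))

/-- The lower bound for the mass removes `kernelMass ^ 2` at the price of `δ^(4n-2d)`, where `δ` is
the distance to `Γ`. With `δ^(-2)` from the derivative and the weight `δ^(-n+d+1)`, the exponents
add up to `3n - d - 1`. -/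
theorem exists_fderiv_extend_sq_mul_weight_le (hΓ : IsAhlforsRegular d Γ) (hd : 0 ≤ d)
    (hdn : d < (n : ℝ) - 1) (hn : 1 ≤ n) :
    ∃ C : ℝ≥0, ∀ g : Space n → ℝ, Measurable g → Tempered d Γ g → ∀ x ∈ Γᶜ,
      ‖fderiv ℝ (extend d Γ g) x‖ₑ ^ 2 * ENNReal.ofReal (weight d Γ x) ≤
        C * ∫⁻ z, ∫⁻ y, ‖g y - g z‖ₑ ^ 2 * (ENNReal.ofReal (infDist x Γ) ^ (3 * n - d - 1 : ℝ) *
          (ekernel x y * ekernel x z)) ∂(surfaceMeasure d Γ) ∂(surfaceMeasure d Γ) := by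
  obtain ⟨C₂, hC₂⟩ := exists_le_kernelMass hΓ
  refine ⟨C₂ ^ 2 * (4 * n) ^ 2, fun g hgm hg x hx => ?_⟩
  push_cast
  set σ := surfaceMeasure d Γ with hσ
  have hδ := infDist_pos_of_notMem hΓ hx
  have h1 := enorm_fderiv_extend_sq_mul_le hΓ hd hdn hn hgm hg hx
  have h2 := hC₂ x hx
  set D := ENNReal.ofReal (infDist x Γ) with hD
  have hD0 : D ≠ 0 := by simpa [hD] using hδ
  have hDt : D ≠ ⊤ := ENNReal.ofReal_ne_top
  have hw : ENNReal.ofReal (weight d Γ x) = D ^ (-(n : ℝ) + d + 1) := by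
    rw [weight, ENNReal.ofReal_rpow_of_pos hδ]
  have h3 : ENNReal.ofReal (4 * n / infDist x Γ) ^ 2 = (4 * n) ^ 2 * D ^ (-2 : ℝ) := by
    rw [ENNReal.ofReal_div_of_pos hδ, div_eq_mul_inv, mul_pow, ENNReal.ofReal_mul (by norm_num),
      ENNReal.rpow_neg, ← hD]
    norm_num
    rw [ENNReal.inv_pow]
  have h4 : (1 : ℝ≥0∞) ≤ C₂ ^ 2 * kernelMass d Γ x ^ 2 * D ^ (4 * n - 2 * d : ℝ) := by
    calc (1 : ℝ≥0∞) = (D ^ (d - 2 * n : ℝ)) ^ 2 * D ^ (4 * n - 2 * d : ℝ) := by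
          rw [← ENNReal.rpow_natCast, ← ENNReal.rpow_mul, ← ENNReal.rpow_add _ _ hD0 hDt]
          rw [show (d - 2 * n : ℝ) * (2 : ℕ) + (4 * n - 2 * d) = 0 by push_cast; ring,
            ENNReal.rpow_zero]
      _ ≤ (C₂ * kernelMass d Γ x) ^ 2 * D ^ (4 * n - 2 * d : ℝ) := by gcongr
      _ = _ := by ring
  have h5 : ∫⁻ z, ∫⁻ y, ‖g y - g z‖ₑ ^ 2 *
      (D ^ (3 * n - d - 1 : ℝ) * (ekernel x y * ekernel x z)) ∂σ ∂σ = D ^ (3 * n - d - 1 : ℝ) *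
      ∫⁻ z, ∫⁻ y, ‖g y - g z‖ₑ ^ 2 * (ekernel x y * ekernel x z) ∂σ ∂σ := by
    have hDne : D ^ (3 * n - d - 1 : ℝ) ≠ ⊤ :=
      ENNReal.rpow_ne_top_of_ne_zero hD0 hDt
    rw [← lintegral_const_mul' _ _ hDne]
    refine lintegral_congr fun z => ?_
    rw [← lintegral_const_mul' _ _ hDne]
    refine lintegral_congr fun y => ?_
    ring
  set I := ∫⁻ z, ∫⁻ y, ‖g y - g z‖ₑ ^ 2 * (ekernel x y * ekernel x z) ∂σ ∂σ with hI
  set N := ‖fderiv ℝ (extend d Γ g) x‖ₑ ^ 2 with hN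
  calc N * ENNReal.ofReal (weight d Γ x)
      ≤ N * ENNReal.ofReal (weight d Γ x) *
        (C₂ ^ 2 * kernelMass d Γ x ^ 2 * D ^ (4 * n - 2 * d : ℝ)) :=
        le_mul_of_one_le_right zero_le h4
    _ = C₂ ^ 2 * (N * kernelMass d Γ x ^ 2) *
        (D ^ (-(n : ℝ) + d + 1) * D ^ (4 * n - 2 * d : ℝ)) := by rw [hw]; ring
    _ ≤ C₂ ^ 2 * ((4 * n) ^ 2 * D ^ (-2 : ℝ) * I) *
        (D ^ (-(n : ℝ) + d + 1) * D ^ (4 * n - 2 * d : ℝ)) := by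
        rw [← h3]; gcongr
    _ = C₂ ^ 2 * (4 * n) ^ 2 * (D ^ (-2 : ℝ) *
        (D ^ (-(n : ℝ) + d + 1) * D ^ (4 * n - 2 * d : ℝ)) * I) := by ring
    _ = _ := by
        rw [h5, ← ENNReal.rpow_add _ _ hD0 hDt, ← ENNReal.rpow_add _ _ hD0 hDt]
        congr 3
        ring_nf

theorem exists_lintegral_fderiv_extend_le (hΓ : IsAhlforsRegular d Γ) (hd : 0 ≤ d)
    (hdn : d < (n : ℝ) - 1) (hn : 1 ≤ n) :
    ∃ C : ℝ≥0, ∀ g : Space n → ℝ, Measurable g → Tempered d Γ g →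
      ∫⁻ x in Γᶜ, ‖fderiv ℝ (extend d Γ g) x‖ₑ ^ 2 * ENNReal.ofReal (weight d Γ x) ≤
        C * energyH d Γ g := by
  have := hΓ.isLocallyFiniteMeasure hd
  obtain ⟨C₁, hC₁⟩ := exists_lintegral_kernel_mul_kernel_le hΓ hd hdn
  obtain ⟨C₂, hC₂⟩ := exists_fderiv_extend_sq_mul_weight_le hΓ hd hdn hn
  refine ⟨C₂ * C₁, fun g hgm hg => ?_⟩
  set σ := surfaceMeasure d Γ with hσ
  set F : Space n → Space n → Space n → ℝ≥0∞ := fun x z y => ‖g y - g z‖ₑ ^ 2 *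
    (ENNReal.ofReal (infDist x Γ) ^ (3 * n - d - 1 : ℝ) * (ekernel x y * ekernel x z)) with hF
  have hFm : Measurable fun q : (Space n × Space n) × Space n => F q.1.1 q.1.2 q.2 :=
    measurable_energy_integrand hgm _
  have hFm2 : Measurable fun q : Space n × Space n => ∫⁻ y, F q.1 q.2 y ∂σ :=
    hFm.lintegral_prod_right'
  calc _ ≤ ∫⁻ x in Γᶜ, C₂ * ∫⁻ z, ∫⁻ y, F x z y ∂σ ∂σ :=
        setLIntegral_mono' hΓ.isClosed.measurableSet.compl (hC₂ g hgm hg)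
    _ = C₂ * ∫⁻ x in Γᶜ, ∫⁻ z, ∫⁻ y, F x z y ∂σ ∂σ :=
        lintegral_const_mul _ hFm2.lintegral_prod_right'
    -- Moving the integral over `x` innermost isolates the product of two kernels, whose integral is
    -- the Slobodeckij kernel up to a constant.
    _ = C₂ * ∫⁻ z, ∫⁻ y, (∫⁻ x in Γᶜ, F x z y) ∂σ ∂σ := by
        congr 1
        rw [lintegral_lintegral_swap hFm2.aemeasurable]
        refine lintegral_congr fun z => ?_
        exact lintegral_lintegral_swap
          (measurable_energy_integrand_right hgm (3 * n - d - 1) z).aemeasurable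
    _ ≤ C₂ * ∫⁻ z, ∫⁻ y, C₁ * (‖g z - g y‖ₑ ^ 2 * edist z y ^ (-(d + 1)))
          ∂σ ∂σ := by
        refine mul_le_mul_right (lintegral_mono_ae ?_) _
        filter_upwards [hΓ.ae_mem] with z hz
        refine lintegral_mono_ae ?_
        filter_upwards [hΓ.ae_mem] with y hy
        rcases eq_or_ne y z with h | h
        · simp [hF, h]
        · simp only [hF]
          rw [lintegral_const_mul' _ _ (by simp), enorm_sub_rev, edist_comm, mul_left_comm]
          exact mul_le_mul_right (hC₁ y hy z hz h) _
    _ = C₂ * (C₁ * energyH d Γ g) := by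
        congr 1
        rw [energyH, ← lintegral_const_mul' _ _ (by simp)]
        refine lintegral_congr fun z => ?_
        rw [lintegral_const_mul' _ _ (by simp)]
    _ = _ := by push_cast; ring

end ExtensionEnergy

/-! ### Classical and weak gradients; the extension as an element of `W` -/

section WeakGradient

variable {n : ℕ} {d : ℝ} {Γ : Set (Space n)}

theorem inner_gradient (f : Space n → ℝ) (x v : Space n) :
    inner ℝ (gradient f x) v = fderiv ℝ f x v := by
  rw [gradient, InnerProductSpace.toDual_symm_apply]

theorem enorm_gradient (f : Space n → ℝ) (x : Space n) :
    ‖gradient f x‖ₑ = ‖fderiv ℝ f x‖ₑ := by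
  rw [gradient, ← ofReal_norm, ← ofReal_norm, LinearIsometryEquiv.norm_map]

theorem measurable_gradient (f : Space n → ℝ) : Measurable (gradient f) :=
  (LinearIsometryEquiv.continuous _).measurable.comp (measurable_fderiv ℝ f)

/-- The classical gradient is a weak gradient as soon as it is locally integrable. -/
theorem hasWeakGradient_gradient {Ω : Set (Space n)} (hΩ : IsOpen Ω) {f : Space n → ℝ}
    (hf : ∀ x ∈ Ω, DifferentiableAt ℝ f x) (hloc : LocallyIntegrableOn (gradient f) Ω) :
    HasWeakGradient Ω f (gradient f) where
  locallyIntegrableOn := ContinuousOn.locallyIntegrableOn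
    (fun x hx => (hf x hx).continuousAt.continuousWithinAt) hΩ.measurableSet
  locallyIntegrableOn_grad := hloc
  integral_eq := fun φ hφ hc hs v => by
    have hfl : LocallyIntegrableOn f Ω := ContinuousOn.locallyIntegrableOn
      (fun x hx => (hf x hx).continuousAt.continuousWithinAt) hΩ.measurableSet
    have hgl : LocallyIntegrableOn (fun x => inner ℝ (gradient f x) v) Ω := fun x hx => by
      obtain ⟨s, hs, hi⟩ := hloc x hx
      exact ⟨s, hs, Integrable.inner_const hi v⟩
    have hz : ∀ x, x ∉ Ω → φ x = 0 := fun x hx =>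
      image_eq_zero_of_notMem_tsupport fun hm => hx (hs hm)
    have hz' : ∀ x, x ∉ Ω → fderiv ℝ φ x = 0 := fun x hx => by
      by_contra h0
      exact hx (hs (support_fderiv_subset ℝ h0))
    have hcd : Continuous fun x => fderiv ℝ φ x v :=
      (hφ.continuous_fderiv (by simp)).clm_apply continuous_const
    have hsub : tsupport (fun x => fderiv ℝ φ x v) ⊆ tsupport φ :=
      closure_minimal (fun x hx => by
        refine support_fderiv_subset ℝ (fun h0 => hx ?_)
        simp [h0]) (isClosed_tsupport φ)
    have i1 : Integrable fun x => fderiv ℝ f x v * φ x := by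
      have := integrableOn_mul_of_tsupport hgl hφ.continuous hc hs
      simp_rw [inner_gradient] at this
      refine (integrableOn_iff_integrable_of_support_subset ?_).1 this
      intro x hx
      by_contra hn
      exact hx (by simp [hz x hn])
    have i2 : Integrable fun x => f x * fderiv ℝ φ x v := by
      have := integrableOn_mul_of_tsupport hfl hcd
        (hc.of_isClosed_subset (isClosed_tsupport _) hsub) (hsub.trans hs)
      refine (integrableOn_iff_integrable_of_support_subset ?_).1 this
      intro x hx
      by_contra hn
      exact hx (by simp [hz' x hn])
    have i3 : Integrable fun x => f x * φ x := by
      have := integrableOn_mul_of_tsupport hfl hφ.continuous hc hs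
      refine (integrableOn_iff_integrable_of_support_subset ?_).1 this
      intro x hx
      by_contra hn
      exact hx (by simp [hz x hn])
    -- Integration by parts on the whole space in the direction `v`: differentiability of `f` is
    -- needed only on `tsupport φ`, which lies in `Ω`.
    have key := integral_bilinear_hasLineDerivAt_right_eq_neg_left_of_integrable
      (B := ContinuousLinearMap.mul ℝ ℝ) (v := v) i1 i2 i3
      (fun x hx => (hf x (hs hx)).hasFDerivAt.hasLineDerivAt v)
      (fun x _ => ((hφ.differentiable (by simp)) x).hasFDerivAt.hasLineDerivAt v)
    simp only [ContinuousLinearMap.mul_apply'] at key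
    rw [setIntegral_eq_integral_of_forall_compl_eq_zero fun x hx => by simp [hz' x hx],
      setIntegral_eq_integral_of_forall_compl_eq_zero fun x hx => by simp [hz x hx], key]
    simp_rw [inner_gradient, mul_comm]

/-- On the ball whose radius `δ` is the distance of its centre to `Γ`, distances to `Γ` are below
`2δ`. As the exponent of the weight is negative, the weight is bounded below there, and finite
energy gives `L²`, hence `L¹`. -/
theorem locallyIntegrableOn_of_energyW (hΓ : IsAhlforsRegular d Γ) (hdn : d < (n : ℝ) - 1)
    {G : Space n → Space n} (hG : Measurable G) (h : energyW d Γ G ≠ ⊤) :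
    LocallyIntegrableOn G Γᶜ := by
  intro x hx
  have hδ := infDist_pos_of_notMem hΓ hx
  set δ := infDist x Γ with hδdef
  have hsub : ball x δ ⊆ Γᶜ := fun y hy hyΓ => by
    have := infDist_le_dist_of_mem (x := x) hyΓ
    rw [mem_ball, dist_comm] at hy
    linarith
  refine ⟨ball x δ, mem_nhdsWithin_of_mem_nhds (ball_mem_nhds x hδ), hG.aestronglyMeasurable, ?_⟩
  set c : ℝ := (2 * δ) ^ (-(n : ℝ) + d + 1) with hc
  have hc0 : 0 < c := by positivity
  have hw : ∀ y ∈ ball x δ, c ≤ weight d Γ y := fun y hy => by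
    refine Real.rpow_le_rpow_of_nonpos (infDist_pos_of_notMem hΓ (hsub hy)) ?_ (by linarith)
    have h1 := infDist_le_infDist_add_dist (s := Γ) (x := y) (y := x)
    have h2 : dist y x < δ := hy
    linarith
  have hsq : ∫⁻ y in ball x δ, ‖G y‖ₑ ^ 2 ≠ ⊤ := by
    have h1 : (∫⁻ y in ball x δ, ‖G y‖ₑ ^ 2) * ENNReal.ofReal c ≤ energyW d Γ G := by
      rw [← lintegral_mul_const' _ _ ENNReal.ofReal_ne_top, energyW]
      refine (setLIntegral_mono' measurableSet_ball fun y hy => ?_).trans (lintegral_mono_set hsub)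
      exact mul_le_mul_right (ENNReal.ofReal_le_ofReal (hw y hy)) _
    intro htop
    rw [htop, ENNReal.top_mul (by simpa using hc0)] at h1
    exact h (top_le_iff.1 h1)
  have h2 := sq_lintegral_le (μ := volume.restrict (ball x δ)) hG.enorm.aemeasurable
  rw [Measure.restrict_apply_univ] at h2
  have h3 := h2.trans_lt (ENNReal.mul_lt_top measure_ball_lt_top hsq.lt_top)
  rw [HasFiniteIntegral]
  by_contra hcon
  simp only [not_lt, top_le_iff] at hcon
  simp [hcon] at h3

theorem measurable_kernelInt (hΓ : IsAhlforsRegular d Γ) (hd : 0 ≤ d) {g : Space n → ℝ}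
    (hg : Measurable g) : Measurable (kernelInt d Γ g) := by
  have := hΓ.isLocallyFiniteMeasure hd
  have h1 : Measurable fun z : Space n × Space n => g z.2 * kernel z.1 z.2 := by
    refine (hg.comp measurable_snd).mul ?_
    unfold kernel
    fun_prop
  exact (h1.stronglyMeasurable.integral_prod_right' (ν := surfaceMeasure d Γ)).measurable

theorem measurable_extend (hΓ : IsAhlforsRegular d Γ) (hd : 0 ≤ d) {g : Space n → ℝ}
    (hg : Measurable g) : Measurable (extend d Γ g) :=
  (measurable_kernelInt hΓ hd hg).div (measurable_kernelInt hΓ hd measurable_const)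

theorem exists_hasWeakGradient_extend (hΓ : IsAhlforsRegular d Γ) (hd : 0 ≤ d)
    (hdn : d < (n : ℝ) - 1) : ∃ C : ℝ≥0, ∀ g : spaceH d Γ, ∃ G : Space n → Space n, Measurable G ∧
      HasWeakGradient Γᶜ (extend d Γ g.1) G ∧ energyW d Γ G ≤ C * energyH d Γ g.1 := by
  have hn : 1 ≤ n := by
    have : (1 : ℝ) < n := by linarith
    exact_mod_cast this.le
  obtain ⟨C, hC⟩ := exists_lintegral_fderiv_extend_le hΓ hd hdn hn
  refine ⟨C, fun g => ?_⟩
  have hg := tempered_of_mem_spaceH hΓ hd hdn g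
  have hE := hC g.1 g.1.measurable hg
  set G := gradient (extend d Γ g.1) with hG
  have hE' : energyW d Γ G ≤ C * energyH d Γ g.1 := by
    simp_rw [energyW, hG, enorm_gradient]
    exact hE
  have hfin : energyH d Γ g.1 ≠ ⊤ := (integrable_slobodeckij_iff hΓ hd g.1.measurable).1 g.2
  refine ⟨G, measurable_gradient _, hasWeakGradient_gradient hΓ.isClosed.isOpen_compl
    (fun x hx => ?_) ?_, hE'⟩
  · obtain ⟨L, hL, -⟩ := hasFDerivAt_extend hΓ hd hdn hn hg 0 hx
    exact hL.differentiableAt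
  · exact locallyIntegrableOn_of_energyW hΓ hdn (measurable_gradient _)
      (hE'.trans_lt (ENNReal.mul_lt_top (by simp) hfin.lt_top)).ne

theorem extend_congr {g g' : Space n → ℝ} (h : g =ᵐ[surfaceMeasure d Γ] g') :
    extend d Γ g = extend d Γ g' := by
  ext x
  rw [extend, extend]
  congr 1
  refine integral_congr_ae ?_
  filter_upwards [h] with y hy
  rw [hy]

theorem extend_add (hΓ : IsAhlforsRegular d Γ) (hn : 1 ≤ n) {g g' : Space n → ℝ}
    (hg : Tempered d Γ g) (hg' : Tempered d Γ g') {x : Space n} (hx : x ∉ Γ) :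
    extend d Γ (g + g') x = extend d Γ g x + extend d Γ g' x := by
  rw [extend, extend, extend, ← add_div]
  congr 1
  rw [kernelInt, kernelInt, kernelInt, ← integral_add (hg.hasFDerivAt_kernelInt hΓ hn hx).1
    (hg'.hasFDerivAt_kernelInt hΓ hn hx).1]
  simp_rw [Pi.add_apply, add_mul]

theorem extend_smul (g : Space n → ℝ) (c : ℝ) (x : Space n) :
    extend d Γ (c • g) x = c * extend d Γ g x := by
  rw [extend, extend, ← mul_div_assoc]
  congr 1
  rw [kernelInt, kernelInt, ← integral_const_mul]
  simp_rw [Pi.smul_apply, smul_eq_mul, mul_assoc]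

/-- The extension operator. -/
theorem exists_extension (hΓ : IsAhlforsRegular d Γ) (hd : 0 ≤ d) (hdn : d < (n : ℝ) - 1) :
    ∃ E : spaceH d Γ →ₗ[ℝ] spaceW d Γ,
      (∀ g, ((E g).1 : Space n → ℝ) =ᵐ[volume.restrict Γᶜ] extend d Γ g.1) ∧
      ∃ C : ℝ, ∀ g : spaceH d Γ, normW d Γ (E g).1 ≤ C * normH d Γ g.1 := by
  have hn : 1 ≤ n := by
    have : (1 : ℝ) < n := by linarith
    exact_mod_cast this.le
  obtain ⟨C, hC⟩ := exists_hasWeakGradient_extend hΓ hd hdn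
  have hm : ∀ g : spaceH d Γ, AEStronglyMeasurable (extend d Γ g.1) (volume.restrict Γᶜ) :=
    fun g => (measurable_extend hΓ hd g.1.measurable).aestronglyMeasurable
  have hfin : ∀ g : spaceH d Γ, energyH d Γ g.1 ≠ ⊤ := fun g =>
    (integrable_slobodeckij_iff hΓ hd g.1.measurable).1 g.2
  have hmk : ∀ g : spaceH d Γ, (AEEqFun.mk _ (hm g) : Space n → ℝ)
      =ᵐ[volume.restrict Γᶜ] extend d Γ g.1 := fun g => AEEqFun.coeFn_mk _ (hm g)
  have hmem : ∀ g : spaceH d Γ, AEEqFun.mk _ (hm g) ∈ spaceW d Γ := fun g => by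
    obtain ⟨G, hG, hw, hE⟩ := hC g
    refine ⟨G, hw.congr (hmk g).symm, ?_⟩
    rw [integrableOn_sq_mul_weight_iff hG.aestronglyMeasurable]
    exact (hE.trans_lt (ENNReal.mul_lt_top (by simp) (hfin g).lt_top)).ne
  let E : spaceH d Γ →ₗ[ℝ] spaceW d Γ :=
    { toFun := fun g => ⟨AEEqFun.mk _ (hm g), hmem g⟩
      map_add' := fun g g' => by
        refine Subtype.ext (AEEqFun.ext ?_)
        refine (hmk (g + g')).trans (EventuallyEq.trans ?_ (AEEqFun.coeFn_add _ _).symm)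
        filter_upwards [hmk g, hmk g',
          ae_restrict_mem hΓ.isClosed.measurableSet.compl] with x h1 h2 hx
        rw [Pi.add_apply, h1, h2, ← extend_add hΓ hn (tempered_of_mem_spaceH hΓ hd hdn g)
          (tempered_of_mem_spaceH hΓ hd hdn g') hx]
        exact congrFun (extend_congr (AEEqFun.coeFn_add g.1 g'.1)) x
      map_smul' := fun c g => by
        refine Subtype.ext (AEEqFun.ext ?_)
        refine (hmk (c • g)).trans (EventuallyEq.trans ?_ (AEEqFun.coeFn_smul _ _).symm)
        filter_upwards [hmk g] with x h1
        rw [Pi.smul_apply, RingHom.id_apply, h1, smul_eq_mul, ← extend_smul]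
        exact congrFun (extend_congr (AEEqFun.coeFn_smul c g.1)) x }
  refine ⟨E, hmk, √C, fun g => ?_⟩
  obtain ⟨G, hG, hw, hE⟩ := hC g
  have hEg : normW d Γ (E g).1 = √(energyW d Γ G).toReal :=
    normW_eq hΓ.isClosed (hw.congr (hmk g).symm)
  rw [normH_eq hΓ hd g.1.measurable, hEg, ← Real.sqrt_mul (by positivity)]
  refine Real.sqrt_le_sqrt ?_
  have := ENNReal.toReal_mono (ENNReal.mul_ne_top (by simp) (hfin g)) hE
  simpa using this

end WeakGradient

/-! ### Lebesgue points in `H` and a pointwise kernel estimate -/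

section TraceOfExtension

variable {n : ℕ} {d : ℝ} {Γ : Set (Space n)}

theorem sq_setLAverage_le {X : Type*} [MeasurableSpace X] {μ : Measure X} {s : Set X}
    (h0 : μ s ≠ 0) (ht : μ s ≠ ⊤) {f : X → ℝ≥0∞} (hf : AEMeasurable f (μ.restrict s)) :
    (⨍⁻ x in s, f x ∂μ) ^ 2 ≤ (∫⁻ x in s, f x ^ 2 ∂μ) / μ s := by
  have h := sq_lintegral_le hf
  rw [Measure.restrict_apply_univ] at h
  rw [setLAverage_eq, div_eq_mul_inv, mul_pow, ← ENNReal.inv_pow, ← div_eq_mul_inv]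
  refine (ENNReal.div_le_div_right h _).trans (le_of_eq ?_)
  rw [sq (μ s), ENNReal.mul_div_mul_left _ _ h0 ht]

theorem tendsto_zero_of_sq_le {f : ℝ → ℝ≥0∞} {M : ℝ≥0∞} (hM : M ≠ ⊤)
    (h : ∀ r : ℝ, 0 < r → f r ^ 2 ≤ ENNReal.ofReal r * M) :
    Tendsto f (𝓝[>] 0) (𝓝 0) := by
  have h1 : Tendsto (fun r : ℝ => (ENNReal.ofReal r * M) ^ (1 / 2 : ℝ)) (𝓝[>] 0) (𝓝 0) := by
    have e : Tendsto (fun r : ℝ => ENNReal.ofReal r * M) (𝓝[>] 0) (𝓝 0) := by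
      have := ENNReal.Tendsto.mul_const (b := M)
        ((ENNReal.continuous_ofReal.tendsto 0).mono_left (nhdsWithin_le_nhds (s := Ioi (0 : ℝ))))
        (Or.inr hM)
      simpa using this
    have := (ENNReal.continuous_rpow_const (y := (1 / 2 : ℝ))).tendsto 0 |>.comp e
    rw [ENNReal.zero_rpow_of_pos (by norm_num)] at this
    exact this
  refine tendsto_of_tendsto_of_tendsto_of_le_of_le' tendsto_const_nhds h1
    (Eventually.of_forall fun _ => zero_le) ?_
  filter_upwards [self_mem_nhdsWithin] with r hr
  rw [one_div, ENNReal.le_rpow_inv_iff (by norm_num)]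
  exact_mod_cast h r hr

/-- The inner integral of the energy of `g`. -/
def pointEnergy (d : ℝ) (Γ : Set (Space n)) (g : Space n → ℝ) (x : Space n) : ℝ≥0∞ :=
  ∫⁻ y, ‖g x - g y‖ₑ ^ 2 * edist x y ^ (-(d + 1)) ∂(surfaceMeasure d Γ)

theorem ae_pointEnergy_ne_top (hΓ : IsAhlforsRegular d Γ) (hd : 0 ≤ d) (g : spaceH d Γ) :
    ∀ᵐ x ∂(surfaceMeasure d Γ), pointEnergy d Γ g.1 x ≠ ⊤ := by
  have := hΓ.isLocallyFiniteMeasure hd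
  have hfin : energyH d Γ g.1 ≠ ⊤ := (integrable_slobodeckij_iff hΓ hd g.1.measurable).1 g.2
  have hm : Measurable fun q : Space n × Space n =>
      ‖g.1 q.1 - g.1 q.2‖ₑ ^ 2 * edist q.1 q.2 ^ (-(d + 1)) :=
    (((g.1.measurable.comp measurable_fst).sub
      (g.1.measurable.comp measurable_snd)).enorm.pow_const 2).mul
      ((by fun_prop : Measurable fun q : Space n × Space n => edist q.1 q.2).pow_const _)
  have hm' : Measurable (pointEnergy d Γ g.1) := hm.lintegral_prod_right'
  filter_upwards [ae_lt_top hm' hfin] with x hx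
  exact hx.ne

/-- Lebesgue points of the functions of `H`. -/
theorem tendsto_laverage_surfaceMeasure (hΓ : IsAhlforsRegular d Γ) (hd : 0 ≤ d)
    {g : Space n → ℝ} (hg : Measurable g) {x : Space n} (hx : x ∈ Γ)
    (hfin : pointEnergy d Γ g x ≠ ⊤) :
    Tendsto (fun r : ℝ => ⨍⁻ y in ball x r, ‖g y - g x‖ₑ ∂(surfaceMeasure d Γ))
      (𝓝[>] 0) (𝓝 0) := by
  obtain ⟨C, hC⟩ := hΓ.exists_le_measure_ball
  obtain ⟨C', hC'⟩ := hΓ.exists_measure_ball_le hd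
  refine tendsto_zero_of_sq_le (M := C * pointEnergy d Γ g x)
    (ENNReal.mul_ne_top (by simp) hfin) fun r hr => ?_
  have hr0 : ENNReal.ofReal r ≠ 0 := by simpa using hr
  have hr0' : ENNReal.ofReal r ^ d ≠ 0 := by
    rw [ENNReal.ofReal_rpow_of_pos hr]
    simpa using Real.rpow_pos_of_pos hr d
  have hlow := hC x hx r hr
  have h0 : surfaceMeasure d Γ (ball x r) ≠ 0 := by
    intro h
    rw [h, mul_zero] at hlow
    exact hr0' (le_zero_iff.1 hlow)
  have ht : surfaceMeasure d Γ (ball x r) ≠ ⊤ := by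
    refine ((hC' x r hr).trans_lt (ENNReal.mul_lt_top (by simp) ?_)).ne
    exact ENNReal.rpow_lt_top_of_nonneg hd ENNReal.ofReal_ne_top
  refine (sq_setLAverage_le h0 ht (hg.sub_const _).enorm.aemeasurable).trans ?_
  -- In the ball `r^(d+1) |x - y|^(-(d+1)) ≥ 1`. Division by the mass of the ball, at least a
  -- multiple of `r ^ d`, then leaves one factor `r`.
  have h1 : ∫⁻ y in ball x r, ‖g y - g x‖ₑ ^ 2 ∂(surfaceMeasure d Γ) ≤
      ENNReal.ofReal r ^ (d + 1) * pointEnergy d Γ g x := by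
    rw [pointEnergy, ← lintegral_const_mul' _ _
      (ENNReal.rpow_ne_top_of_nonneg (by linarith) ENNReal.ofReal_ne_top)]
    refine (setLIntegral_mono' measurableSet_ball fun y hy => ?_).trans
      (setLIntegral_le_lintegral _ _)
    rw [mem_ball'] at hy
    rcases eq_or_ne x y with h | h
    · simp [h]
    have h2 : (1 : ℝ≥0∞) ≤ ENNReal.ofReal r ^ (d + 1) * edist x y ^ (-(d + 1)) := by
      calc (1 : ℝ≥0∞) = edist x y ^ (d + 1) * edist x y ^ (-(d + 1)) := by
            rw [← ENNReal.rpow_add _ _ (edist_pos.2 h).ne' (edist_ne_top _ _), add_neg_cancel,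
              ENNReal.rpow_zero]
        _ ≤ _ := by
          gcongr
          rw [edist_dist]
          exact ENNReal.ofReal_le_ofReal hy.le
    calc ‖g y - g x‖ₑ ^ 2 ≤ ‖g y - g x‖ₑ ^ 2 *
          (ENNReal.ofReal r ^ (d + 1) * edist x y ^ (-(d + 1))) := le_mul_of_one_le_right zero_le h2
      _ = _ := by rw [enorm_sub_rev]; ring
  rw [ENNReal.div_le_iff h0 ht]
  calc _ ≤ ENNReal.ofReal r ^ (d + 1) * pointEnergy d Γ g x := h1
    _ = ENNReal.ofReal r ^ d * (ENNReal.ofReal r * pointEnergy d Γ g x) := by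
        rw [ENNReal.rpow_add _ _ hr0 ENNReal.ofReal_ne_top, ENNReal.rpow_one, mul_assoc]
    _ ≤ C * surfaceMeasure d Γ (ball x r) * (ENNReal.ofReal r * pointEnergy d Γ g x) := by gcongr
    _ = _ := by ring

/-- There are two regimes. If `x` is no farther from `z` than from `y`, then `dist(x, Γ) ≤ |x - z| ≤
r` supplies a factor `r`, and `|z - y| ≤ 2|x - y|` handles the remaining power. Otherwise `x` is
within `r` of `y` and `|z - y| ≤ 2r`, so the singularity `|x - y|^(-d)` remains, to be integrated
locally. -/
theorem rpow_infDist_mul_ekernel_le (hΓ : IsAhlforsRegular d Γ) (hd : 0 ≤ d)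
    (hdn : d < (n : ℝ) - 1) {x y z : Space n} {r : ℝ} (hx : x ∉ Γ) (hy : y ∈ Γ) (hz : z ∈ Γ) (hyz : z ≠ y) (hxz : x ∈ ball z r) :
    ENNReal.ofReal (infDist x Γ) ^ (2 * n - d : ℝ) * ekernel x y ≤
      (2 ^ (d + 1) * ENNReal.ofReal r + ENNReal.ofReal (2 * r) ^ (d + 1) *
        (ball y r).indicator (fun x => edist x y ^ (-d)) x) * edist z y ^ (-(d + 1)) := by
  have hr : 0 < r := dist_nonneg.trans_lt (mem_ball.1 hxz)
  have hxy' : x ≠ y := by rintro rfl; exact hx hy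
  have ha0 : edist x y ≠ 0 := (edist_pos.2 hxy').ne'
  have hat : edist x y ≠ ⊤ := edist_ne_top _ _
  have hρ0 : edist z y ≠ 0 := (edist_pos.2 hyz).ne'
  have hρt : edist z y ≠ ⊤ := edist_ne_top _ _
  have hDa := ofReal_infDist_le_edist x hy
  have hDb := ofReal_infDist_le_edist x hz
  have hbr : edist x z ≤ ENNReal.ofReal r := by
    rw [edist_dist]
    exact ENNReal.ofReal_le_ofReal (mem_ball.1 hxz).le
  have htri : edist z y ≤ edist x z + edist x y := edist_triangle_left _ _ _
  set D := ENNReal.ofReal (infDist x Γ)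
  rw [ekernel]
  rcases le_or_gt (edist x z) (edist x y) with h | h
  · have h1 : edist z y ≤ 2 * edist x y := by
      rw [two_mul]
      exact htri.trans (add_le_add h le_rfl)
    have hD0 : D ≠ 0 := by simpa [D] using infDist_pos_of_notMem hΓ hx
    have h2 : edist x y ^ (-(d + 1)) ≤ 2 ^ (d + 1) * edist z y ^ (-(d + 1)) := by
      calc edist x y ^ (-(d + 1)) = 2 ^ (d + 1) * (2 * edist x y) ^ (-(d + 1)) := by
            rw [ENNReal.mul_rpow_of_ne_top (by simp) hat, ← mul_assoc,
              ← ENNReal.rpow_add _ _ (by simp) (by simp), add_neg_cancel, ENNReal.rpow_zero,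
              one_mul]
        _ ≤ _ := by
          rw [ENNReal.rpow_neg, ENNReal.rpow_neg]
          gcongr
    calc D ^ (2 * n - d : ℝ) * edist x y ^ (-(2 * n : ℝ))
        = D * (D ^ (2 * n - d - 1 : ℝ) * edist x y ^ (-(2 * n : ℝ))) := by
          rw [← mul_assoc, show D * D ^ (2 * n - d - 1 : ℝ) = D ^ (2 * n - d : ℝ) by
            nth_rewrite 1 [← ENNReal.rpow_one D]
            rw [← ENNReal.rpow_add _ _ hD0 ENNReal.ofReal_ne_top]
            congr 1; ring]
      _ ≤ ENNReal.ofReal r * (edist x y ^ (2 * n - d - 1 : ℝ) * edist x y ^ (-(2 * n : ℝ))) := by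
          gcongr
          · exact hDb.trans hbr
          · linarith
      _ = ENNReal.ofReal r * edist x y ^ (-(d + 1)) := by
          rw [← ENNReal.rpow_add _ _ ha0 hat]
          congr 2; ring
      _ ≤ ENNReal.ofReal r * (2 ^ (d + 1) * edist z y ^ (-(d + 1))) := by gcongr
      _ = 2 ^ (d + 1) * ENNReal.ofReal r * edist z y ^ (-(d + 1)) := by ring
      _ ≤ _ := by gcongr; exact le_self_add
  · have hm : x ∈ ball y r := by
      rw [edist_dist, edist_dist, ENNReal.ofReal_lt_ofReal_iff_of_nonneg dist_nonneg] at h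
      exact h.trans hxz
    rw [indicator_of_mem hm]
    have h1 : edist z y ≤ ENNReal.ofReal (2 * r) := by
      rw [two_mul, ENNReal.ofReal_add hr.le hr.le]
      exact htri.trans (add_le_add hbr (h.le.trans hbr))
    have h2 : (1 : ℝ≥0∞) ≤ ENNReal.ofReal (2 * r) ^ (d + 1) * edist z y ^ (-(d + 1)) := by
      calc (1 : ℝ≥0∞) = edist z y ^ (d + 1) * edist z y ^ (-(d + 1)) := by
            rw [← ENNReal.rpow_add _ _ hρ0 hρt, add_neg_cancel, ENNReal.rpow_zero]
        _ ≤ _ := by gcongr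
    calc D ^ (2 * n - d : ℝ) * edist x y ^ (-(2 * n : ℝ))
        ≤ edist x y ^ (2 * n - d : ℝ) * edist x y ^ (-(2 * n : ℝ)) := by
          gcongr
          linarith
      _ = edist x y ^ (-d) := by
          rw [← ENNReal.rpow_add _ _ ha0 hat]
          congr 1; ring
      _ ≤ edist x y ^ (-d) * (ENNReal.ofReal (2 * r) ^ (d + 1) * edist z y ^ (-(d + 1))) :=
          le_mul_of_one_le_right zero_le h2
      _ = ENNReal.ofReal (2 * r) ^ (d + 1) * edist x y ^ (-d) * edist z y ^ (-(d + 1)) := by ring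
      _ ≤ _ := by gcongr; exact le_add_self

end TraceOfExtension

/-! ### The trace of the extension -/

section TraceOfExtension

variable {n : ℕ} {d : ℝ} {Γ : Set (Space n)}

/-- Both regimes of the pointwise estimate contribute `r^(n+1)`: one as `r * r^n`, the other as
`r^(d+1) * r^(n-d)`, since `|x - y|^(-d)` is locally integrable for `d < n`. -/
theorem exists_setLIntegral_rpow_infDist_mul_ekernel_le (hΓ : IsAhlforsRegular d Γ) (hd : 0 ≤ d)
    (hdn : d < (n : ℝ) - 1) :
    ∃ C : ℝ≥0, ∀ y ∈ Γ, ∀ z ∈ Γ, z ≠ y → ∀ r : ℝ, 0 < r →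
      ∫⁻ x in ball z r ∩ Γᶜ, ENNReal.ofReal (infDist x Γ) ^ (2 * n - d : ℝ) * ekernel x y ≤
        C * ENNReal.ofReal r ^ (n + 1 : ℝ) * edist z y ^ (-(d + 1)) := by
  have hn : (1 : ℝ) < n := by linarith
  obtain ⟨C', hC'⟩ := exists_lintegral_ball_le (X := Space n)
    (volume (ball (0 : Space n) 1)).toNNReal (d := n) (q := d) hd (by linarith)
  set κ := (volume (ball (0 : Space n) 1)).toNNReal with hκ
  refine ⟨2 ^ (d + 1) * (κ + C'), fun y hy z hz hzy r hr => ?_⟩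
  have hr0 : ENNReal.ofReal r ≠ 0 := by simpa using hr
  have h0 : volume {x : Space n | dist x y = 0} = 0 := by
    have : Nonempty (Fin n) := ⟨⟨0, by exact_mod_cast one_pos.trans hn⟩⟩
    simp_rw [dist_eq_zero]
    exact measure_singleton y
  have hρ : edist z y ^ (-(d + 1)) ≠ ⊤ :=
    ENNReal.rpow_ne_top_of_ne_zero (edist_pos.2 hzy).ne' (edist_ne_top _ _)
  have hR : ENNReal.ofReal (2 * r) ^ (d + 1) = 2 ^ (d + 1) * ENNReal.ofReal r ^ (d + 1) := by
    rw [ENNReal.ofReal_mul (by norm_num), ENNReal.mul_rpow_of_nonneg _ _ (by linarith)]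
    simp
  have hRt : ENNReal.ofReal (2 * r) ^ (d + 1) ≠ ⊤ :=
    ENNReal.rpow_ne_top_of_nonneg (by linarith) ENNReal.ofReal_ne_top
  have hms : MeasurableSet (ball z r ∩ Γᶜ) :=
    measurableSet_ball.inter hΓ.isClosed.measurableSet.compl
  calc _ ≤ ∫⁻ x in ball z r ∩ Γᶜ, (2 ^ (d + 1) * ENNReal.ofReal r +
          ENNReal.ofReal (2 * r) ^ (d + 1) * (ball y r).indicator (fun x => edist x y ^ (-d)) x) * edist z y ^ (-(d + 1)) :=
        setLIntegral_mono' hms fun x hx =>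
          rpow_infDist_mul_ekernel_le hΓ hd hdn hx.2 hy hz hzy hx.1
    _ = (∫⁻ x in ball z r ∩ Γᶜ, (2 ^ (d + 1) * ENNReal.ofReal r +
          ENNReal.ofReal (2 * r) ^ (d + 1) *
            (ball y r).indicator (fun x => edist x y ^ (-d)) x)) * edist z y ^ (-(d + 1)) :=
        lintegral_mul_const' _ _ hρ
    _ ≤ (2 ^ (d + 1) * ENNReal.ofReal r * volume (ball z r) + ENNReal.ofReal (2 * r) ^ (d + 1) *
          ∫⁻ x in ball y r, edist x y ^ (-d)) * edist z y ^ (-(d + 1)) := by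
        gcongr
        rw [lintegral_add_left measurable_const, lintegral_const_mul' _ _ hRt, setLIntegral_const]
        refine add_le_add (mul_le_mul_right (measure_mono inter_subset_left) _)
          (mul_le_mul_right ?_ _)
        refine (setLIntegral_le_lintegral _ _).trans (le_of_eq ?_)
        rw [lintegral_indicator measurableSet_ball]
    _ ≤ (2 ^ (d + 1) * ENNReal.ofReal r * (κ * ENNReal.ofReal r ^ (n : ℝ)) +
          ENNReal.ofReal (2 * r) ^ (d + 1) * (C' * ENNReal.ofReal r ^ (n - d : ℝ))) *
          edist z y ^ (-(d + 1)) := by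
        gcongr
        · exact volume_ball_le_rpow z hr
        · exact hC' volume y h0 (fun s hs => volume_ball_le_rpow y hs) r hr
    _ = _ := by
        have e1 : ENNReal.ofReal r ^ (n + 1 : ℝ) =
            ENNReal.ofReal r * ENNReal.ofReal r ^ (n : ℝ) := by
          rw [ENNReal.rpow_add _ _ hr0 ENNReal.ofReal_ne_top, ENNReal.rpow_one, mul_comm]
        have e2 : ENNReal.ofReal r ^ (n + 1 : ℝ) =
            ENNReal.ofReal r ^ (d + 1) * ENNReal.ofReal r ^ (n - d : ℝ) := by
          rw [← ENNReal.rpow_add _ _ hr0 ENNReal.ofReal_ne_top]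
          congr 1; ring
        push_cast
        rw [ENNReal.coe_rpow_of_nonneg _ (by linarith), hR]
        push_cast
        calc _ = (2 ^ (d + 1) * κ * (ENNReal.ofReal r * ENNReal.ofReal r ^ (n : ℝ)) +
              2 ^ (d + 1) * C' * (ENNReal.ofReal r ^ (d + 1) * ENNReal.ofReal r ^ (n - d : ℝ))) *
              edist z y ^ (-(d + 1)) := by ring
          _ = _ := by
            rw [← e1, ← e2]
            ring

/-- Cauchy–Schwarz for the normalized average with `c = g z`, the lower bound for the mass, and
Tonelli reduce this to the integral of one kernel over the ball. The exponent `n + 1` beats the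
volume of the ball by one power of `r`. -/
theorem exists_setLIntegral_extend_sub_sq_le (hΓ : IsAhlforsRegular d Γ) (hd : 0 ≤ d)
    (hdn : d < (n : ℝ) - 1) (hn : 1 ≤ n) :
    ∃ C : ℝ≥0, ∀ g : Space n → ℝ, Measurable g → Tempered d Γ g → ∀ z ∈ Γ, ∀ r : ℝ, 0 < r →
      ∫⁻ x in ball z r ∩ Γᶜ, ‖extend d Γ g x - g z‖ₑ ^ 2 ≤
        C * ENNReal.ofReal r ^ (n + 1 : ℝ) * pointEnergy d Γ g z := by
  have := hΓ.isLocallyFiniteMeasure hd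
  obtain ⟨C₁, hC₁⟩ := exists_le_kernelMass hΓ
  obtain ⟨C₂, hC₂⟩ := exists_setLIntegral_rpow_infDist_mul_ekernel_le hΓ hd hdn
  refine ⟨C₁ * C₂, fun g hgm hg z hz r hr => ?_⟩
  have hms : MeasurableSet (ball z r ∩ Γᶜ) :=
    measurableSet_ball.inter hΓ.isClosed.measurableSet.compl
  set F : Space n → Space n → ℝ≥0∞ := fun x y => ‖g y - g z‖ₑ ^ 2 *
    (ENNReal.ofReal (infDist x Γ) ^ (2 * n - d : ℝ) * ekernel x y) with hF
  have hFm : Measurable fun q : Space n × Space n => F q.1 q.2 := by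
    have h1 : Measurable fun q : Space n × Space n => ‖g q.2 - g z‖ₑ ^ 2 :=
      ((hgm.comp measurable_snd).sub_const _).enorm.pow_const 2
    have h2 : Measurable fun q : Space n × Space n =>
        ENNReal.ofReal (infDist q.1 Γ) ^ (2 * n - d : ℝ) :=
      ((continuous_infDist_pt Γ).measurable.comp measurable_fst).ennreal_ofReal.pow_const _
    exact h1.mul (h2.mul measurable_ekernel)
  have hpt : ∀ x ∈ ball z r ∩ Γᶜ, ‖extend d Γ g x - g z‖ₑ ^ 2 ≤
      C₁ * ∫⁻ y, F x y ∂(surfaceMeasure d Γ) := by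
    intro x hx
    have h1 := enorm_extend_sub_sq_mul_le hΓ hd hdn hn hgm hg (g z) hx.2
    have h2 := hC₁ x hx.2
    set D := ENNReal.ofReal (infDist x Γ) with hD
    have hD0 : D ≠ 0 := by simpa [hD] using infDist_pos_of_notMem hΓ hx.2
    have hDt : D ≠ ⊤ := ENNReal.ofReal_ne_top
    have hDp : D ^ (2 * n - d : ℝ) ≠ ⊤ := ENNReal.rpow_ne_top_of_ne_zero hD0 hDt
    have h3 : (1 : ℝ≥0∞) ≤ C₁ * kernelMass d Γ x * D ^ (2 * n - d : ℝ) := by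
      calc (1 : ℝ≥0∞) = D ^ (d - 2 * n : ℝ) * D ^ (2 * n - d : ℝ) := by
            rw [← ENNReal.rpow_add _ _ hD0 hDt, sub_add_sub_cancel, sub_self, ENNReal.rpow_zero]
        _ ≤ _ := by gcongr
    calc ‖extend d Γ g x - g z‖ₑ ^ 2
        ≤ ‖extend d Γ g x - g z‖ₑ ^ 2 * (C₁ * kernelMass d Γ x * D ^ (2 * n - d : ℝ)) :=
          le_mul_of_one_le_right zero_le h3
      _ = C₁ * (D ^ (2 * n - d : ℝ) * (‖extend d Γ g x - g z‖ₑ ^ 2 * kernelMass d Γ x)) := by ring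
      _ ≤ C₁ * (D ^ (2 * n - d : ℝ) *
          ∫⁻ y, ‖g y - g z‖ₑ ^ 2 * ekernel x y ∂(surfaceMeasure d Γ)) := by gcongr
      _ = _ := by
        rw [← lintegral_const_mul' _ _ hDp]
        simp only [hF]
        congr 1
        refine lintegral_congr fun y => ?_
        ring
  calc _ ≤ ∫⁻ x in ball z r ∩ Γᶜ, C₁ * ∫⁻ y, F x y ∂(surfaceMeasure d Γ) :=
        setLIntegral_mono' hms hpt
    _ = C₁ * ∫⁻ y, (∫⁻ x in ball z r ∩ Γᶜ, F x y) ∂(surfaceMeasure d Γ) := by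
        rw [lintegral_const_mul' _ _ (by simp), lintegral_lintegral_swap hFm.aemeasurable]
    _ ≤ C₁ * ∫⁻ y, C₂ * ENNReal.ofReal r ^ (n + 1 : ℝ) *
          (‖g z - g y‖ₑ ^ 2 * edist z y ^ (-(d + 1))) ∂(surfaceMeasure d Γ) := by
        refine mul_le_mul_right (lintegral_mono_ae ?_) _
        filter_upwards [hΓ.ae_mem] with y hy
        rcases eq_or_ne z y with h | h
        · simp [hF, h]
        · simp only [hF]
          rw [lintegral_const_mul' _ _ (by simp), enorm_sub_rev, mul_left_comm]
          exact mul_le_mul_right (hC₂ y hy z hz h r hr) _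
    _ = _ := by
        rw [lintegral_const_mul' _ _ (ENNReal.mul_ne_top (by simp)
          (ENNReal.rpow_ne_top_of_nonneg (by positivity) ENNReal.ofReal_ne_top)), ← pointEnergy]
        push_cast
        ring

/-- The trace of the extension of `g` is `g`. -/
theorem isLebesgueValue_extend (hΓ : IsAhlforsRegular d Γ) (hd : 0 ≤ d) (hdn : d < (n : ℝ) - 1)
    {g : Space n → ℝ} (hgm : Measurable g) (hg : Tempered d Γ g) {z : Space n} (hz : z ∈ Γ)
    (hfin : pointEnergy d Γ g z ≠ ⊤) : IsLebesgueValue (extend d Γ g) z (g z) := by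
  have hn : 1 ≤ n := by
    have : (1 : ℝ) < n := by linarith
    exact_mod_cast this.le
  obtain ⟨C, hC⟩ := exists_setLIntegral_extend_sub_sq_le hΓ hd hdn hn
  set κ := volume (ball (0 : Space n) 1) with hκ
  have hκ0 : κ ≠ 0 := volume_ball_ne_zero 0 one_pos
  have hκt : κ ≠ ⊤ := measure_ball_lt_top.ne
  have hΓ0 : ∀ᵐ x : Space n, x ∈ Γᶜ :=
    measure_eq_zero_iff_ae_notMem.1 (hΓ.volume_eq_zero hd hdn)
  refine tendsto_zero_of_sq_le (M := C * pointEnergy d Γ g z / κ)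
    (ENNReal.div_ne_top (ENNReal.mul_ne_top (by simp) hfin) hκ0) fun r hr => ?_
  have hr0 : ENNReal.ofReal r ≠ 0 := by simpa using hr
  have hb0 := volume_ball_ne_zero z hr
  refine (sq_setLAverage_le hb0 measure_ball_lt_top.ne
    ((measurable_extend hΓ hd hgm).sub_const _).enorm.aemeasurable).trans ?_
  rw [ENNReal.div_le_iff hb0 measure_ball_lt_top.ne]
  have e : (volume : Measure (Space n)).restrict (ball z r ∩ Γᶜ) = volume.restrict (ball z r) := by
    rw [inter_comm, ← Measure.restrict_restrict hΓ.isClosed.measurableSet.compl]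
    exact Measure.restrict_eq_self_of_ae_mem (ae_restrict_of_ae hΓ0)
  have h := hC g hgm hg z hz r hr
  rw [e] at h
  refine h.trans (le_of_eq ?_)
  rw [volume_ball_eq z hr, ← hκ, ENNReal.rpow_add _ _ hr0 ENNReal.ofReal_ne_top, ENNReal.rpow_one,
    ENNReal.rpow_natCast, ENNReal.ofReal_pow hr.le]
  calc _ = ENNReal.ofReal r * (C * pointEnergy d Γ g z) * ENNReal.ofReal r ^ n := by ring
    _ = ENNReal.ofReal r * (C * pointEnergy d Γ g z / κ * κ) * ENNReal.ofReal r ^ n := by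
        rw [ENNReal.div_mul_cancel hκ0 hκt]
    _ = _ := by ring

end TraceOfExtension
end HigherCodim

end

/-! ### Assembly of the operators -/

theorem mainTheorem6 (n : ℕ) (d : ℝ) (hd : 0 ≤ d) (hdn : d < (n : ℝ) - 1)
    (Γ : Set (HigherCodim.Space n)) (hΓ : HigherCodim.IsAhlforsRegular d Γ) :
    ∃ (T : HigherCodim.spaceW d Γ →ₗ[ℝ] HigherCodim.spaceH d Γ)
      (E : HigherCodim.spaceH d Γ →ₗ[ℝ] HigherCodim.spaceW d Γ),
      -- `T` and `E` are bounded
      (∃ C : ℝ, ∀ u : HigherCodim.spaceW d Γ,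
        HigherCodim.normH d Γ (T u).1 ≤ C * HigherCodim.normW d Γ u.1) ∧
      (∃ C : ℝ, ∀ g : HigherCodim.spaceH d Γ,
        HigherCodim.normW d Γ (E g).1 ≤ C * HigherCodim.normH d Γ g.1) ∧
      -- `T ∘ E` is the identity of `H`
      T ∘ₗ E = LinearMap.id ∧
      -- `T u` is the limit of the averages of `u` on balls, in the Lebesgue sense
      (∀ u : HigherCodim.spaceW d Γ, ∀ᵐ x ∂(HigherCodim.surfaceMeasure d Γ),
        (∀ᶠ r in 𝓝[>] (0 : ℝ), IntegrableOn (u.1 : HigherCodim.Space n → ℝ) (ball x r) volume) ∧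
        Tendsto (fun r : ℝ => ⨍ y in ball x r, u.1 y ∂volume) (𝓝[>] 0) (𝓝 ((T u).1 x)) ∧
        Tendsto (fun r : ℝ => ⨍⁻ y in ball x r, ‖u.1 y - (T u).1 x‖ₑ ∂volume) (𝓝[>] 0) (𝓝 0)) ∧
      -- Lebesgue density property for the functions of `H`
      (∀ g : HigherCodim.spaceH d Γ, ∀ᵐ x ∂(HigherCodim.surfaceMeasure d Γ),
        Tendsto (fun r : ℝ => ⨍⁻ y in ball x r, ‖g.1 y - g.1 x‖ₑ ∂(HigherCodim.surfaceMeasure d Γ))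
          (𝓝[>] 0) (𝓝 0)) := by
  -- `Γ` is Lebesgue null, so classes modulo equality almost everywhere in `Ω` have well-defined
  -- averages on all balls.
  have hres : (volume : Measure (HigherCodim.Space n)).restrict Γᶜ = volume :=
    Measure.restrict_eq_self_of_ae_mem
      (measure_eq_zero_iff_ae_notMem.1 (hΓ.volume_eq_zero hd hdn))
  have toVol : ∀ {f k : HigherCodim.Space n → ℝ}, f =ᵐ[volume.restrict Γᶜ] k →
      f =ᵐ[volume] k := fun h => by rwa [hres] at h
  obtain ⟨C, hC⟩ := HigherCodim.exists_trace hΓ hd hdn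
  obtain ⟨E, hE, hEb⟩ := HigherCodim.exists_extension hΓ hd hdn
  choose τ hτ hτb using hC
  have hval : ∀ u : HigherCodim.spaceW d Γ, ∀ᵐ x ∂(HigherCodim.surfaceMeasure d Γ),
      HigherCodim.IsLebesgueValue u.1 x ((τ u).1 x) := fun u => (hτ u).mono fun x hx => hx.2.2
  -- The traces `τ u` are chosen one `u` at a time; linearity follows because Lebesgue values are
  -- unique and respect sums and multiples.
  let T : HigherCodim.spaceW d Γ →ₗ[ℝ] HigherCodim.spaceH d Γ :=
    { toFun := τ
      map_add' := fun u v => by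
        refine Subtype.ext (AEEqFun.ext ?_)
        refine EventuallyEq.trans ?_ (AEEqFun.coeFn_add _ _).symm
        filter_upwards [hval u, hval v, hval (u + v)] with x hu hv huv
        exact huv.unique (u + v).1.measurable ((hu.add u.1.measurable hv).congr
          (toVol (AEEqFun.coeFn_add u.1 v.1)).symm)
      map_smul' := fun c u => by
        refine Subtype.ext (AEEqFun.ext ?_)
        refine EventuallyEq.trans ?_ (AEEqFun.coeFn_smul _ _).symm
        filter_upwards [hval u, hval (c • u)] with x hu hcu
        exact hcu.unique (c • u).1.measurable ((hu.smul c).congr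
          (toVol (AEEqFun.coeFn_smul c u.1)).symm) }
  refine ⟨T, E, ⟨C, hτb⟩, hEb, LinearMap.ext fun g => Subtype.ext (AEEqFun.ext ?_),
    fun u => ?_, fun g => ?_⟩
  -- At almost every point both `T (E g)` and `g` are Lebesgue values of the same function.
  · filter_upwards [hval (E g), hΓ.ae_mem, HigherCodim.ae_pointEnergy_ne_top hΓ hd g]
      with x hx hxΓ hfin
    exact hx.unique (E g).1.measurable ((HigherCodim.isLebesgueValue_extend hΓ hd hdn
      g.1.measurable (HigherCodim.tempered_of_mem_spaceH hΓ hd hdn g) hxΓ hfin).congr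
      (toVol (hE g)).symm)
  · filter_upwards [hτ u] with x hx
    refine ⟨?_, hx.2⟩
    filter_upwards [self_mem_nhdsWithin] with r hr
    exact hx.1 r hr
  · filter_upwards [hΓ.ae_mem, HigherCodim.ae_pointEnergy_ne_top hΓ hd g] with x hx hfin
    exact HigherCodim.tendsto_laverage_surfaceMeasure hΓ hd g.1.measurable hx hfin
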